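/- Let $k$ be a field and $\Lambda$ an arbitrary finite-dimensional $k$-algebra. Let $\mathrm{mod}\,\Lambda$ be the category of finitely generated left $\Lambda$-modules, and let $$\mathcal U=\mathrm{add}\{A[i]\mid A\in\mathrm{mod}\,\Lambda,\ i\in\mathbb Z\}$$ be the Yoneda category of $\Lambda$, i.e. the full subcategory of the derived category of $\mathrm{mod}\,\Lambda$ consisting of direct summands of finite direct sums of shifts of modules. A $\mathcal U$-module is an additive functor $\mathcal U^{\mathrm{op}}\to\mathrm{Ab}$. It is finitely presented if it is the cokernel of a morphism of representable modules $\mathcal U(-,B)\to\mathcal U(-,A)$, and Cohen–Macaulay if it is moreover such that $\mathrm{Ext}^i_{\mathcal U}(X,\mathcal U(-,A))=0$ for all $A\in\mathcal U$ and $i>0$. Let $\underline{\mathrm{CM}}\,\mathcal U$ be the stable category of Cohen–Macaulay $\mathcal U$-modules (morphisms modulo those factoring through projective modules), with Happel's triangulated structure: the suspension $X[1]$ is the cokernel of an inclusion $X\to P$ with $P$ projective and $P/X$ Cohen–Macaulay, and the triangles are those isomorphic to the ones induced by short exact sequences of Cohen–Macaulay modules. For $A\in\mathrm{mod}\,\Lambda$,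 let $\mathcal U_0(-,A)$ be the $\mathcal U$-module which sends $\bigoplus_i B_i[-i]$, $B_i\in\mathrm{mod}\,\Lambda$, to $\mathrm{Hom}_\Lambda(B_0,A)$; in other words $\mathcal U_0(-,A)=\mathrm{Hom}_\Lambda(H^0(-),A)$. Then the stable category $\underline{\mathrm{CM}}\,\mathcal U$ with this structure is indeed a triangulated category, each $\mathcal U_0(-,A)$ is Cohen–Macaulay, and the full subcategories $$t^{\le 0}=\{X\in\underline{\mathrm{CM}}\,\mathcal U\mid \underline{\mathrm{Hom}}_{\mathcal U}(X,\mathcal U_0(-,A)[i])=0\ \text{for all } A\in\mathrm{mod}\,\Lambda \text{ and } i<0\},$$ $$t^{\ge 0}=\{X\in\underline{\mathrm{CM}}\,\mathcal U\mid \underline{\mathrm{Hom}}_{\mathcal U}(X,\mathcal U_0(-,A)[i])=0\ \text{for all } A\in\mathrm{mod}\,\Lambda \text{ and } i>0\}$$ form a t-structure on $\underline{\mathrm{CM}}\,\mathcal U$. This t-structure is bounded, and its heart $t^{\le 0}\cap t^{\ge 0}$ is equivalent to $\mathrm{mod}(\underline{\mathrm{mod}}\,\Lambda)$, the category of finitely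 presented contravariant additive functors to $\mathrm{Ab}$ on the stable category $\underline{\mathrm{mod}}\,\Lambda$ of $\mathrm{mod}\,\Lambda$ modulo morphisms factoring through projective modules. -/

import Mathlib

open CategoryTheory Limits Pretriangulated ZeroObject

universe w v u

noncomputable section

namespace YonedaTStructure

/-! ### Modules over a preadditive category -/

section Modules

variable (C : Type u) [Category.{v} C] [Preadditive C]

instance additiveFunctor_isClosedUnderSubobjects :
    (additiveFunctor Cᵒᵖ AddCommGrpCat.{v}).IsClosedUnderSubobjects where
  prop_of_mono {X Y} f _ hY := by
    have : Y.Additive := hY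
    refine (additiveFunctor_iff X).2 ⟨fun {A B a b} => ?_⟩
    rw [← cancel_mono (f.app B)]
    simp [Functor.map_add]

instance additiveFunctor_isClosedUnderQuotients :
    (additiveFunctor Cᵒᵖ AddCommGrpCat.{v}).IsClosedUnderQuotients where
  prop_of_epi {X Y} f _ hX := by
    have : X.Additive := hX
    refine (additiveFunctor_iff Y).2 ⟨fun {A B a b} => ?_⟩
    rw [← cancel_epi (f.app A)]
    simp only [Preadditive.comp_add, ← NatTrans.naturality, Functor.map_add, Preadditive.add_comp]

instance additiveFunctor_isClosedUnderFiniteProducts :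
    (additiveFunctor Cᵒᵖ AddCommGrpCat.{v}).IsClosedUnderFiniteProducts where
  isClosedUnderLimitsOfShape J _ := ⟨by
    rintro X ⟨p⟩
    refine (additiveFunctor_iff X).2 ⟨fun {A B a b} => ?_⟩
    refine (isLimitOfPreserves ((evaluation _ _).obj B) p.isLimit).hom_ext fun j => ?_
    have : (p.diag.obj j).Additive := p.prop_diag_obj j
    have h (c : A ⟶ B) : X.map c ≫ (p.π.app j).app B = (p.π.app j).app A ≫ (p.diag.obj j).map c :=
      (p.π.app j).naturality c
    change X.map (a + b) ≫ (p.π.app j).app B = (X.map a + X.map b) ≫ (p.π.app j).app B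
    rw [Preadditive.add_comp, h, h, h, Functor.map_add, Preadditive.comp_add]⟩

instance additiveFunctor_containsZero :
    (additiveFunctor Cᵒᵖ AddCommGrpCat.{v}).ContainsZero where
  exists_zero := ⟨0, isZero_zero _, (additiveFunctor_iff _).2
    ⟨fun {A _ _ _} => ((isZero_zero (Cᵒᵖ ⥤ AddCommGrpCat.{v})).obj A).eq_of_src _ _⟩⟩

/-- The category `Mod C` of all modules over a preadditive category `C`: contravariant additive
functors from `C` to abelian groups. It is an abelian category. -/
abbrev Mod : Type (max u (v + 1)) := Cᵒᵖ ⥤+ AddCommGrpCat.{v}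

instance : Abelian (Mod C) := inferInstance

variable {C}

/-- The representable module `C(-, A)`. -/
def representable (A : C) : Mod C :=
  AdditiveFunctor.of (preadditiveYoneda.obj A)

variable (C)

/-- A module `X` is finitely presented if there is an exact sequence
`C(-, B) ⟶ C(-, A) ⟶ X ⟶ 0`. -/
def finitelyPresented : ObjectProperty (Mod C) := fun X =>
  ∃ (A B : C) (f : representable B ⟶ representable A) (p : representable A ⟶ X) (h : f ≫ p = 0),
    (ShortComplex.mk f p h).Exact ∧ Epi p

/-- The category `mod C` of finitely presented modules over `C`. -/
abbrev FPMod := (finitelyPresented C).FullSubcategory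

/-- A module `X` is Cohen-Macaulay if it is finitely presented and `Ext^i(X, C(-, A)) = 0` for all
`A` in `C` and all `i > 0`, where `Ext` is taken in the abelian category `Mod C`. -/
def cohenMacaulay : ObjectProperty (Mod C) := fun X =>
  finitelyPresented C X ∧
    ∀ (A : C) (i : ℕ), 0 < i →
      haveI := HasExt.standard (Mod C)
      Subsingleton (Abelian.Ext X (representable A) i)

instance [HasZeroObject C] : (cohenMacaulay C).ContainsZero where
  exists_zero := by
    refine ⟨0, isZero_zero _, ⟨0, 0, 𝟙 _, 0, by simp, ?_, ?_⟩, fun A i _ => ?_⟩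
    · rw [ShortComplex.exact_iff_epi _ (by simp)]
      dsimp
      infer_instance
    · exact ⟨fun _ _ _ => (isZero_zero (Mod C)).eq_of_src _ _⟩
    · have := HasExt.standard (Mod C)
      refine ⟨fun a b => ?_⟩
      exact (Abelian.Ext.eq_zero_of_hasProjectiveDimensionLT _ 0 (by omega)).trans
        (Abelian.Ext.eq_zero_of_hasProjectiveDimensionLT _ 0 (by omega)).symm

end Modules

/-! ### Stable categories -/

section Stable

variable {A : Type u} [Category.{v} A] [Abelian A] (Q : ObjectProperty A)

/-- Two morphisms between objects satisfying `Q` are identified in the stable category if their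
difference factors through a projective object. -/
def stableRel : HomRel Q.FullSubcategory := fun X Y f g =>
  ∃ (P : A) (_ : Projective P) (a : X.obj ⟶ P) (b : P ⟶ Y.obj), a ≫ b = f.hom - g.hom

lemma stableRel_add {X Y : Q.FullSubcategory} (f₁ f₂ g₁ g₂ : X ⟶ Y)
    (h₁ : stableRel Q f₁ f₂) (h₂ : stableRel Q g₁ g₂) : stableRel Q (f₁ + g₁) (f₂ + g₂) := by
  obtain ⟨P, _, a, b, h⟩ := h₁
  obtain ⟨P', _, a', b', h'⟩ := h₂
  refine ⟨P ⊞ P', inferInstance, biprod.lift a a', biprod.desc b b', ?_⟩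
  rw [biprod.lift_desc, h, h']
  change _ = (f₁.hom + g₁.hom) - (f₂.hom + g₂.hom)
  abel

instance : Congruence (stableRel Q) where
  equivalence :=
    { refl f := ⟨0, inferInstance, 0, 0, by simp⟩
      symm := by
        rintro f g ⟨P, hP, a, b, h⟩
        exact ⟨P, hP, -a, b, by simp [h]⟩
      trans := by
        intro f g k h₁ h₂
        obtain ⟨P, hP, a, b, h⟩ := stableRel_add Q _ _ _ _ h₁ h₂
        refine ⟨P, hP, a, b, ?_⟩
        rw [h]
        change (f.hom + g.hom) - (g.hom + k.hom) = f.hom - k.hom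
        abel }
  comp_left := by
    rintro X Y Z f g g' ⟨P, hP, a, b, h⟩
    exact ⟨P, hP, f.hom ≫ a, b, by simp [h]⟩
  comp_right := by
    rintro X Y Z f f' g ⟨P, hP, a, b, h⟩
    exact ⟨P, hP, a, b ≫ g.hom, by simp [reassoc_of% h]⟩

/-- The stable category of the full subcategory of objects satisfying `Q`: same objects, and
morphisms modulo those that factor through a projective object. -/
def Stable : Type u := Quotient (stableRel Q)

instance : Category.{v} (Stable Q) := inferInstanceAs (Category (Quotient (stableRel Q)))

instance : Preadditive (Stable Q) :=
  Quotient.preadditive (stableRel Q) fun _ _ => stableRel_add Q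

/-- The canonical functor to the stable category. -/
def toStable : Q.FullSubcategory ⥤ Stable Q := Quotient.functor (stableRel Q)

instance : (toStable Q).Additive :=
  Quotient.functor_additive (stableRel Q) fun _ _ => stableRel_add Q

instance [Q.ContainsZero] : HasZeroObject (Stable Q) :=
  (toStable Q).hasZeroObject_of_additive

variable {Q}

/-- A conflation: a short exact sequence of `A` all of whose terms satisfy `Q`. -/
def IsConflation (S : ShortComplex Q.FullSubcategory) : Prop := (S.map Q.ι).ShortExact

/-- A conflation `X ⟶ P ⟶ X'` with projective middle term `P`; then `X'` is a model of the
suspension of `X` in the stable category (and `X` is a syzygy of `X'`). -/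
structure IsProjConflation (S : ShortComplex Q.FullSubcategory) : Prop where
  isConflation : IsConflation S
  projective : Projective S.X₂.obj

variable (Q)

/-- The shift and the distinguished triangles on the stable category are those which Happel
defines on the stable category of a Frobenius category. Every object is the first term, and every
object is the third term, of a conflation with projective middle term. The suspension of `X` is the
third term of a conflation `X ⟶ P ⟶ X'` with `P` projective, functorially in the conflation. A
triangle is distinguished if and only if it is isomorphic to some `X ⟶ Y ⟶ Z ⟶ X⟦1⟧` which comes
from a conflation `X ⟶ Y ⟶ Z`, where `Z ⟶ X' ≅ X⟦1⟧` is the map on third terms of a morphism from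
`X ⟶ Y ⟶ Z` to a conflation `X ⟶ P ⟶ X'` with `P` projective which identifies the first terms.
(Whether a sign is put on `Z ⟶ X'` does not matter, as `σ` may be replaced by `-σ`.) -/
structure IsHappelTriangulation [Q.ContainsZero] [HasShift (Stable Q) ℤ]
    [∀ n : ℤ, (shiftFunctor (Stable Q) n).Additive] [Pretriangulated (Stable Q)] : Prop where
  exists_suspension (X : Q.FullSubcategory) :
    ∃ S : ShortComplex Q.FullSubcategory, IsProjConflation S ∧ S.X₁ = X
  exists_syzygy (X : Q.FullSubcategory) :
    ∃ S : ShortComplex Q.FullSubcategory, IsProjConflation S ∧ S.X₃ = X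
  exists_iso :
    ∃ σ : ∀ S : ShortComplex Q.FullSubcategory, IsProjConflation S →
        ((toStable Q).obj S.X₃ ≅ ((toStable Q).obj S.X₁)⟦(1 : ℤ)⟧),
      (∀ (S S' : ShortComplex Q.FullSubcategory) (hS : IsProjConflation S)
          (hS' : IsProjConflation S') (φ : S ⟶ S'),
        (toStable Q).map φ.τ₃ ≫ (σ S' hS').hom =
          (σ S hS).hom ≫ ((toStable Q).map φ.τ₁)⟦(1 : ℤ)⟧') ∧
      ∀ T : Triangle (Stable Q), T ∈ distTriang (Stable Q) ↔
        ∃ (S S' : ShortComplex Q.FullSubcategory) (_ : IsConflation S) (hS' : IsProjConflation S')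
          (φ : S ⟶ S') (_ : IsIso φ.τ₁),
          Nonempty (T ≅ Triangle.mk ((toStable Q).map S.f) ((toStable Q).map S.g)
            ((toStable Q).map φ.τ₃ ≫ (σ S' hS').hom ≫ ((toStable Q).map (inv φ.τ₁))⟦(1 : ℤ)⟧'))

end Stable

/-- The stable category of Cohen-Macaulay modules over `C`. -/
abbrev StableCM (C : Type u) [Category.{v} C] [Preadditive C] := Stable (cohenMacaulay C)

/-! ### The Yoneda category -/

section Yoneda

variable (M : Type u) [Category.{v} M] [Abelian M] [HasDerivedCategory.{w} M]

/-- The objects of `add { A[i] | A ∈ M, i ∈ ℤ }`: the direct summands of finite direct sums of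
shifts of objects of `M` in the derived category of `M`. (All of these are bounded complexes.) -/
def yonedaProp : ObjectProperty (DerivedCategory M) := fun X =>
  ∃ (n : ℕ) (B : Fin n → M) (i : Fin n → ℤ),
    Nonempty (Retract X (⨁ fun j => ((DerivedCategory.singleFunctor M 0).obj (B j))⟦i j⟧))

instance : (yonedaProp M).ContainsZero where
  exists_zero := ⟨0, isZero_zero _, 0, Fin.elim0, Fin.elim0,
    ⟨⟨0, 0, (isZero_zero (DerivedCategory M)).eq_of_src _ _⟩⟩⟩

/-- The Yoneda category `U` of `M`, a full subcategory of the derived category of `M`. -/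
abbrev YonedaCat := (yonedaProp M).FullSubcategory

variable {M}

/-- The `U`-module `U₀(-, A)` for `A` in `M`. As a functor it is `X ↦ Hom(H⁰ X, A)`; here `M` is identified
with the full subcategory of complexes concentrated in degree `0`. So it takes `B[0]` to
`Hom_M(B, A)` and `B[i]` to `0` for `i ≠ 0`, and a morphism of `U` acts through its component
of degree `0`. -/
def degreeZeroModule (A : M) : Mod (YonedaCat M) :=
  AdditiveFunctor.of
    (((yonedaProp M).ι ⋙ DerivedCategory.homologyFunctor M 0 ⋙
        DerivedCategory.singleFunctor M 0).op ⋙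
      preadditiveYoneda.obj ((DerivedCategory.singleFunctor M 0).obj A))

end Yoneda

end YonedaTStructure

end

open YonedaTStructure

noncomputable section

namespace YonedaTStructure

/-! ### Transport of a triangulated structure along a fully faithful functor -/

section

variable {T : Type*} [Category* T] [HasShift T ℤ] [Preadditive T] [HasZeroObject T]
  [∀ n : ℤ, (shiftFunctor T n).Additive] [Pretriangulated T]

/-! Let `M` be an abelian category with enough injectives and `U` its Yoneda category; for finitely
generated modules over Λ, enough injectives come from the embeddings of A into Hom_k(Λ, A). The
proof describes Cohen-Macaulay modules as the images of U(-, K) → U(-, E) for distinguished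
triangles K → E → N → K[1] whose three terms lie in `U` (`TrianglePresentation`). Rotating the
triangle both ways gives a complete projective resolution that stays exact under Hom into
representables, so such images are Cohen-Macaulay. Conversely, let X be the cokernel of U(-, B) →
U(-, A) with Ext¹(X, U(-, W)) = 0 for all W. Then a map from the cocone Z of B → A to an object of
`U` is zero once it kills all maps from `U` to Z (`eq_zero_of_ghost`). Comparison with injectives
then splits Z into its shifted homology objects, so Z lies in `U` (`yonedaProp_of_ghost`).

Hence Cohen-Macaulay modules form a Frobenius category (`isFrobenius_yoneda`). The stable category
of a Frobenius subcategory embeds fully faithfully in the Verdier quotient of the derived category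
by the objects that are eventually orthogonal to the subcategory. Its image is closed under shifts
and cones, so the triangulation can be pulled back (`exists_isHappelTriangulation`). On
presentations, suspension is rotation.

For the t-structure, objects of `U` split into truncations. Truncating K → E to nonpositive degrees
gives a submodule presented in degrees ≤ 0, whose quotient is presented by a triangle with K in
degrees ≥ 1 and E, N in degrees ≥ 0 (`TrianglePresentation.exists_truncation`). Stable maps between
the two kinds vanish for degree reasons. To match this with orthogonality to the modules U₀(-,
A)[i], one shows that an object orthogonal to all of them is zero: orthogonality lets the lowest
part of K be split off, and rotation then shortens the triangle (`isZero_of_bounded_presentation`).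

Objects of the heart are presented by triangles in degree zero, that is, by short exact sequences K
→ E → N of `M`. Their double suspension is the cokernel of U(-, E) → U(-, N). Morphisms between such
cokernels, and between the corresponding cokernels over the stable category of `M`, are governed by
the same maps N → N' modulo those factoring through E' → N'. The structure `Bridge` records this. -/

lemma distinguished_of_iso {X Y Z X' Y' Z' : T} {f : X ⟶ Y} {g : Y ⟶ Z} {h : Z ⟶ X⟦(1 : ℤ)⟧}
    (H : Triangle.mk f g h ∈ distTriang T) (f' : X' ⟶ Y') (g' : Y' ⟶ Z') (h' : Z' ⟶ X'⟦(1 : ℤ)⟧)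
    (e₁ : X' ≅ X) (e₂ : Y' ≅ Y) (e₃ : Z' ≅ Z) (c₁ : f' ≫ e₂.hom = e₁.hom ≫ f)
    (c₂ : g' ≫ e₃.hom = e₂.hom ≫ g) (c₃ : h' ≫ e₁.hom⟦(1 : ℤ)⟧' = e₃.hom ≫ h) :
    Triangle.mk f' g' h' ∈ distTriang T :=
  isomorphic_distinguished _ H _ (Triangle.isoMk _ _ e₁ e₂ e₃ c₁ c₂ c₃)

variable {X Y Z : T} {f : X ⟶ Y} {g : Y ⟶ Z} {h : Z ⟶ X⟦(1 : ℤ)⟧}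
  (H : Triangle.mk f g h ∈ distTriang T) {W : T}

include H

lemma exists_lift_mor₁ (a : W ⟶ Y) (ha : a ≫ g = 0) : ∃ b : W ⟶ X, a = b ≫ f :=
  Triangle.coyoneda_exact₂ _ H a ha

lemma exists_lift_mor₂ (a : W ⟶ Z) (ha : a ≫ h = 0) : ∃ b : W ⟶ Y, a = b ≫ g :=
  Triangle.coyoneda_exact₃ _ H a ha

lemma exists_desc_mor₂ (a : Y ⟶ W) (ha : f ≫ a = 0) : ∃ b : Z ⟶ W, a = g ≫ b :=
  Triangle.yoneda_exact₂ _ H a ha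

lemma exists_desc_mor₃ (a : Z ⟶ W) (ha : g ≫ a = 0) : ∃ b : X⟦(1 : ℤ)⟧ ⟶ W, a = h ≫ b :=
  Triangle.yoneda_exact₃ _ H a ha

lemma exists_desc_mor₁ (a : X ⟶ W) (ha : h ≫ a⟦(1 : ℤ)⟧' = 0) : ∃ b : Y ⟶ W, a = f ≫ b := by
  obtain ⟨b, hb⟩ : ∃ b : Y⟦(1 : ℤ)⟧ ⟶ W⟦(1 : ℤ)⟧, a⟦(1 : ℤ)⟧' = (-f⟦(1 : ℤ)⟧') ≫ b :=
    Triangle.yoneda_exact₃ _ (rot_of_distTriang _ H) _ ha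
  obtain ⟨b, rfl⟩ := (shiftFunctor T (1 : ℤ)).map_surjective b
  -- The sign cancels the one in the rotated triangle, whose last morphism is `-f⟦1⟧'`.
  refine ⟨-b, (shiftFunctor T (1 : ℤ)).map_injective ?_⟩
  simp [hb]

lemma comp_mor₁_mor₂ : f ≫ g = 0 := comp_distTriang_mor_zero₁₂ _ H

lemma comp_mor₂_mor₃ : g ≫ h = 0 := comp_distTriang_mor_zero₂₃ _ H

lemma comp_mor₃_mor₁ : h ≫ f⟦(1 : ℤ)⟧' = 0 := comp_distTriang_mor_zero₃₁ _ H

/-- Shifting a triangle by `n` multiplies all three morphisms by (-1)ⁿ. Rescaling the middle term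
removes the sign from the first two and leaves it on the third. -/
lemma shift_distinguished (n : ℤ) : Triangle.mk (f⟦n⟧') (g⟦n⟧') (n.negOnePow •
    h⟦n⟧' ≫ (shiftFunctorComm T 1 n).hom.app X) ∈ distTriang T := by
  have hn := Int.units_mul_self n.negOnePow
  refine distinguished_of_iso (f := n.negOnePow • f⟦n⟧') (g := n.negOnePow • g⟦n⟧')
    (h := n.negOnePow • h⟦n⟧' ≫ (shiftFunctorComm T 1 n).hom.app X)
    (Triangle.shift_distinguished _ H n) _ _ _
    (Iso.refl _) (n.negOnePow • Iso.refl _) (Iso.refl _) ?_ ?_ ?_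
  · simp [Linear.comp_units_smul]
  · simp [Linear.units_smul_comp, smul_smul, hn, Linear.comp_units_smul]
  · simp

end

section Transport

variable {E : Type*} [Category* E] {T : Type*} [Category* T] (G : E ⥤ T) [G.Full] [G.Faithful]

/-- An endofunctor of `E` lifting `G ⋙ F` along the fully faithful functor `G`. -/
def liftAlong (F : T ⥤ T) (h : ∀ X, G.essImage (F.obj (G.obj X))) : E ⥤ E :=
  G.essImage.lift (G ⋙ F) h ⋙ G.toEssImage.inv

def liftAlongIso (F : T ⥤ T) (h : ∀ X, G.essImage (F.obj (G.obj X))) :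
    liftAlong G F h ⋙ G ≅ G ⋙ F :=
  Functor.isoWhiskerLeft (G.essImage.lift (G ⋙ F) h)
    (Functor.isoWhiskerLeft G.toEssImage.inv G.toEssImageCompι.symm ≪≫
      (Functor.associator _ _ _).symm ≪≫
      Functor.isoWhiskerRight G.toEssImage.asEquivalence.counitIso G.essImage.ι ≪≫
      Functor.leftUnitor _) ≪≫ G.essImage.liftCompιIso _ _

variable [HasShift T ℤ] (h : ∀ X (n : ℤ), G.essImage ((G.obj X)⟦n⟧))

@[reducible]
def hasShiftOfEssImage : HasShift E ℤ :=
  (Functor.FullyFaithful.ofFullyFaithful G).hasShift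
    (fun n => liftAlong G (shiftFunctor T n) (fun X => h X n))
    (fun n => liftAlongIso G (shiftFunctor T n) (fun X => h X n))

@[reducible]
def commShiftOfEssImage : letI := hasShiftOfEssImage G h; G.CommShift ℤ :=
  Functor.CommShift.ofHasShiftOfFullyFaithful _ _ _

variable [Preadditive T] [HasZeroObject T] [∀ n : ℤ, (shiftFunctor T n).Additive]
  [Pretriangulated T] [Preadditive E] [G.Additive] [HasZeroObject E]

omit [G.Full] [HasZeroObject T] [Pretriangulated T] [HasZeroObject E] in
lemma shiftFunctor_additive_of_commShift [HasShift E ℤ] [G.CommShift ℤ] (n : ℤ) :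
    (shiftFunctor E n).Additive := by
  have : (shiftFunctor E n ⋙ G).Additive := Functor.additive_of_iso (G.commShiftIso n).symm
  exact Functor.additive_of_comp_faithful _ G

variable [HasShift E ℤ] [∀ n : ℤ, (shiftFunctor E n).Additive] [G.CommShift ℤ]

@[reducible]
-- Triangles are distinguished when their images are. Closure of the essential image under cones is
-- needed only for completing a morphism to a triangle; the other axioms are reflected by `G`.
def pretriangulatedOfEssImage
    (h₃ : ∀ S ∈ distTriang T, G.essImage S.obj₁ → G.essImage S.obj₂ → G.essImage S.obj₃) :
    Pretriangulated E where
  distinguishedTriangles := G.mapTriangle.obj ⁻¹' (distTriang T)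
  isomorphic_distinguished T₁ hT₁ T₂ e :=
    isomorphic_distinguished _ hT₁ _ (G.mapTriangle.mapIso e)
  contractible_distinguished X := by
    refine distinguished_of_iso (contractible_distinguished (G.obj X)) (G.map (𝟙 X))
      (G.map 0) (G.map 0 ≫ (G.commShiftIso (1 : ℤ)).hom.app X)
      (Iso.refl _) (Iso.refl _) G.mapZeroObject (by simp) ((isZero_zero T).eq_of_tgt _ _)
      ((G.map_isZero (isZero_zero E)).eq_of_src _ _)
  distinguished_cocone_triangle {X Y} f := by
    obtain ⟨Z', g', h', mem⟩ := distinguished_cocone_triangle (G.map f)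
    obtain ⟨Z, ⟨e⟩⟩ : G.essImage Z' := h₃ _ mem ⟨X, ⟨Iso.refl _⟩⟩ ⟨Y, ⟨Iso.refl _⟩⟩
    refine ⟨Z, G.preimage (g' ≫ e.inv),
      G.preimage (e.hom ≫ h' ≫ (G.commShiftIso (1 : ℤ)).inv.app X),
      distinguished_of_iso mem (G.map f) (G.map (G.preimage (g' ≫ e.inv)))
        (G.map (G.preimage (e.hom ≫ h' ≫ (G.commShiftIso (1 : ℤ)).inv.app X)) ≫
          (G.commShiftIso (1 : ℤ)).hom.app X) (Iso.refl _) (Iso.refl _) e ?_ ?_ ?_⟩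
    all_goals simp
  rotate_distinguished_triangle S :=
    (rotate_distinguished_triangle (G.mapTriangle.obj S)).trans
      (distinguished_iff_of_iso (G.mapTriangleRotateIso.app S))
  complete_distinguished_triangle_morphism T₁ T₂ hT₁ hT₂ a b comm := by
    obtain ⟨c, hc₁, hc₂⟩ := complete_distinguished_triangle_morphism (G.mapTriangle.obj T₁)
      (G.mapTriangle.obj T₂) hT₁ hT₂ (G.map a) (G.map b)
      ((G.map_comp _ _).symm.trans ((G.congr_map comm).trans (G.map_comp _ _)))
    obtain ⟨c, rfl⟩ := G.map_surjective c
    change G.map T₁.mor₂ ≫ G.map c = G.map b ≫ G.map T₂.mor₂ at hc₁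
    change (G.map T₁.mor₃ ≫ (G.commShiftIso (1 : ℤ)).hom.app T₁.obj₁) ≫ (G.map a)⟦(1 : ℤ)⟧' =
      G.map c ≫ G.map T₂.mor₃ ≫ (G.commShiftIso (1 : ℤ)).hom.app T₂.obj₁ at hc₂
    refine ⟨c, G.map_injective (by simpa using hc₁), G.map_injective ?_⟩
    have := G.commShiftIso_hom_naturality a (1 : ℤ)
    rw [← cancel_mono ((Functor.commShiftIso G (1 : ℤ)).hom.app T₂.obj₁)]
    simpa [this] using hc₂

lemma isTriangulated_of_pretriangulatedOfEssImage [IsTriangulated T]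
    (h₃ : ∀ S ∈ distTriang T, G.essImage S.obj₁ → G.essImage S.obj₂ → G.essImage S.obj₃) :
    letI := pretriangulatedOfEssImage G h₃; IsTriangulated E := by
  let := pretriangulatedOfEssImage G h₃
  have : G.IsTriangulated := ⟨fun _ hT => hT⟩
  exact IsTriangulated.of_fully_faithful_triangulated_functor G

end Transport

/-! ### Frobenius subcategories of abelian categories -/

section Frobenius

variable {A : Type u} [Category.{v} A] [Abelian A] (Q : ObjectProperty A)

/-- The axioms which make `Q`, with the short exact sequences all of whose terms satisfy `Q`, a
Frobenius category whose projective objects are the projective objects of `A` in `Q`. -/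
structure IsFrobenius : Prop where
  ext_closed (S : ShortComplex A) (hS : S.ShortExact) (h₁ : Q S.X₁) (h₃ : Q S.X₃) : Q S.X₂
  exists_suspension (X : Q.FullSubcategory) :
    ∃ S : ShortComplex Q.FullSubcategory, IsProjConflation S ∧ S.X₁ = X
  exists_syzygy (X : Q.FullSubcategory) :
    ∃ S : ShortComplex Q.FullSubcategory, IsProjConflation S ∧ S.X₃ = X
  ext_eq_zero (X P : A) (hX : Q X) (hP : Q P) (_ : Projective P) (n : ℕ) (hn : 0 < n) :
    haveI := HasExt.standard A
    Subsingleton (Abelian.Ext X P n)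

variable {Q} (hQ : IsFrobenius Q) [HasDerivedCategory.{w} A]

open DerivedCategory

lemma eq_zero_of_ext {X Y : A} {n : ℕ}
    (h : haveI := HasExt.standard A; Subsingleton (Abelian.Ext X Y n))
    (f : (singleFunctor A 0).obj X ⟶ ((singleFunctor A 0).obj Y)⟦(n : ℤ)⟧) : f = 0 := by
  have := HasExt.standard A
  have : Subsingleton (Abelian.Ext X Y n) := h
  have := (Abelian.Ext.homEquiv (X := X) (Y := Y) (n := n)).symm.subsingleton
  exact Subsingleton.elim (α := ShiftedHom _ _ _) _ _

lemma eq_zero_of_projective {X Y : A} [Projective X] {n : ℕ} (hn : 0 < n)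
    (f : (singleFunctor A 0).obj X ⟶ ((singleFunctor A 0).obj Y)⟦(n : ℤ)⟧) : f = 0 := by
  have := HasExt.standard A
  obtain ⟨n, rfl⟩ := Nat.exists_eq_succ_of_ne_zero hn.ne'
  exact eq_zero_of_ext ⟨fun a b => (Abelian.Ext.eq_zero_of_projective a).trans
    (Abelian.Ext.eq_zero_of_projective b).symm⟩ f

variable (Q) in
/-- The objects of the derived category which receive no nonzero morphism from the objects
satisfying `Q` after a sufficiently large shift. -/
def eventuallyOrthogonal : ObjectProperty (DerivedCategory A) := fun Z =>
  ∃ n₀ : ℤ, ∀ n, n₀ ≤ n → ∀ X, Q X → ∀ f : (singleFunctor A 0).obj X ⟶ Z⟦n⟧, f = 0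

instance : (eventuallyOrthogonal Q).IsClosedUnderIsomorphisms where
  of_iso {Z Z'} e := by
    rintro ⟨n₀, h⟩
    refine ⟨n₀, fun n hn X hX f => ?_⟩
    rw [← cancel_mono (e.inv⟦n⟧'), zero_comp]
    exact h n hn X hX _

instance : (eventuallyOrthogonal Q).IsTriangulated where
  exists_zero := ⟨0, isZero_zero _, 0, fun n _ X _ f =>
    ((shiftFunctor _ n).map_isZero (isZero_zero _)).eq_of_tgt _ _⟩
  isStableUnderShiftBy a :=
    { le_shift := by
        rintro Z ⟨n₀, h⟩
        refine ⟨n₀ - a, fun n hn X hX f => ?_⟩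
        rw [← cancel_mono ((shiftFunctorAdd' (DerivedCategory A) a n (a + n) rfl).inv.app Z),
          zero_comp]
        exact h _ (by lia) X hX _ }
  toIsTriangulatedClosed₂ := .mk' (by
    rintro S hS ⟨n₁, h₁⟩ ⟨n₃, h₃⟩
    refine ⟨max n₁ n₃, fun n hn X hX f => ?_⟩
    obtain ⟨g, rfl⟩ := exists_lift_mor₁ (shift_distinguished (f := S.mor₁) hS n) f
      (h₃ n ((le_max_right _ _).trans hn) X hX _)
    rw [h₁ n ((le_max_left _ _).trans hn) X hX g, zero_comp])

include hQ

/-- Projective objects in `Q` are injective relative to `Q`: the bound is 1 because Extⁿ(X, P) = 0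
for all n ≥ 1. -/
lemma eventuallyOrthogonal_of_projective {P : A} (hP : Q P) [Projective P] :
    eventuallyOrthogonal Q ((singleFunctor A 0).obj P) := by
  refine ⟨1, fun n hn X hX f => ?_⟩
  obtain ⟨n, rfl⟩ := Int.eq_ofNat_of_zero_le (by lia : 0 ≤ n)
  exact eq_zero_of_ext (hQ.ext_eq_zero X P hX hP inferInstance n (by lia)) f

/-- Comparison of an object with its iterated suspensions in the derived category. -/
lemma exists_iterated_suspension (X : A) (hX : Q X) (n : ℕ) :
    ∃ (X' : A) (_ : Q X') (t : (singleFunctor A 0).obj X' ⟶ ((singleFunctor A 0).obj X)⟦(n : ℤ)⟧),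
      (n = 0 → IsIso t) ∧ (eventuallyOrthogonal Q).trW t ∧
      (∀ (Y : A) (h : (singleFunctor A 0).obj X' ⟶ ((singleFunctor A 0).obj Y)⟦(n : ℤ)⟧),
        ∃ f : X ⟶ Y, h = t ≫ ((singleFunctor A 0).map f)⟦(n : ℤ)⟧') ∧
      (∀ (Y : A) (f : X ⟶ Y), 0 < n → t ≫ ((singleFunctor A 0).map f)⟦(n : ℤ)⟧' = 0 →
        ∃ (P : A) (_ : Projective P) (a : X ⟶ P) (b : P ⟶ Y), a ≫ b = f) := by
  induction n with
  | zero =>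
    let e := (shiftFunctorZero (DerivedCategory A) ℤ).symm.app ((singleFunctor A 0).obj X)
    refine ⟨X, hX, e.hom, fun _ => inferInstance, ObjectProperty.trW_of_isIso _ _, fun Y h => ?_,
      fun _ _ h => (lt_irrefl _ h).elim⟩
    obtain ⟨f, hf⟩ := (singleFunctor A 0).map_surjective
      (h ≫ (shiftFunctorZero (DerivedCategory A) ℤ).hom.app _)
    refine ⟨f, ?_⟩
    have := (shiftFunctorZero (DerivedCategory A) ℤ).inv.naturality ((singleFunctor A 0).map f)
    refine Eq.trans ?_ this
    rw [Functor.id_map, hf, Category.assoc, Iso.hom_inv_id_app]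
    exact (Category.comp_id h).symm
  | succ n ih =>
    obtain ⟨X', hX', t, ht₀, ht₁, ht₂, ht₃⟩ := ih
    obtain ⟨S, hS, hSX⟩ := hQ.exists_suspension ⟨X', hX'⟩
    obtain rfl : S.X₁.obj = X' := congrArg (·.obj) hSX
    have hS' : (S.map Q.ι).ShortExact := hS.isConflation
    have := hS.projective
    obtain ⟨δ, hT⟩ : ∃ δ, Triangle.mk ((singleFunctor A 0).map S.f.hom)
        ((singleFunctor A 0).map S.g.hom) δ ∈ distTriang _ :=
      ⟨_, hS'.singleTriangle_distinguished⟩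
    let e := shiftFunctorAdd' (DerivedCategory A) (n : ℤ) 1 (n + 1 : ℕ) (by simp)
    have he {X Y : DerivedCategory A} (f : X ⟶ Y) :
        e.inv.app X ≫ f⟦((n + 1 : ℕ) : ℤ)⟧' = f⟦(n : ℤ)⟧'⟦(1 : ℤ)⟧' ≫ e.inv.app Y :=
      (e.inv.naturality f).symm
    -- Since the middle term of the conflation dies in the quotient, the connecting morphism `δ` has
    -- eventually orthogonal cone; composing it with the shift of the previous `t` gives the next
    -- comparison map.
    refine ⟨S.X₃.obj, S.X₃.property, δ ≫ t⟦(1 : ℤ)⟧' ≫ e.inv.app _, fun h => (Nat.succ_ne_zero n h).elim, ?_, ?_, ?_⟩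
    · refine MorphismProperty.comp_mem _ _ _ ?_ (MorphismProperty.comp_mem _ _ _ ?_ ?_)
      · exact ObjectProperty.trW.mk _ (rot_of_distTriang _ (rot_of_distTriang _ hT))
          (ObjectProperty.le_shift _ (1 : ℤ) _
            (eventuallyOrthogonal_of_projective hQ S.X₂.property))
      · exact ht₁.shift 1
      · exact ObjectProperty.trW_of_isIso _ (e.symm.app ((singleFunctor A 0).obj X)).hom
    · intro Y h
      -- The restriction of `h` to the projective middle term is an element of a positive Ext group,
      -- hence zero.
      obtain ⟨g, rfl⟩ := exists_desc_mor₃ hT h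
        (eq_zero_of_projective (X := S.X₂.obj) (by lia) _)
      obtain ⟨g', hg'⟩ := (shiftFunctor (DerivedCategory A) (1 : ℤ)).map_surjective
        (g ≫ e.hom.app _)
      obtain ⟨f, rfl⟩ := ht₂ Y g'
      refine ⟨f, ?_⟩
      have hg₂ : g = (g ≫ e.hom.app _) ≫ e.inv.app _ := by simp
      rw [hg₂, ← hg', Category.assoc, Category.assoc, he, Functor.map_comp, Category.assoc]
    · intro Y f _ hf
      have hk : δ ≫ (t ≫ ((singleFunctor A 0).map f)⟦(n : ℤ)⟧')⟦(1 : ℤ)⟧' = 0 := by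
        rw [← cancel_mono (e.inv.app _), zero_comp, Functor.map_comp, Category.assoc,
          Category.assoc, ← he]
        simpa only [Category.assoc] using hf
      -- Now `t` followed by the shifted `f` factors as `S.f` followed by `k`, with `k` starting at
      -- a projective object. For n = 0 this is the required factorization of `f`; for n > 0 the map
      -- `k` vanishes and induction applies.
      obtain ⟨k, hk'⟩ := exists_desc_mor₁ hT _ hk
      rcases Nat.eq_zero_or_pos n with rfl | hn
      · obtain ⟨r, hr, hr'⟩ := ht₀ rfl
        let z (X : DerivedCategory A) : X⟦((0 : ℕ) : ℤ)⟧ ≅ X := shiftZero ℤ X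
        have hz {X Y : DerivedCategory A} (f : X ⟶ Y) :
            f = (z X).inv ≫ f⟦((0 : ℕ) : ℤ)⟧' ≫ (z Y).hom := by
          have := (shiftFunctorZero (DerivedCategory A) ℤ).hom.naturality f
          rw [Iso.eq_inv_comp]
          exact this.symm
        obtain ⟨a, ha⟩ := (singleFunctor A 0).map_surjective
          ((z _).inv ≫ r ≫ (singleFunctor A 0).map S.f.hom)
        obtain ⟨b, hb⟩ := (singleFunctor A 0).map_surjective (k ≫ (z _).hom)
        refine ⟨_, hS.projective, a, b, (singleFunctor A 0).map_injective ?_⟩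
        rw [Functor.map_comp, ha, hb, hz ((singleFunctor A 0).map f)]
        simp only [Category.assoc]
        rw [← reassoc_of% hk', reassoc_of% hr']
      · exact ht₃ Y f hn (by rw [hk', eq_zero_of_projective hn k, comp_zero])

variable (Q) in
omit hQ in
/-- The Verdier quotient of the derived category in which the stable category embeds. -/
abbrev SingularityCat := (eventuallyOrthogonal Q).trW.Localization

omit hQ in
variable (Q) in
/-- The localization functor. -/
abbrev toSingularityCat : DerivedCategory A ⥤ SingularityCat Q := (eventuallyOrthogonal Q).trW.Q

omit hQ in
lemma toSingularityCat_map_isIso {X Y : DerivedCategory A} {f : X ⟶ Y}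
    (hf : (eventuallyOrthogonal Q).trW f) : IsIso ((toSingularityCat Q).map f) :=
  Localization.inverts _ (eventuallyOrthogonal Q).trW f hf

/-- Write the morphism as a left fraction with denominator s : Y → Z of eventually orthogonal cone.
After a large shift and composition with the comparison from an iterated suspension, the numerator
no longer sees the cone and lifts to the shift of Y. The lift comes from a map X → Y, and the
comparison is invertible in the quotient. -/
lemma toSingularityCat_map_surjective (X Y : A) (hX : Q X)
    (g : (toSingularityCat Q).obj ((singleFunctor A 0).obj X) ⟶
      (toSingularityCat Q).obj ((singleFunctor A 0).obj Y)) :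
    ∃ f : X ⟶ Y, (toSingularityCat Q).map ((singleFunctor A 0).map f) = g := by
  obtain ⟨φ, hφ⟩ := Localization.exists_leftFraction _ (eventuallyOrthogonal Q).trW g
  obtain ⟨W, u, v, hT, n₀, hW⟩ := φ.hs
  obtain ⟨X', hX', t, -, ht₁, ht₂, -⟩ := exists_iterated_suspension hQ X hX n₀.toNat
  obtain ⟨h, hh⟩ := exists_lift_mor₁ (shift_distinguished hT n₀.toNat)
    (t ≫ φ.f⟦(n₀.toNat : ℤ)⟧') (hW _ (Int.self_le_toNat n₀) X' hX' _)
  obtain ⟨f, rfl⟩ := ht₂ Y h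
  refine ⟨f, ?_⟩
  have := toSingularityCat_map_isIso ht₁
  have := toSingularityCat_map_isIso φ.hs
  rw [hφ, ← cancel_mono ((toSingularityCat Q).map φ.s),
    MorphismProperty.LeftFraction.map_comp_map_s, ← Functor.map_comp]
  rw [Category.assoc, ← Functor.map_comp] at hh
  have h₂ := (cancel_epi _).1 ((Functor.map_comp _ _ _).symm.trans
    ((congrArg (toSingularityCat Q).map hh).trans (Functor.map_comp _ _ _)))
  have h₃ := ((toSingularityCat Q).commShiftIso (n₀.toNat : ℤ)).hom.naturality φ.f
  have h₄ := ((toSingularityCat Q).commShiftIso (n₀.toNat : ℤ)).hom.naturality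
    ((singleFunctor A 0).map f ≫ φ.s)
  apply (shiftFunctor (SingularityCat Q) (n₀.toNat : ℤ)).map_injective
  rw [← cancel_epi (((toSingularityCat Q).commShiftIso (n₀.toNat : ℤ)).hom.app _)]
  exact h₄.symm.trans ((congrArg (· ≫ _) h₂.symm).trans h₃)

/-- A map that dies in the quotient factors through an eventually orthogonal object. It therefore
vanishes on a high enough suspension of X, which detects exactly the maps factoring through
projectives. -/
lemma factors_of_toSingularityCat_map_eq_zero (X Y : A) (hX : Q X) (f : X ⟶ Y)
    (hf : (toSingularityCat Q).map ((singleFunctor A 0).map f) = 0) :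
    ∃ (P : A) (_ : Projective P) (a : X ⟶ P) (b : P ⟶ Y), a ≫ b = f := by
  obtain ⟨Z, s, hs, hfs⟩ := (MorphismProperty.map_eq_iff_postcomp (toSingularityCat Q)
    (eventuallyOrthogonal Q).trW ((singleFunctor A 0).map f) 0).1 (by rw [hf, Functor.map_zero])
  rw [ObjectProperty.trW_iff'] at hs
  obtain ⟨W, u, v, hT, n₀, hW⟩ := hs
  rw [zero_comp] at hfs
  obtain ⟨k, hk⟩ := exists_lift_mor₁ hT _ hfs
  -- One more than the orthogonality bound, because the detection of projective factorizations needs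
  -- a positive number of suspensions.
  obtain ⟨X', hX', t, -, -, -, ht₃⟩ := exists_iterated_suspension hQ X hX (n₀.toNat + 1)
  refine ht₃ Y f (by lia) ?_
  rw [hk, Functor.map_comp, ← Category.assoc, hW _ (by lia) X' hX' (t ≫ _), zero_comp]

omit [HasDerivedCategory.{w} A] in
/-- Every morphism is, in the stable category, the first morphism of a conflation. -/
lemma exists_conflation {X Y : Q.FullSubcategory} (f : X ⟶ Y) :
    ∃ (M Z : Q.FullSubcategory) (i : X ⟶ M) (g : M ⟶ Z) (w : i ≫ g = 0)
      (e : (toStable Q).obj M ≅ (toStable Q).obj Y), IsConflation (ShortComplex.mk i g w) ∧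
      (toStable Q).map i ≫ e.hom = (toStable Q).map f := by
  obtain ⟨R, hR, rfl⟩ := hQ.exists_suspension X
  have hR' : (R.map Q.ι).ShortExact := hR.isConflation
  have hmono : Mono R.f.hom := hR'.mono_f
  have hepi : Epi R.g.hom := hR'.epi_g
  have hepi' : Epi (R.map Q.ι).g := hR'.epi_g
  have hR₀ : R.f.hom ≫ R.g.hom = 0 := (R.map Q.ι).zero
  -- Adding an embedding of X into a projective makes `f` a monomorphism without changing its class,
  -- since Y ⊞ P and Y are stably isomorphic.
  let l : R.X₁.obj ⟶ Y.obj ⊞ R.X₂.obj := biprod.lift f.hom R.f.hom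
  have hl₂ : l ≫ biprod.snd = R.f.hom := biprod.lift_snd _ _
  have hl : Mono l := mono_of_mono_fac hl₂
  have hlE : (ShortComplex.mk l (cokernel.π l) (cokernel.condition l)).ShortExact :=
    { exact := ShortComplex.exact_cokernel l }
  have h₂ : Q (Y.obj ⊞ R.X₂.obj) :=
    hQ.ext_closed (ShortComplex.mk biprod.inl biprod.snd biprod.inl_snd)
      (ShortComplex.Splitting.ofHasBinaryBiproduct _ _).shortExact Y.property R.X₂.property
  let q : cokernel l ⟶ R.X₃.obj := cokernel.desc l (biprod.snd ≫ R.g.hom) (by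
    rw [reassoc_of% hl₂, hR₀])
  have hq : cokernel.π l ≫ q = biprod.snd ≫ R.g.hom := cokernel.π_desc _ _ _
  have hz : (biprod.inl ≫ cokernel.π l) ≫ q = 0 := by simp [hq]
  have hm : Mono (biprod.inl ≫ cokernel.π l) := by
    refine Preadditive.mono_of_cancel_zero _ fun {W} a ha => ?_
    rw [← Category.assoc] at ha
    obtain ⟨b, hb⟩ : ∃ b : W ⟶ R.X₁.obj, b ≫ l = a ≫ biprod.inl :=
      ⟨hlE.exact.lift _ ha, hlE.exact.lift_f _ ha⟩
    have hb₀ : b = 0 := by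
      rw [← cancel_mono R.f.hom, ← hl₂, reassoc_of% hb]
      simp
    rw [← cancel_mono (biprod.inl : Y.obj ⟶ Y.obj ⊞ R.X₂.obj), ← hb, hb₀]
    simp
  -- The cokernel is an extension of the suspension of X by Y, so extension closure puts it in `Q`.
  have h₃ : Q (cokernel l) := by
    refine hQ.ext_closed (ShortComplex.mk (biprod.inl ≫ cokernel.π l) q hz) ?_ Y.property
      R.X₃.property
    have : Epi q := by
      have : Epi (cokernel.π l ≫ q) := by rw [hq]; exact epi_comp _ _
      exact epi_of_epi (cokernel.π l) q
    refine { exact := ShortComplex.exact_of_g_is_cokernel _ (CokernelCofork.IsColimit.ofπ' _ _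
      fun {W} t ht => ?_) }
    have ht' : biprod.inl ≫ cokernel.π l ≫ t = 0 := by rw [← Category.assoc]; exact ht
    have h₁ : cokernel.π l ≫ t = biprod.snd ≫ biprod.inr ≫ cokernel.π l ≫ t := by
      ext <;> simp [ht']
    have h₂ : R.f.hom ≫ biprod.inr ≫ cokernel.π l ≫ t = 0 := by
      rw [← hl₂, Category.assoc, ← h₁, cokernel.condition_assoc, zero_comp]
    have h₄ : ∃ t' : R.X₃.obj ⟶ W, R.g.hom ≫ t' = biprod.inr ≫ cokernel.π l ≫ t :=
      ⟨hR'.exact.desc _ h₂, hR'.exact.g_desc _ h₂⟩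
    refine ⟨h₄.choose, ?_⟩
    rw [← cancel_epi (cokernel.π l)]
    dsimp only
    rw [reassoc_of% hq, h₄.choose_spec, ← h₁]
  let M : Q.FullSubcategory := ⟨_, h₂⟩
  let i : R.X₁ ⟶ M := ObjectProperty.homMk l
  let g : M ⟶ ⟨_, h₃⟩ := ObjectProperty.homMk (cokernel.π l)
  have := hR.projective
  let p : M ⟶ Y := ObjectProperty.homMk biprod.fst
  let j : Y ⟶ M := ObjectProperty.homMk biprod.inl
  refine ⟨M, _, i, g, by ext; exact cokernel.condition l,
    ⟨(toStable Q).map p, (toStable Q).map j, ?_, ?_⟩, hlE, ?_⟩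
  · rw [← Functor.map_comp, ← CategoryTheory.Functor.map_id]
    refine CategoryTheory.Quotient.sound _ ⟨R.X₂.obj, inferInstance, -biprod.snd, biprod.inr, ?_⟩
    change _ = biprod.fst ≫ biprod.inl - 𝟙 _
    rw [← biprod.total, sub_add_cancel_left, Preadditive.neg_comp]
  · rw [← Functor.map_comp, ← CategoryTheory.Functor.map_id]
    congr 1
    ext
    exact biprod.inl_fst
  · rw [← Functor.map_comp]
    congr 1
    ext
    exact biprod.lift_fst _ _

end Frobenius

/-! ### The embedding of the stable category into the Verdier quotient -/

section Happel

variable {A : Type u} [Category.{v} A] [Abelian A] {Q : ObjectProperty A}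
lemma toStable_map_surjective {X Y : Q.FullSubcategory}
    (f : (toStable Q).obj X ⟶ (toStable Q).obj Y) : ∃ g : X ⟶ Y, (toStable Q).map g = f :=
  (CategoryTheory.Quotient.functor (stableRel Q)).map_surjective f

instance : (toStable Q).Full := ⟨toStable_map_surjective⟩

lemma toStable_map_eq_iff {X Y : Q.FullSubcategory} (f g : X ⟶ Y) :
    (toStable Q).map f = (toStable Q).map g ↔ stableRel Q f g :=
  CategoryTheory.Quotient.functor_map_eq_iff _ f g

lemma toStable_obj_surjective (X : Stable Q) : ∃ Y : Q.FullSubcategory, (toStable Q).obj Y = X :=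
  ⟨X.as, rfl⟩

variable (hQ : IsFrobenius Q) [HasDerivedCategory.{w} A]

open DerivedCategory

lemma isZero_toSingularityCat_obj {Z : DerivedCategory A} (hZ : eventuallyOrthogonal Q Z) :
    IsZero ((toSingularityCat Q).obj Z) := by
  have : (eventuallyOrthogonal Q).trW (0 : 0 ⟶ Z) :=
    ObjectProperty.trW.mk _ (contractible_distinguished₁ Z) hZ
  have := toSingularityCat_map_isIso this
  exact ((toSingularityCat Q).map_isZero (isZero_zero _)).of_iso
    (asIso ((toSingularityCat Q).map (0 : 0 ⟶ Z))).symm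

include hQ in
-- The projective object in `stableRel` need not satisfy `Q`. The map from it to Y lifts to the
-- projective term of a syzygy conflation of Y, which does satisfy `Q` and is zero in the quotient.
lemma toSingularityCat_map_eq_of_stableRel {X Y : Q.FullSubcategory} (f g : X ⟶ Y)
    (h : stableRel Q f g) :
    (Q.ι ⋙ singleFunctor A 0 ⋙ toSingularityCat Q).map f =
      (Q.ι ⋙ singleFunctor A 0 ⋙ toSingularityCat Q).map g := by
  obtain ⟨P, _, a, b, hab⟩ := h
  obtain ⟨S, hS, rfl⟩ := hQ.exists_syzygy Y
  have : Epi S.g.hom := hS.isConflation.epi_g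
  have := hS.projective
  have hz := isZero_toSingularityCat_obj
    (eventuallyOrthogonal_of_projective hQ (P := S.X₂.obj) S.X₂.property)
  rw [← sub_eq_zero, ← Functor.map_sub]
  have : (f - g).hom = (a ≫ Projective.factorThru b S.g.hom) ≫ S.g.hom := by
    rw [Category.assoc, Projective.factorThru_comp, hab]
    rfl
  dsimp only [Functor.comp_map, ObjectProperty.ι_map]
  rw [this, Functor.map_comp, Functor.map_comp, hz.eq_of_tgt ((toSingularityCat Q).map _) 0,
    zero_comp]

/-- The embedding of the stable category in the singularity category. -/
def stableToSingularityCat : Stable Q ⥤ SingularityCat Q :=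
  CategoryTheory.Quotient.lift (stableRel Q) (Q.ι ⋙ singleFunctor A 0 ⋙ toSingularityCat Q)
    (fun _ _ => toSingularityCat_map_eq_of_stableRel hQ)

instance : (stableToSingularityCat hQ).Additive where
  map_add {X Y f g} := by
    obtain ⟨X, rfl⟩ := toStable_obj_surjective X
    obtain ⟨Y, rfl⟩ := toStable_obj_surjective Y
    obtain ⟨f, rfl⟩ := toStable_map_surjective f
    obtain ⟨g, rfl⟩ := toStable_map_surjective g
    rw [← Functor.map_add]
    exact (Q.ι ⋙ singleFunctor A 0 ⋙ toSingularityCat Q).map_add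

instance : (stableToSingularityCat hQ).Full where
  map_surjective {X Y} f := by
    obtain ⟨X, rfl⟩ := toStable_obj_surjective X
    obtain ⟨Y, rfl⟩ := toStable_obj_surjective Y
    obtain ⟨f, rfl⟩ := toSingularityCat_map_surjective hQ X.obj Y.obj X.property f
    exact ⟨(toStable Q).map (ObjectProperty.homMk f), rfl⟩

instance : (stableToSingularityCat hQ).Faithful where
  map_injective {X Y} f g h := by
    obtain ⟨X, rfl⟩ := toStable_obj_surjective X
    obtain ⟨Y, rfl⟩ := toStable_obj_surjective Y
    obtain ⟨f, rfl⟩ := toStable_map_surjective f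
    obtain ⟨g, rfl⟩ := toStable_map_surjective g
    rw [toStable_map_eq_iff]
    refine factors_of_toSingularityCat_map_eq_zero hQ X.obj Y.obj X.property (f.hom - g.hom) ?_
    rw [Functor.map_sub, Functor.map_sub, sub_eq_zero]
    exact h

lemma map_comp_commShiftIso_hom {C D : Type*} [Category* C] [Category* D] [HasShift C ℤ]
    [HasShift D ℤ] (F : C ⥤ D) [F.CommShift ℤ] {X Y X' Y' : C} {a : X ⟶ X'} {d : X ⟶ Y⟦(1 : ℤ)⟧}
    {d' : X' ⟶ Y'⟦(1 : ℤ)⟧} {b : Y ⟶ Y'} (h : a ≫ d' = d ≫ b⟦(1 : ℤ)⟧') :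
    F.map a ≫ F.map d' ≫ (F.commShiftIso (1 : ℤ)).hom.app Y' =
      (F.map d ≫ (F.commShiftIso (1 : ℤ)).hom.app Y) ≫ (F.map b)⟦(1 : ℤ)⟧' := by
  rw [← Functor.map_comp_assoc, h, Functor.map_comp, Category.assoc, Category.assoc,
    Functor.commShiftIso_hom_naturality]

/-- The connecting morphism of a conflation. -/
def conflationδ (S : ShortComplex Q.FullSubcategory) (hS : IsConflation S) :
    (stableToSingularityCat hQ).obj ((toStable Q).obj S.X₃) ⟶
      ((stableToSingularityCat hQ).obj ((toStable Q).obj S.X₁))⟦(1 : ℤ)⟧ :=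
  (toSingularityCat Q).map (show (S.map Q.ι).ShortExact from hS).singleδ ≫
    ((toSingularityCat Q).commShiftIso (1 : ℤ)).hom.app _

lemma conflationδ_distinguished (S : ShortComplex Q.FullSubcategory) (hS : IsConflation S) :
    Triangle.mk ((stableToSingularityCat hQ).map ((toStable Q).map S.f))
      ((stableToSingularityCat hQ).map ((toStable Q).map S.g)) (conflationδ hQ S hS) ∈
      distTriang (SingularityCat Q) :=
  (toSingularityCat Q).map_distinguished _
    (show (S.map Q.ι).ShortExact from hS).singleTriangle_distinguished

lemma conflationδ_naturality (S S' : ShortComplex Q.FullSubcategory) (hS : IsConflation S)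
    (hS' : IsConflation S') (φ : S ⟶ S') :
    (stableToSingularityCat hQ).map ((toStable Q).map φ.τ₃) ≫ conflationδ hQ S' hS' =
      conflationδ hQ S hS ≫
        ((stableToSingularityCat hQ).map ((toStable Q).map φ.τ₁))⟦(1 : ℤ)⟧' := by
  have h : (singleFunctor A 0).map φ.τ₃.hom ≫
      (show (S'.map Q.ι).ShortExact from hS').singleδ =
      (show (S.map Q.ι).ShortExact from hS).singleδ ≫
        ((singleFunctor A 0).map φ.τ₁.hom)⟦(1 : ℤ)⟧' :=
    (ShortComplex.ShortExact.singleTriangle.map hS hS' (Q.ι.mapShortComplex.map φ)).comm₃.symm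
  exact map_comp_commShiftIso_hom (toSingularityCat Q) h

lemma isIso_conflationδ (S : ShortComplex Q.FullSubcategory) (hS : IsProjConflation S) :
    IsIso (conflationδ hQ S hS.isConflation) := by
  have := hS.projective
  exact (Triangle.isZero₂_iff_isIso₃ _ (conflationδ_distinguished hQ S hS.isConflation)).1
    (isZero_toSingularityCat_obj
      (eventuallyOrthogonal_of_projective hQ (P := S.X₂.obj) S.X₂.property))

/-- Connecting morphisms of conflations with projective middle term are invertible, so suspensions
realize the shift by 1 and syzygies the shift by -1. The general case is an induction. -/
lemma shift_mem_essImage (n : ℤ) (X : Stable Q) :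
    (stableToSingularityCat hQ).essImage (((stableToSingularityCat hQ).obj X)⟦n⟧) := by
  have h₁ (X : Stable Q) : ∃ X', Nonempty ((stableToSingularityCat hQ).obj X' ≅
      ((stableToSingularityCat hQ).obj X)⟦(1 : ℤ)⟧) := by
    obtain ⟨S, hS, h⟩ := hQ.exists_suspension X.as
    obtain rfl : (toStable Q).obj S.X₁ = X := congrArg (toStable Q).obj h
    have := isIso_conflationδ hQ S hS
    exact ⟨_, ⟨asIso (conflationδ hQ S hS.isConflation)⟩⟩
  have h₂ (X : Stable Q) : ∃ X', Nonempty ((stableToSingularityCat hQ).obj X' ≅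
      ((stableToSingularityCat hQ).obj X)⟦(-1 : ℤ)⟧) := by
    obtain ⟨S, hS, h⟩ := hQ.exists_syzygy X.as
    obtain rfl : (toStable Q).obj S.X₃ = X := congrArg (toStable Q).obj h
    have := isIso_conflationδ hQ S hS
    exact ⟨_, ⟨(shiftShiftNeg _ (1 : ℤ)).symm ≪≫
      (shiftFunctor _ (-1 : ℤ)).mapIso (asIso (conflationδ hQ S hS.isConflation)).symm⟩⟩
  induction n using Int.induction_on generalizing X with
  | zero => exact ⟨X, ⟨(shiftZero ℤ _).symm⟩⟩
  | succ n ih =>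
    obtain ⟨X', ⟨e⟩⟩ := ih X
    obtain ⟨X'', ⟨e'⟩⟩ := h₁ X'
    exact ⟨X'', ⟨e' ≪≫ (shiftFunctor _ (1 : ℤ)).mapIso e ≪≫
      (shiftFunctorAdd' (SingularityCat Q) (n : ℤ) 1 (n + 1) rfl).symm.app _⟩⟩
  | pred n ih =>
    obtain ⟨X', ⟨e⟩⟩ := ih X
    obtain ⟨X'', ⟨e'⟩⟩ := h₂ X'
    exact ⟨X'', ⟨e' ≪≫ (shiftFunctor _ (-1 : ℤ)).mapIso e ≪≫
      (shiftFunctorAdd' (SingularityCat Q) (-(n : ℤ)) (-1) (-(n : ℤ) - 1) rfl).symm.app _⟩⟩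

/-- A triangle is determined up to isomorphism by its first morphism, and stably every morphism is
the inclusion of a conflation. -/
lemma exists_conflation_iso {X Y : Stable Q} (T : Triangle (SingularityCat Q))
    (hT : T ∈ distTriang _) (f : X ⟶ Y) (e₁ : T.obj₁ ≅ (stableToSingularityCat hQ).obj X)
    (e₂ : T.obj₂ ≅ (stableToSingularityCat hQ).obj Y)
    (comm : T.mor₁ ≫ e₂.hom = e₁.hom ≫ (stableToSingularityCat hQ).map f) :
    ∃ (S : ShortComplex Q.FullSubcategory) (hS : IsConflation S), Nonempty (T ≅ Triangle.mk
      ((stableToSingularityCat hQ).map ((toStable Q).map S.f))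
      ((stableToSingularityCat hQ).map ((toStable Q).map S.g)) (conflationδ hQ S hS)) := by
  obtain ⟨X, rfl⟩ := toStable_obj_surjective X
  obtain ⟨Y, rfl⟩ := toStable_obj_surjective Y
  obtain ⟨f, rfl⟩ := toStable_map_surjective f
  obtain ⟨M, Z, i, g, w, e, hS, hi⟩ := exists_conflation hQ f
  refine ⟨_, hS, ⟨isoTriangleOfIso₁₂ _ _ hT (conflationδ_distinguished hQ _ hS) e₁
    (e₂ ≪≫ (stableToSingularityCat hQ).mapIso e.symm) ?_⟩⟩
  change T.mor₁ ≫ e₂.hom ≫ (stableToSingularityCat hQ).map e.inv =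
    e₁.hom ≫ (stableToSingularityCat hQ).map ((toStable Q).map i)
  rw [reassoc_of% comm, ← Functor.map_comp, ← hi, Category.assoc, Iso.hom_inv_id,
    Category.comp_id]

lemma cone_mem_essImage (T : Triangle (SingularityCat Q)) (hT : T ∈ distTriang _)
    (h₁ : (stableToSingularityCat hQ).essImage T.obj₁)
    (h₂ : (stableToSingularityCat hQ).essImage T.obj₂) :
    (stableToSingularityCat hQ).essImage T.obj₃ := by
  obtain ⟨X, ⟨e₁⟩⟩ := h₁
  obtain ⟨Y, ⟨e₂⟩⟩ := h₂
  obtain ⟨f, hf⟩ := (stableToSingularityCat hQ).map_surjective (e₁.hom ≫ T.mor₁ ≫ e₂.inv)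
  obtain ⟨S, hS, ⟨e⟩⟩ := exists_conflation_iso hQ T hT f e₁.symm e₂.symm (by simp [hf])
  exact ⟨_, ⟨(Triangle.π₃.mapIso e).symm⟩⟩

end Happel

/-! ### Happel's triangulation, transported from the Verdier quotient -/

section HappelTriangulation

variable {A : Type u} [Category.{v} A] [Abelian A] {Q : ObjectProperty A}
variable (hQ : IsFrobenius Q)

open DerivedCategory

include hQ in
/-- Projective objects of a Frobenius category are injective with respect to conflations. -/
lemma exists_extension {S : ShortComplex A} (hS : S.ShortExact) (h₃ : Q S.X₃) {P : A} (hP : Q P)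
    [Projective P] (u : S.X₁ ⟶ P) : ∃ v : S.X₂ ⟶ P, S.f ≫ v = u := by
  let _ := HasDerivedCategory.standard A
  obtain ⟨v, hv⟩ := exists_desc_mor₁ (f := (singleFunctor A 0).map S.f)
    hS.singleTriangle_distinguished ((singleFunctor A 0).map u)
    (eq_zero_of_ext (n := 1) (hQ.ext_eq_zero _ _ h₃ hP inferInstance 1 one_pos) _)
  obtain ⟨v, rfl⟩ := (singleFunctor A 0).map_surjective v
  exact ⟨v, (singleFunctor A 0).map_injective (by rw [Functor.map_comp, hv])⟩

include hQ in
-- Relative injectivity of the projective middle term extends `u` to the middle terms; the third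
-- component is induced on cokernels.
lemma exists_hom_of_conflation {S S' : ShortComplex Q.FullSubcategory} (hS : IsConflation S)
    (hS' : IsProjConflation S') (u : S.X₁ ⟶ S'.X₁) : ∃ φ : S ⟶ S', φ.τ₁ = u := by
  have := hS'.projective
  have h : (S.map Q.ι).ShortExact := hS
  have : Epi (S.map Q.ι).g := h.epi_g
  obtain ⟨v, hv⟩ : ∃ v : S.X₂.obj ⟶ S'.X₂.obj, S.f.hom ≫ v = u.hom ≫ S'.f.hom :=
    exists_extension hQ h S.X₃.property S'.X₂.property _
  have hv' : S.f.hom ≫ v ≫ S'.g.hom = 0 := by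
    rw [← Category.assoc]
    refine (congrArg (· ≫ S'.g.hom) hv).trans ?_
    rw [Category.assoc]
    exact (congrArg (u.hom ≫ ·) (S'.map Q.ι).zero).trans comp_zero
  obtain ⟨t, ht⟩ : ∃ t : S.X₃.obj ⟶ S'.X₃.obj, S.g.hom ≫ t = v ≫ S'.g.hom :=
    ⟨h.exact.desc _ hv', h.exact.g_desc _ hv'⟩
  exact ⟨{ τ₁ := u
           τ₂ := ObjectProperty.homMk v
           τ₃ := ObjectProperty.homMk t
           comm₁₂ := by ext; exact hv.symm
           comm₂₃ := by ext; exact ht.symm }, rfl⟩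

include hQ in
/-- The stable category of a Frobenius category is triangulated. -/
theorem exists_isHappelTriangulation [Q.ContainsZero] :
    ∃ (_ : HasShift (Stable Q) ℤ) (_ : ∀ n : ℤ, (shiftFunctor (Stable Q) n).Additive)
      (_ : Pretriangulated (Stable Q)), IsTriangulated (Stable Q) ∧ IsHappelTriangulation Q := by
  let _ := HasDerivedCategory.standard A
  let G := stableToSingularityCat hQ
  let _ : HasShift (Stable Q) ℤ := hasShiftOfEssImage G fun X n => shift_mem_essImage hQ n X
  let _ : G.CommShift ℤ := commShiftOfEssImage G fun X n => shift_mem_essImage hQ n X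
  have hadd (n : ℤ) : (shiftFunctor (Stable Q) n).Additive :=
    shiftFunctor_additive_of_commShift G n
  let _ : Pretriangulated (Stable Q) := pretriangulatedOfEssImage G (cone_mem_essImage hQ)
  refine ⟨inferInstance, hadd, inferInstance,
    isTriangulated_of_pretriangulatedOfEssImage G (cone_mem_essImage hQ),
    hQ.exists_suspension, hQ.exists_syzygy, ?_⟩
  have hσ (S : ShortComplex Q.FullSubcategory) (hS : IsProjConflation S) :
      IsIso (conflationδ hQ S hS.isConflation) := isIso_conflationδ hQ S hS
  -- The suspension isomorphism is the preimage of the connecting morphism, so its naturality is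
  -- that of connecting morphisms.
  let σ (S : ShortComplex Q.FullSubcategory) (hS : IsProjConflation S) :
      (toStable Q).obj S.X₃ ≅ ((toStable Q).obj S.X₁)⟦(1 : ℤ)⟧ :=
    G.preimageIso (@asIso _ _ _ _ (conflationδ hQ S hS.isConflation) (hσ S hS) ≪≫
      (G.commShiftIso (1 : ℤ)).symm.app ((toStable Q).obj S.X₁))
  have σ_map (S : ShortComplex Q.FullSubcategory) (hS : IsProjConflation S) :
      G.map (σ S hS).hom ≫ (G.commShiftIso (1 : ℤ)).hom.app _ =
        conflationδ hQ S hS.isConflation := by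
    simp [σ]
    exact Category.comp_id _
  have comm {X Y : Stable Q} (f : X ⟶ Y) : G.map (f⟦(1 : ℤ)⟧') ≫
      (G.commShiftIso (1 : ℤ)).hom.app Y = (G.commShiftIso (1 : ℤ)).hom.app X ≫
      (G.map f)⟦(1 : ℤ)⟧' := G.commShiftIso_hom_naturality f (1 : ℤ)
  -- Under `G` the third morphism of Happel's triangle becomes the connecting morphism of `S`, by
  -- naturality along `φ`. The choice of `S'` and `φ` is therefore irrelevant.
  have key (S S' : ShortComplex Q.FullSubcategory) (hS : IsConflation S)
      (hS' : IsProjConflation S') (φ : S ⟶ S') [IsIso φ.τ₁] :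
      G.map ((toStable Q).map φ.τ₃ ≫ (σ S' hS').hom ≫
        ((toStable Q).map (inv φ.τ₁))⟦(1 : ℤ)⟧') ≫ (G.commShiftIso (1 : ℤ)).hom.app _ =
      conflationδ hQ S hS := by
    have h' := σ_map S' hS'
    rw [Functor.map_comp, Functor.map_comp, Category.assoc, Category.assoc, comm,
      reassoc_of% h']
    have h := conflationδ_naturality hQ S S' hS hS'.isConflation φ
    refine (Category.assoc _ _ _).symm.trans ((congrArg (· ≫ _) h).trans ?_)
    rw [Category.assoc]
    refine (congrArg (conflationδ hQ S hS ≫ ·) ?_).trans (Category.comp_id _)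
    rw [← Functor.map_comp, ← Functor.map_comp, ← Functor.map_comp, IsIso.hom_inv_id]
    simp only [CategoryTheory.Functor.map_id]
  refine ⟨σ, fun S S' hS hS' φ => G.map_injective ?_, fun T => ⟨fun hT => ?_, ?_⟩⟩
  · have h := σ_map S hS
    rw [← cancel_mono ((G.commShiftIso (1 : ℤ)).hom.app _), Functor.map_comp, Functor.map_comp,
      Category.assoc, Category.assoc, σ_map S' hS', comm, reassoc_of% h]
    exact conflationδ_naturality hQ S S' hS.isConflation hS'.isConflation φ
  · have hT' : Triangle.mk (G.map T.mor₁) (G.map T.mor₂)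
        (G.map T.mor₃ ≫ (G.commShiftIso (1 : ℤ)).hom.app _) ∈ distTriang _ := hT
    obtain ⟨S, hS, ⟨e⟩⟩ := exists_conflation_iso hQ _ hT' T.mor₁ (Iso.refl _) (Iso.refl _)
      ((Category.comp_id _).trans (Category.id_comp _).symm)
    obtain ⟨S', hS', h⟩ := hQ.exists_suspension S.X₁
    obtain ⟨φ, hφ⟩ := exists_hom_of_conflation hQ hS hS' (eqToHom h.symm)
    have : IsIso φ.τ₁ := by rw [hφ]; infer_instance
    let e₁ : T.obj₁ ≅ (toStable Q).obj S.X₁ := G.preimageIso (Triangle.π₁.mapIso e)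
    let e₂ : T.obj₂ ≅ (toStable Q).obj S.X₂ := G.preimageIso (Triangle.π₂.mapIso e)
    let e₃ : T.obj₃ ≅ (toStable Q).obj S.X₃ := G.preimageIso (Triangle.π₃.mapIso e)
    have he₁ : G.map e₁.hom = e.hom.hom₁ := G.map_preimage _
    have he₂ : G.map e₂.hom = e.hom.hom₂ := G.map_preimage _
    have he₃ : G.map e₃.hom = e.hom.hom₃ := G.map_preimage _
    have c₁ : T.mor₁ ≫ e₂.hom = e₁.hom ≫ (toStable Q).map S.f := G.map_injective (by
      rw [Functor.map_comp, Functor.map_comp, he₁, he₂]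
      exact e.hom.comm₁)
    have c₂ : T.mor₂ ≫ e₃.hom = e₂.hom ≫ (toStable Q).map S.g := G.map_injective (by
      rw [Functor.map_comp, Functor.map_comp, he₂, he₃]
      exact e.hom.comm₂)
    have c₃ : T.mor₃ ≫ e₁.hom⟦(1 : ℤ)⟧' = e₃.hom ≫ (toStable Q).map φ.τ₃ ≫ (σ S' hS').hom ≫
        ((toStable Q).map (inv φ.τ₁))⟦(1 : ℤ)⟧' := by
      apply G.map_injective
      rw [← cancel_mono ((G.commShiftIso (1 : ℤ)).hom.app _), Functor.map_comp, Functor.map_comp,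
        Category.assoc, Category.assoc, comm, he₁, he₃]
      have h₃ : (G.map T.mor₃ ≫ (G.commShiftIso (1 : ℤ)).hom.app _) ≫ e.hom.hom₁⟦(1 : ℤ)⟧' =
        e.hom.hom₃ ≫ conflationδ hQ S hS := e.hom.comm₃
      exact (Category.assoc _ _ _).symm.trans
        (h₃.trans (congrArg (e.hom.hom₃ ≫ ·) (key S S' hS hS' φ).symm))
    exact ⟨S, S', hS, hS', φ, this, ⟨Triangle.isoMk _ _ e₁ e₂ e₃ c₁ c₂ c₃⟩⟩
  · rintro ⟨S, S', hS, hS', φ, hφ, ⟨e⟩⟩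
    refine isomorphic_distinguished _ ?_ _ e
    change Triangle.mk (G.map ((toStable Q).map S.f)) (G.map ((toStable Q).map S.g))
      (G.map ((toStable Q).map φ.τ₃ ≫ (σ S' hS').hom ≫ ((toStable Q).map (inv φ.τ₁))⟦(1 : ℤ)⟧') ≫
        (G.commShiftIso (1 : ℤ)).hom.app _) ∈ distTriang _
    rw [key S S' hS hS' φ]
    exact conflationδ_distinguished hQ S hS

end HappelTriangulation

/-! ### Representable modules -/

section Representable

open Opposite

variable {C : Type u} [Category.{v} C] [Preadditive C]

/-- The Yoneda embedding of `C` into `Mod C`. -/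
def representableFunctor : C ⥤ Mod C where
  obj A := representable A
  map f := ObjectProperty.homMk (preadditiveYoneda.map f)

instance : (AdditiveFunctor.forget Cᵒᵖ AddCommGrpCat.{v}).PreservesHomology where
  preservesKernels _ _ f := ObjectProperty.preservesKernels_ι _ f
  preservesCokernels _ _ f := ObjectProperty.preservesCokernels_ι _ f

lemma exact_app {S : ShortComplex (Mod C)} (hS : S.Exact) (A : Cᵒᵖ)
    (x : S.X₂.obj.obj A) (hx : S.g.hom.app A x = 0) : ∃ y, S.f.hom.app A y = x := by
  have h := ((hS.map (AdditiveFunctor.forget Cᵒᵖ AddCommGrpCat.{v})).map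
    ((evaluation _ _).obj A))
  rw [ShortComplex.ab_exact_iff] at h
  exact h x hx

lemma app_surjective {X Y : Mod C} (f : X ⟶ Y) [Epi f] (A : Cᵒᵖ) :
    Function.Surjective (f.hom.app A) := fun y =>
  exact_app (S := ShortComplex.mk f (0 : Y ⟶ Y) comp_zero)
    ((ShortComplex.exact_iff_epi _ rfl).2 ‹_›) A y (by rfl)

/-- The Yoneda lemma. -/
def homRepresentableEquiv (A : C) (X : Mod C) : (representable A ⟶ X) ≃ X.obj.obj (op A) where
  toFun x := x.hom.app (op A) (𝟙 A)
  invFun a := ObjectProperty.homMk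
    { app B := AddCommGrpCat.ofHom
        { toFun b := X.obj.map (Quiver.Hom.op b) a
          map_zero' := by
            change (X.obj.map (Quiver.Hom.op 0)) a = 0
            rw [op_zero, Functor.map_zero]
            rfl
          map_add' b c := by
            exact ConcreteCategory.congr_hom
              (X.obj.map_add (f := Quiver.Hom.op (b : B.unop ⟶ A)) (g := Quiver.Hom.op c)) a }
      naturality B B' b := by
        ext c
        exact ConcreteCategory.congr_hom
          (X.obj.map_comp (Quiver.Hom.op (c : B.unop ⟶ A)) b) a }
  left_inv x := by
    ext B b
    have h := ConcreteCategory.congr_hom (x.hom.naturality (Quiver.Hom.op b)) (𝟙 A)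
    refine Eq.trans h.symm ?_
    exact congrArg (x.hom.app B) (Category.comp_id (X := B.unop) (Y := A) b)
  right_inv a := by
    change X.obj.map (𝟙 (op A)) a = a
    rw [CategoryTheory.Functor.map_id]
    rfl

lemma homRepresentableEquiv_comp {A : C} {X Y : Mod C} (x : representable A ⟶ X) (f : X ⟶ Y) :
    homRepresentableEquiv A Y (x ≫ f) = f.hom.app (op A) (homRepresentableEquiv A X x) := rfl

/-- The Yoneda embedding is fully faithful. -/
def representableFunctorFullyFaithful : (representableFunctor (C := C)).FullyFaithful where
  preimage {A B} f := homRepresentableEquiv A (representable B) f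
  map_preimage {A B} f := by
    apply (homRepresentableEquiv A (representable B)).injective
    exact Category.id_comp (Y := B) (homRepresentableEquiv A (representable B) f)
  preimage_map {A B} f := Category.id_comp f

instance : (representableFunctor (C := C)).Full := representableFunctorFullyFaithful.full

instance : (representableFunctor (C := C)).Faithful := representableFunctorFullyFaithful.faithful

instance : (representableFunctor (C := C)).Additive where
  map_add {A B f g} := by
    ext X a
    exact Preadditive.comp_add _ _ _ a f g

instance (A : C) : Projective (representable A) where
  factors {X Y} f e _ := by
    obtain ⟨x, hx⟩ := app_surjective e (op A) (homRepresentableEquiv A Y f)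
    refine ⟨(homRepresentableEquiv A X).symm x, (homRepresentableEquiv A Y).injective ?_⟩
    rw [homRepresentableEquiv_comp, Equiv.apply_symm_apply, hx]

/-- The map of representable modules given by a morphism of `C`. -/
def representableMap {A B : C} (f : A ⟶ B) : representable A ⟶ representable B :=
  representableFunctor.map f

lemma exists_representableMap {A B : C} (f : representable A ⟶ representable B) :
    ∃ g : A ⟶ B, representableMap g = f := (representableFunctor (C := C)).map_surjective f

lemma representableMap_injective {A B : C} {f g : A ⟶ B}
    (h : representableMap f = representableMap g) : f = g :=
  (representableFunctor (C := C)).map_injective h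

lemma representableMap_comp {A B D : C} (f : A ⟶ B) (g : B ⟶ D) :
    representableMap (f ≫ g) = representableMap f ≫ representableMap g :=
  representableFunctor.map_comp f g

@[simp]
lemma representableMap_id (A : C) : representableMap (𝟙 A) = 𝟙 (representable A) :=
  representableFunctor.map_id A

@[simp]
lemma representableMap_zero (A B : C) : representableMap (0 : A ⟶ B) = 0 :=
  representableFunctor.map_zero A B

@[simp]
lemma representableMap_add {A B : C} (f g : A ⟶ B) :
    representableMap (f + g) = representableMap f + representableMap g :=
  representableFunctor.map_add

@[simp]
lemma representableMap_sub {A B : C} (f g : A ⟶ B) :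
    representableMap (f - g) = representableMap f - representableMap g :=
  representableFunctor.map_sub

/-- By the Yoneda lemma, maps from representables are elements. Equality of maps, epimorphisms,
monomorphisms and exactness can thus be tested on such elements, as in the next lemmas. -/
lemma mod_hom_ext {X Y : Mod C} {f g : X ⟶ Y}
    (h : ∀ (A : C) (x : representable A ⟶ X), x ≫ f = x ≫ g) : f = g := by
  ext A x
  obtain ⟨x, rfl⟩ := (homRepresentableEquiv A.unop X).surjective x
  exact congrArg (homRepresentableEquiv A.unop Y) (h A.unop x)

lemma epi_of_representable_lift {X Y : Mod C} (f : X ⟶ Y)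
    (h : ∀ (A : C) (y : representable A ⟶ Y), ∃ x, x ≫ f = y) : Epi f :=
  ⟨fun a b hab => mod_hom_ext fun A y => by
    obtain ⟨x, rfl⟩ := h A y
    rw [Category.assoc, hab, Category.assoc]⟩

lemma mono_of_representable {X Y : Mod C} (f : X ⟶ Y)
    (h : ∀ (A : C) (x : representable A ⟶ X), x ≫ f = 0 → x = 0) : Mono f :=
  Preadditive.mono_of_cancel_zero _ fun g hg => mod_hom_ext fun A x => by
    rw [comp_zero]
    exact h A _ (by rw [Category.assoc, hg, comp_zero])

lemma exact_of_representable (S : ShortComplex (Mod C))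
    (h : ∀ (A : C) (x : representable A ⟶ S.X₂), x ≫ S.g = 0 → ∃ y, y ≫ S.f = x) : S.Exact := by
  rw [S.exact_iff_epi_kernel_lift]
  refine epi_of_representable_lift _ fun A y => ?_
  obtain ⟨x, hx⟩ := h A (y ≫ kernel.ι S.g) (by simp)
  exact ⟨x, by rw [← cancel_mono (kernel.ι S.g), Category.assoc, kernel.lift_ι, hx]⟩

lemma exact_representable_lift {S : ShortComplex (Mod C)} (hS : S.Exact) {A : C}
    (x : representable A ⟶ S.X₂) (hx : x ≫ S.g = 0) : ∃ y, y ≫ S.f = x :=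
  ⟨hS.liftFromProjective x hx, hS.liftFromProjective_comp x hx⟩

lemma exists_representable_lift {X Y : Mod C} (f : X ⟶ Y) [Epi f] {A : C}
    (y : representable A ⟶ Y) : ∃ x, x ≫ f = y :=
  ⟨Projective.factorThru y f, Projective.factorThru_comp y f⟩

end Representable

/-! ### Dimension shifting -/

section Ext

variable {A : Type u} [Category.{v} A] [Abelian A]

open Abelian

variable {S : ShortComplex A} (hS : S.ShortExact) {Y : A}

include hS

lemma exists_extension_of_subsingleton_ext
    (h : haveI := HasExt.standard A; Subsingleton (Ext S.X₃ Y 1)) (u : S.X₁ ⟶ Y) :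
    ∃ v : S.X₂ ⟶ Y, S.f ≫ v = u := by
  have := HasExt.standard A
  obtain ⟨v, hv⟩ := Ext.contravariant_sequence_exact₁ hS Y (Ext.mk₀ u) (add_zero 1)
    (Subsingleton.elim _ _)
  obtain ⟨v, rfl⟩ := Ext.homEquiv₀.symm.surjective v
  refine ⟨v, Ext.homEquiv₀.symm.injective ?_⟩
  simpa using hv

/-- With a projective middle term every class in Ext¹ is the pushout of the given extension along
some `u`; an extension of `u` to the middle term splits this pushout. -/
lemma subsingleton_ext_one_of_exists_extension [Projective S.X₂]
    (h : ∀ u : S.X₁ ⟶ Y, ∃ v : S.X₂ ⟶ Y, S.f ≫ v = u) :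
    haveI := HasExt.standard A; Subsingleton (Ext S.X₃ Y 1) := by
  have := HasExt.standard A
  refine subsingleton_of_forall_eq 0 fun x => ?_
  obtain ⟨u, rfl⟩ := Ext.contravariant_sequence_exact₃ hS Y x (Ext.eq_zero_of_projective _)
    (add_zero 1)
  obtain ⟨u, rfl⟩ := Ext.homEquiv₀.symm.surjective u
  obtain ⟨v, rfl⟩ := h u
  change hS.extClass.comp (Ext.mk₀ (S.f ≫ v)) _ = 0
  rw [← Ext.mk₀_comp_mk₀, hS.extClass_comp_assoc]

lemma subsingleton_ext_succ_of_projective [Projective S.X₂] {n : ℕ}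
    (h : haveI := HasExt.standard A; Subsingleton (Ext S.X₁ Y n)) :
    haveI := HasExt.standard A; Subsingleton (Ext S.X₃ Y (n + 1)) := by
  have := HasExt.standard A
  refine subsingleton_of_forall_eq 0 fun x => ?_
  obtain ⟨u, rfl⟩ := Ext.contravariant_sequence_exact₃ hS Y x (Ext.eq_zero_of_projective _)
    (add_comm 1 n)
  rw [Subsingleton.elim u 0, Ext.comp_zero]

lemma subsingleton_ext_middle {n : ℕ}
    (h₁ : haveI := HasExt.standard A; Subsingleton (Ext S.X₁ Y n))
    (h₃ : haveI := HasExt.standard A; Subsingleton (Ext S.X₃ Y n)) :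
    haveI := HasExt.standard A; Subsingleton (Ext S.X₂ Y n) := by
  have := HasExt.standard A
  refine subsingleton_of_forall_eq 0 fun x => ?_
  obtain ⟨u, rfl⟩ := Ext.contravariant_sequence_exact₂ hS Y x (Subsingleton.elim _ _)
  rw [Subsingleton.elim u 0, Ext.comp_zero]

omit hS in
lemma subsingleton_ext_of_retract {X Y' : A} (r : Retract Y' Y) {n : ℕ}
    (h : haveI := HasExt.standard A; Subsingleton (Ext X Y n)) :
    haveI := HasExt.standard A; Subsingleton (Ext X Y' n) := by
  have := HasExt.standard A
  refine subsingleton_of_forall_eq 0 fun x => ?_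
  have : x = (x.comp (Ext.mk₀ r.i) (add_zero n)).comp (Ext.mk₀ r.r) (add_zero n) := by
    simp
  rw [this, Subsingleton.elim (x.comp (Ext.mk₀ r.i) (add_zero n)) 0, Ext.zero_comp]

end Ext

/-! ### Modules presented by distinguished triangles -/

section Presentation

variable {D : Type u} [Category.{v} D] [Preadditive D] {P : ObjectProperty D}

/-- The map of representable modules over a full subcategory given by a morphism of the ambient
category. -/
abbrev rmap {A B : P.FullSubcategory} (f : A.obj ⟶ B.obj) : representable A ⟶ representable B :=
  representableMap (ObjectProperty.homMk f)

lemma exists_rmap {A B : P.FullSubcategory} (f : representable A ⟶ representable B) :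
    ∃ g : A.obj ⟶ B.obj, rmap g = f := by
  obtain ⟨g, rfl⟩ := exists_representableMap f
  exact ⟨g.hom, rfl⟩

lemma rmap_injective {A B : P.FullSubcategory} {f g : A.obj ⟶ B.obj}
    (h : (rmap f : representable A ⟶ representable B) = rmap g) : f = g :=
  congrArg (·.hom) (representableMap_injective h)

lemma rmap_comp {A B E : P.FullSubcategory} (f : A.obj ⟶ B.obj) (g : B.obj ⟶ E.obj) :
    (rmap (f ≫ g) : representable A ⟶ representable E) =
      (rmap f : _ ⟶ representable B) ≫ rmap g :=
  representableMap_comp (ObjectProperty.homMk f) (ObjectProperty.homMk g)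

lemma rmap_zero {A B : P.FullSubcategory} :
    (rmap (0 : A.obj ⟶ B.obj) : representable A ⟶ representable B) = 0 :=
  representableMap_zero A B

lemma rmap_eq_zero_iff {A B : P.FullSubcategory} (f : A.obj ⟶ B.obj) :
    (rmap f : representable A ⟶ representable B) = 0 ↔ f = 0 :=
  ⟨fun h => rmap_injective (h.trans rmap_zero.symm), fun h => h ▸ rmap_zero⟩

variable [HasZeroObject D] [HasShift D ℤ] [∀ n : ℤ, (shiftFunctor D n).Additive]
  [Pretriangulated D]

/-- A module `X` is presented by a distinguished triangle `K ⟶ E ⟶ N ⟶ K⟦1⟧` if it is the image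
of the map of representable modules given by `K ⟶ E`. -/
structure TrianglePresentation (X : Mod P.FullSubcategory) where
  /-- the first term of the triangle -/
  K : P.FullSubcategory
  /-- the second term of the triangle -/
  E : P.FullSubcategory
  /-- the third term of the triangle -/
  N : P.FullSubcategory
  /-- the first morphism of the triangle -/
  f : K.obj ⟶ E.obj
  /-- the second morphism of the triangle -/
  g : E.obj ⟶ N.obj
  /-- the third morphism of the triangle -/
  h : N.obj ⟶ K.obj⟦(1 : ℤ)⟧
  distinguished : Triangle.mk f g h ∈ distTriang D
  /-- the projection from a representable module -/
  p : representable K ⟶ X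
  /-- the inclusion into a representable module -/
  i : X ⟶ representable E
  epi : Epi p
  mono : Mono i
  fac : p ≫ i = rmap f

namespace TrianglePresentation

attribute [instance] epi mono

/-- The image of the map of representable modules given by the first morphism of a triangle. -/
abbrev ofTriangle {K E N : P.FullSubcategory} (f : K.obj ⟶ E.obj) (g : E.obj ⟶ N.obj)
    (h : N.obj ⟶ K.obj⟦(1 : ℤ)⟧) (H : Triangle.mk f g h ∈ distTriang D) :
    TrianglePresentation (image (rmap f : representable K ⟶ representable E)) where
  K := K
  E := E
  N := N
  f := f
  g := g
  h := h
  distinguished := H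
  p := factorThruImage _
  i := image.ι _
  epi := inferInstance
  mono := inferInstance
  fac := image.fac _

variable {X : Mod P.FullSubcategory} (T : TrianglePresentation X)

lemma exists_lift {Z : P.FullSubcategory} (x : representable Z ⟶ X) :
    ∃ a : Z.obj ⟶ T.K.obj, rmap a ≫ T.p = x := by
  obtain ⟨y, rfl⟩ := exists_representable_lift T.p x
  obtain ⟨a, rfl⟩ := exists_rmap y
  exact ⟨a, rfl⟩

lemma rmap_p_eq_zero_iff {Z : P.FullSubcategory} (a : Z.obj ⟶ T.K.obj) :
    (rmap a : representable Z ⟶ _) ≫ T.p = 0 ↔ a ≫ T.f = 0 := by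
  rw [← cancel_mono T.i, Category.assoc, T.fac, zero_comp, ← rmap_comp, rmap_eq_zero_iff]

lemma i_g : T.i ≫ rmap T.g = 0 := by
  rw [← cancel_epi T.p, ← Category.assoc, T.fac, ← rmap_comp, comp_mor₁_mor₂ T.distinguished,
    rmap_zero, comp_zero]

/-- The cosyzygy given by a presentation, with the presentation by the rotated triangle. -/
abbrev rotate [P.IsStableUnderShift ℤ] : TrianglePresentation (cokernel T.i) where
  K := T.E
  E := T.N
  N := ⟨T.K.obj⟦(1 : ℤ)⟧, P.le_shift 1 _ T.K.property⟩
  f := T.g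
  g := T.h
  h := -T.f⟦(1 : ℤ)⟧'
  distinguished := rot_of_distTriang _ T.distinguished
  p := cokernel.π T.i
  i := cokernel.desc T.i (rmap T.g) T.i_g
  epi := inferInstance
  -- An element of the representable of `T.E` killed by `T.g` lifts to `T.K`, so it already lies in
  -- the submodule X.
  mono := mono_of_representable _ fun Z x hx => by
    obtain ⟨y, rfl⟩ := exists_representable_lift (cokernel.π T.i) x
    obtain ⟨a, rfl⟩ := exists_rmap y
    rw [Category.assoc, cokernel.π_desc, ← rmap_comp, rmap_eq_zero_iff] at hx
    obtain ⟨b, rfl⟩ := exists_lift_mor₁ T.distinguished a hx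
    rw [rmap_comp (B := T.K), ← T.fac]
    simp
  fac := cokernel.π_desc _ _ _

lemma shortExact_rotate :
    (ShortComplex.mk T.i (cokernel.π T.i) (cokernel.condition T.i)).ShortExact where
  exact := ShortComplex.exact_cokernel T.i

/-- The third term of the triangle, shifted to the left. -/
abbrev N' [P.IsStableUnderShift ℤ] : P.FullSubcategory :=
  ⟨T.N.obj⟦(-1 : ℤ)⟧, P.le_shift (-1) _ T.N.property⟩

/-- The connecting morphism from the shifted third term of the triangle. -/
abbrev d : T.N.obj⟦(-1 : ℤ)⟧ ⟶ T.K.obj := (Triangle.mk T.f T.g T.h).invRotate.mor₁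

lemma d_distinguished :
    Triangle.mk T.d T.f (Triangle.mk T.f T.g T.h).invRotate.mor₃ ∈ distTriang D :=
  inv_rot_of_distTriang _ T.distinguished

variable [P.IsStableUnderShift ℤ]

/-- The syzygy given by a presentation, with the presentation by the inversely rotated triangle. -/
abbrev invRotate : TrianglePresentation (kernel T.p) where
  K := T.N'
  E := T.K
  N := T.E
  f := T.d
  g := T.f
  h := _
  distinguished := T.d_distinguished
  p := kernel.lift T.p (rmap (A := T.N') T.d) ((T.rmap_p_eq_zero_iff _).2
    (comp_mor₁_mor₂ T.d_distinguished))
  i := kernel.ι T.p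
  epi := epi_of_representable_lift _ fun Z x => by
    obtain ⟨a, ha⟩ := exists_rmap (x ≫ kernel.ι T.p)
    have : a ≫ T.f = 0 := (T.rmap_p_eq_zero_iff a).1 (by rw [ha]; simp)
    obtain ⟨b, rfl⟩ := exists_lift_mor₁ T.d_distinguished a this
    refine ⟨rmap (B := T.N') b, ?_⟩
    rw [← cancel_mono (kernel.ι T.p), ← ha, Category.assoc, kernel.lift_ι]
    exact (rmap_comp (B := T.N') b T.d).symm
  mono := inferInstance
  fac := kernel.lift_ι _ _ _

omit [P.IsStableUnderShift ℤ] in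
lemma shortExact_invRotate :
    (ShortComplex.mk (kernel.ι T.p) T.p (kernel.condition T.p)).ShortExact where
  exact := ShortComplex.exact_kernel T.p

include T in
lemma finitelyPresented : finitelyPresented P.FullSubcategory X := by
  refine ⟨T.K, T.N', rmap (A := T.N') T.d, T.p, (T.rmap_p_eq_zero_iff _).2
    (comp_mor₁_mor₂ T.d_distinguished), exact_of_representable _ fun Z x hx => ?_, T.epi⟩
  obtain ⟨a, rfl⟩ := exists_rmap x
  obtain ⟨b, rfl⟩ := exists_lift_mor₁ T.d_distinguished a ((T.rmap_p_eq_zero_iff a).1 hx)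
  exact ⟨rmap (B := T.N') b, (rmap_comp (B := T.N') b T.d).symm⟩

include T in
-- A map from the syzygy to a representable is given by a morphism N[-1] → A that kills the
-- preceding term E[-1] of the triangle. Exactness of Hom(-, A) on triangles extends it to K, which
-- is the extension required.
lemma subsingleton_ext_one (A : P.FullSubcategory) :
    haveI := HasExt.standard (Mod P.FullSubcategory)
    Subsingleton (Abelian.Ext X (representable A) 1) := by
  refine subsingleton_ext_one_of_exists_extension T.shortExact_invRotate fun u => ?_
  obtain ⟨a, ha⟩ := exists_rmap (A := T.N') (T.invRotate.p ≫ u)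
  obtain ⟨b, hb⟩ : ∃ b : T.K.obj ⟶ A.obj, a = T.d ≫ b :=
    exists_desc_mor₂ T.invRotate.d_distinguished a (by
      refine (rmap_eq_zero_iff (A := T.invRotate.N') _).1 ?_
      rw [rmap_comp (B := T.N'), ha, ← Category.assoc]
      refine (congrArg (· ≫ u) ((T.invRotate.rmap_p_eq_zero_iff (Z := T.invRotate.N') _).2 ?_)).trans
        zero_comp
      exact comp_mor₁_mor₂ T.invRotate.d_distinguished)
  have := T.invRotate.epi
  refine ⟨rmap b, (cancel_epi T.invRotate.p).1 ?_⟩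
  refine Eq.trans ?_ ha
  rw [hb]
  exact ((Category.assoc _ _ _).symm.trans (congrArg (· ≫ rmap b) T.invRotate.fac)).trans
    (rmap_comp (A := T.N') T.d b).symm

include T in
-- Dimension shifting applies indefinitely because the syzygy is again presented by a triangle.
lemma subsingleton_ext (A : P.FullSubcategory) (n : ℕ) :
    haveI := HasExt.standard (Mod P.FullSubcategory)
    Subsingleton (Abelian.Ext X (representable A) (n + 1)) := by
  induction n generalizing X with
  | zero => exact T.subsingleton_ext_one A
  | succ n ih =>
    exact subsingleton_ext_succ_of_projective T.shortExact_invRotate (ih T.invRotate)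

include T in
/-- Modules presented by triangles are Cohen-Macaulay. -/
lemma cohenMacaulay : cohenMacaulay P.FullSubcategory X :=
  ⟨T.finitelyPresented, fun A i hi => by
    obtain ⟨n, rfl⟩ := Nat.exists_eq_succ_of_ne_zero hi.ne'
    exact T.subsingleton_ext A n⟩

end TrianglePresentation

end Presentation

/-! ### Extensions of finitely presented and Cohen-Macaulay modules -/

section FinitePresentation

variable {C : Type u} [Category.{v} C] [Preadditive C]

/-- Extensions of finitely presented modules are finitely presented. -/
lemma finitelyPresented_of_shortExact [HasBinaryBiproducts C] {S : ShortComplex (Mod C)}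
    (hS : S.ShortExact) (h₁ : finitelyPresented C S.X₁) (h₃ : finitelyPresented C S.X₃) :
    finitelyPresented C S.X₂ := by
  obtain ⟨A₁, B₁, f₁, p₁, w₁, e₁, _⟩ := h₁
  obtain ⟨A₃, B₃, f₃, p₃, w₃, e₃, _⟩ := h₃
  have := hS.epi_g
  have := hS.mono_f
  obtain ⟨q, hq⟩ := exists_representable_lift S.g p₃
  obtain ⟨r, hr⟩ := exact_representable_lift hS.exact (f₃ ≫ q) (by rw [Category.assoc, hq, w₃])
  obtain ⟨t, ht⟩ := exists_representable_lift p₁ r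
  obtain ⟨a₁, rfl⟩ := exists_representableMap f₁
  obtain ⟨a₃, rfl⟩ := exists_representableMap f₃
  obtain ⟨t, rfl⟩ := exists_representableMap t
  let p : representable (A₁ ⊞ A₃) ⟶ S.X₂ :=
    representableMap biprod.fst ≫ p₁ ≫ S.f + representableMap biprod.snd ≫ q
  -- As in the horseshoe lemma: the relations `a₃` of the quotient, lifted along `q`, need not
  -- vanish in the middle module. They give an element of the submodule, which `t` represents and
  -- the off-diagonal entry subtracts.
  let f : B₁ ⊞ B₃ ⟶ A₁ ⊞ A₃ := biprod.lift (biprod.fst ≫ a₁ - biprod.snd ≫ t) (biprod.snd ≫ a₃)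
  have hp₁ : representableMap biprod.inl ≫ p = p₁ ≫ S.f := by
    simp only [p, Preadditive.comp_add, ← Category.assoc, ← representableMap_comp]
    simp
  have hp₃ : representableMap biprod.inr ≫ p = q := by
    simp only [p, Preadditive.comp_add, ← Category.assoc, ← representableMap_comp]
    simp
  have hp {Z : C} (z : Z ⟶ A₁ ⊞ A₃) : representableMap z ≫ p =
      representableMap (z ≫ biprod.fst) ≫ p₁ ≫ S.f + representableMap (z ≫ biprod.snd) ≫ q := by
    simp only [p, Preadditive.comp_add, ← Category.assoc, ← representableMap_comp]
  refine ⟨A₁ ⊞ A₃, B₁ ⊞ B₃, representableMap f, p, ?_, exact_of_representable _ fun Z x hx => ?_,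
    epi_of_representable_lift _ fun Z y => ?_⟩
  · rw [hp]
    simp only [f, biprod.lift_fst, biprod.lift_snd]
    have h₁ : representableMap a₁ ≫ p₁ ≫ S.f = 0 := by rw [reassoc_of% w₁, zero_comp]
    have h₂ : representableMap t ≫ p₁ ≫ S.f = representableMap a₃ ≫ q := by
      rw [reassoc_of% ht, hr]
    rw [representableMap_sub, Preadditive.sub_comp, representableMap_comp,
      representableMap_comp, representableMap_comp, Category.assoc, Category.assoc, Category.assoc,
      h₁, h₂]
    simp
  · obtain ⟨z, rfl⟩ := exists_representableMap x
    have hx : representableMap z ≫ p = 0 := hx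
    rw [hp] at hx
    obtain ⟨y₃, hy₃⟩ := exact_representable_lift e₃ (representableMap (z ≫ biprod.snd)) (by
      have := congrArg (· ≫ S.g) hx
      simpa [hq] using this)
    obtain ⟨y₃, rfl⟩ := exists_representableMap y₃
    rw [← representableMap_comp] at hy₃
    have hy₃ := representableMap_injective hy₃
    obtain ⟨y₁, hy₁⟩ := exact_representable_lift e₁
        (representableMap (z ≫ biprod.fst + y₃ ≫ t)) (by
      rw [← cancel_mono S.f, zero_comp, ← hx, ← hy₃, representableMap_add,
        representableMap_comp y₃, representableMap_comp y₃]
      simp [ht, hr])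
    obtain ⟨y₁, rfl⟩ := exists_representableMap y₁
    rw [← representableMap_comp] at hy₁
    have hy₁ := representableMap_injective hy₁
    refine ⟨representableMap (biprod.lift y₁ y₃), ?_⟩
    change representableMap _ ≫ representableMap f = _
    rw [← representableMap_comp]
    congr 1
    ext
    · simp [f, hy₁]
    · simp [f, hy₃]
  · obtain ⟨z₃, hz₃⟩ := exists_representable_lift p₃ (y ≫ S.g)
    obtain ⟨y₁, hy₁⟩ := exact_representable_lift hS.exact (y - z₃ ≫ q) (by
      rw [Preadditive.sub_comp, Category.assoc, hq, hz₃, sub_self])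
    obtain ⟨z₁, rfl⟩ := exists_representable_lift p₁ y₁
    obtain ⟨z₁, rfl⟩ := exists_representableMap z₁
    obtain ⟨z₃, rfl⟩ := exists_representableMap z₃
    refine ⟨representableMap (biprod.lift z₁ z₃), ?_⟩
    rw [hp]
    simp only [biprod.lift_fst, biprod.lift_snd]
    rw [← Category.assoc, hy₁]
    simp

/-- Extensions of Cohen-Macaulay modules are Cohen-Macaulay. -/
lemma cohenMacaulay_of_shortExact [HasBinaryBiproducts C] {S : ShortComplex (Mod C)}
    (hS : S.ShortExact) (h₁ : cohenMacaulay C S.X₁) (h₃ : cohenMacaulay C S.X₃) :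
    cohenMacaulay C S.X₂ :=
  ⟨finitelyPresented_of_shortExact hS h₁.1 h₃.1, fun A i hi =>
    subsingleton_ext_middle hS (h₁.2 A i hi) (h₃.2 A i hi)⟩

lemma cohenMacaulay_representable [HasZeroObject C] (A : C) :
    cohenMacaulay C (representable A) := by
  refine ⟨⟨A, 0, 0, 𝟙 _, by simp, ?_, inferInstance⟩, fun B i hi => ?_⟩
  · exact exact_of_representable _ fun Z x hx => ⟨0, by simpa using hx.symm⟩
  · have := HasExt.standard (Mod C)
    obtain ⟨n, rfl⟩ := Nat.exists_eq_succ_of_ne_zero hi.ne'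
    exact subsingleton_of_forall_eq 0 Abelian.Ext.eq_zero_of_projective

end FinitePresentation

/-! ### From vanishing of Ext¹ to presentations by triangles -/

section Presentation

variable {D : Type u} [Category.{v} D] [Preadditive D] [HasZeroObject D] [HasShift D ℤ]
  [∀ n : ℤ, (shiftFunctor D n).Additive] [Pretriangulated D] {P : ObjectProperty D}
  [P.IsStableUnderShift ℤ]

/-- If `X` is the cokernel of a map of representable modules given by `f : B ⟶ A` and there are no
nontrivial extensions of `X` by representable modules, then a morphism from the cocone of `f` to an
object of `P` vanishes as soon as it vanishes on all objects of `P`. -/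
lemma eq_zero_of_ghost {A B : P.FullSubcategory} {Z : D} {c : Z ⟶ B.obj} {f : B.obj ⟶ A.obj}
    {δ : A.obj ⟶ Z⟦(1 : ℤ)⟧} (H : Triangle.mk c f δ ∈ distTriang D) {X : Mod P.FullSubcategory}
    {p : representable A ⟶ X} [Epi p] (w : rmap f ≫ p = 0)
    (hp : (ShortComplex.mk _ _ w).Exact) {W : P.FullSubcategory}
    (hX : haveI := HasExt.standard (Mod P.FullSubcategory)
      Subsingleton (Abelian.Ext X (representable W) 1))
    (φ : Z ⟶ W.obj) (hφ : ∀ (V : P.FullSubcategory) (a : V.obj ⟶ Z), a ≫ φ = 0) : φ = 0 := by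
  -- The map A[-1] → Z of the triangle starts in `P`, so `φ` kills it and extends along `c`.
  obtain ⟨q, rfl⟩ : ∃ q : B.obj ⟶ W.obj, φ = c ≫ q :=
    exists_desc_mor₂ (f := (Triangle.mk c f δ).invRotate.mor₁) (inv_rot_of_distTriang _ H) φ
      (hφ ⟨A.obj⟦(-1 : ℤ)⟧, P.le_shift (-1) _ A.property⟩ _)
  have hS : (ShortComplex.mk (kernel.ι p) p (kernel.condition p)).ShortExact :=
    { exact := ShortComplex.exact_kernel p }
  let r : representable B ⟶ kernel p := kernel.lift p (rmap f) w
  have : Epi r := epi_of_representable_lift _ fun V x => by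
    obtain ⟨y, hy⟩ := exact_representable_lift hp (x ≫ kernel.ι p) (by simp)
    exact ⟨y, by rw [← cancel_mono (kernel.ι p), ← hy]; simp [r]⟩
  -- The elements of B killed by `f` come from Z, where `φ` annihilates everything visible from `P`.
  -- Hence `q` descends to the image of `f`, which is the kernel of `p`.
  obtain ⟨u, hu⟩ : ∃ u : kernel p ⟶ representable W, r ≫ u = rmap q := by
    have h : kernel.ι r ≫ rmap q = 0 := mod_hom_ext fun V x => by
      obtain ⟨a, ha⟩ := exists_rmap (x ≫ kernel.ι r)
      have haf : a ≫ f = 0 := by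
        rw [← rmap_eq_zero_iff, rmap_comp (B := B), ha]
        have : r ≫ kernel.ι p = rmap f := kernel.lift_ι _ _ _
        rw [← this]
        simp
      obtain ⟨b, rfl⟩ := exists_lift_mor₁ H a haf
      rw [← Category.assoc, ← ha, ← rmap_comp, Category.assoc, hφ V b, rmap_zero, comp_zero]
    exact ⟨(ShortComplex.exact_kernel r).desc _ h, (ShortComplex.exact_kernel r).g_desc _ h⟩
  -- Vanishing of Ext¹ extends `u` to A. Then `q` factors through `f`, and `φ` contains the zero
  -- composite of `c` and `f`.
  obtain ⟨s, hs⟩ := exists_extension_of_subsingleton_ext hS hX u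
  obtain ⟨s, rfl⟩ : ∃ t : A.obj ⟶ W.obj, rmap t = s := exists_rmap s
  have : q = f ≫ s := rmap_injective (A := B) (B := W) (by
    have : r ≫ kernel.ι p = rmap f := kernel.lift_ι _ _ _
    rw [rmap_comp (B := A), ← hu, ← this, Category.assoc]
    exact congrArg (r ≫ ·) hs.symm)
  rw [this, ← Category.assoc, comp_mor₁_mor₂ H, zero_comp]

/-- A finitely presented module is presented by a triangle if the cocone of the map defining it
satisfies `P`. -/
lemma exists_trianglePresentation_of_cocone {A B : P.FullSubcategory} {Z : D} (hZ : P Z)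
    {c : Z ⟶ B.obj} {f : B.obj ⟶ A.obj}
    {δ : A.obj ⟶ Z⟦(1 : ℤ)⟧} (H : Triangle.mk c f δ ∈ distTriang D) {X : Mod P.FullSubcategory}
    {p : representable A ⟶ X} [Epi p] (w : rmap f ≫ p = 0)
    (hp : (ShortComplex.mk _ _ w).Exact) :
    ∃ T : TrianglePresentation X, T.K = A ∧ T.E.obj = Z⟦(1 : ℤ)⟧ ∧ T.N.obj = B.obj⟦(1 : ℤ)⟧ := by
  let E : P.FullSubcategory := ⟨Z⟦(1 : ℤ)⟧, P.le_shift 1 _ hZ⟩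
  have hfδ : rmap f ≫ (rmap δ : representable A ⟶ representable E) = 0 := by
    rw [← rmap_comp (E := E), comp_mor₂_mor₃ H, rmap_zero]
  let i : X ⟶ representable E := hp.desc (rmap (B := E) δ) hfδ
  have fac : p ≫ i = rmap (B := E) δ := hp.g_desc _ _
  exact ⟨
    { K := A
      E := E
      N := ⟨B.obj⟦(1 : ℤ)⟧, P.le_shift 1 _ B.property⟩
      f := δ
      g := _
      h := _
      distinguished := rot_of_distTriang _ (rot_of_distTriang _ H)
      p := p
      i := i
      epi := inferInstance
      mono := mono_of_representable _ fun V x hx => by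
        obtain ⟨y, rfl⟩ := exists_representable_lift p x
        obtain ⟨a, rfl⟩ := exists_rmap y
        rw [Category.assoc, fac, ← rmap_comp (E := E), rmap_eq_zero_iff] at hx
        obtain ⟨b, rfl⟩ := exists_lift_mor₂ H a hx
        rw [rmap_comp (B := B), Category.assoc, w, comp_zero]
      fac := fac }, rfl, rfl, rfl⟩

variable (P) in
/-- If all Cohen-Macaulay modules are presented by triangles, then they form a Frobenius
category. -/
lemma isFrobenius_cohenMacaulay [HasZeroObject P.FullSubcategory]
    [HasBinaryBiproducts P.FullSubcategory]
    (hP : ∀ X : Mod P.FullSubcategory, cohenMacaulay _ X → Nonempty (TrianglePresentation X)) :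
    IsFrobenius (cohenMacaulay P.FullSubcategory) where
  ext_closed S hS h₁ h₃ := cohenMacaulay_of_shortExact hS h₁ h₃
  exists_suspension X := by
    obtain ⟨T⟩ := hP X.obj X.property
    let S : ShortComplex (cohenMacaulay P.FullSubcategory).FullSubcategory :=
      ShortComplex.mk (X₁ := X) (X₂ := ⟨_, cohenMacaulay_representable T.E⟩)
        (X₃ := ⟨_, T.rotate.cohenMacaulay⟩) (ObjectProperty.homMk T.i)
        (ObjectProperty.homMk (cokernel.π T.i)) (by ext1; exact cokernel.condition T.i)
    exact ⟨S, ⟨T.shortExact_rotate, inferInstanceAs (Projective (representable T.E))⟩, rfl⟩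
  exists_syzygy X := by
    obtain ⟨T⟩ := hP X.obj X.property
    let S : ShortComplex (cohenMacaulay P.FullSubcategory).FullSubcategory :=
      ShortComplex.mk (X₁ := ⟨_, T.invRotate.cohenMacaulay⟩)
        (X₂ := ⟨_, cohenMacaulay_representable T.K⟩)
        (X₃ := X) (ObjectProperty.homMk (kernel.ι T.p))
        (ObjectProperty.homMk T.p) (by ext1; exact kernel.condition T.p)
    exact ⟨S, ⟨T.shortExact_invRotate, inferInstanceAs (Projective (representable T.K))⟩, rfl⟩
  ext_eq_zero X Y hX hY _ n hn := by
    obtain ⟨A, B, f, p, w, hf, _⟩ := hY.1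
    -- A finitely presented projective module is a direct summand of a representable one, where the
    -- vanishing is part of being Cohen-Macaulay.
    exact subsingleton_ext_of_retract
      ⟨Projective.factorThru (𝟙 Y) p, p, Projective.factorThru_comp _ _⟩ (hX.2 A n hn)

end Presentation

lemma exists_shift_comp_eq {D : Type*} [Category* D] [HasShift D ℤ] {X Z : D} {n : ℤ}
    (φ : X⟦n⟧ ⟶ Z) : ∃ (v : X ⟶ Z⟦-n⟧) (e : Z⟦-n⟧⟦n⟧ ≅ Z), v⟦n⟧' ≫ e.hom = φ := by
  refine ⟨(shiftFunctorCompIsoId D n (-n) (by simp)).inv.app X ≫ φ⟦-n⟧',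
    (shiftFunctorCompIsoId D (-n) n (by simp)).app _, ?_⟩
  have h := (shiftFunctorCompIsoId D (-n) n (by simp)).hom.naturality φ
  dsimp at h ⊢
  simp only [Functor.map_comp, Category.assoc]
  rw [h, shift_shiftFunctorCompIsoId_inv_app]
  simp

/-! ### Morphisms to complexes concentrated in degree zero -/

section DegreeZero

open DerivedCategory

variable {M : Type u} [Category.{v} M] [Abelian M] [HasDerivedCategory.{w} M]

/-- The component in degree zero of a morphism to a complex concentrated in degree zero. -/
def degreeZero {X : DerivedCategory M} {W : M} (φ : X ⟶ (singleFunctor M 0).obj W) :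
    (homologyFunctor M 0).obj X ⟶ W :=
  (homologyFunctor M 0).map φ ≫ (singleFunctorCompHomologyFunctorIso M 0).hom.app W

lemma degreeZero_comp {X Y : DerivedCategory M} {W : M} (f : X ⟶ Y)
    (φ : Y ⟶ (singleFunctor M 0).obj W) :
    degreeZero (f ≫ φ) = (homologyFunctor M 0).map f ≫ degreeZero φ := by
  simp [degreeZero]

lemma degreeZero_comp_map {X : DerivedCategory M} {W W' : M}
    (φ : X ⟶ (singleFunctor M 0).obj W) (f : W ⟶ W') :
    degreeZero (φ ≫ (singleFunctor M 0).map f) = degreeZero φ ≫ f := by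
  have h := (singleFunctorCompHomologyFunctorIso M 0).hom.naturality f
  rw [degreeZero, degreeZero, Functor.map_comp, Category.assoc, Category.assoc]
  exact congrArg (_ ≫ ·) h

lemma degreeZero_add {X : DerivedCategory M} {W : M} (φ ψ : X ⟶ (singleFunctor M 0).obj W) :
    degreeZero (φ + ψ) = degreeZero φ + degreeZero ψ := by
  simp [degreeZero, Functor.map_add]

lemma degreeZero_sub {X : DerivedCategory M} {W : M} (φ ψ : X ⟶ (singleFunctor M 0).obj W) :
    degreeZero (φ - ψ) = degreeZero φ - degreeZero ψ := by
  simp [degreeZero, Functor.map_sub]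

lemma degreeZero_zero {X : DerivedCategory M} {W : M} :
    degreeZero (0 : X ⟶ (singleFunctor M 0).obj W) = 0 := by
  simp [degreeZero]

lemma degreeZero_sum {X : DerivedCategory M} {W : M} {n : ℕ}
    (φ : Fin n → (X ⟶ (singleFunctor M 0).obj W)) :
    degreeZero (∑ j, φ j) = ∑ j, degreeZero (φ j) := by
  simp [degreeZero, Functor.map_sum, Preadditive.sum_comp]

lemma degreeZero_map {V W : M} (f : V ⟶ W) : degreeZero ((singleFunctor M 0).map f) =
    (singleFunctorCompHomologyFunctorIso M 0).hom.app V ≫ f :=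
  (singleFunctorCompHomologyFunctorIso M 0).hom.naturality f

/-- Every morphism from the homology of `X` in degree zero comes from a morphism of `X`. -/
def IsLiftable (X : DerivedCategory M) : Prop :=
  ∀ (W : M) (u : (homologyFunctor M 0).obj X ⟶ W),
    ∃ φ : X ⟶ (singleFunctor M 0).obj W, degreeZero φ = u

lemma isLiftable_of_id {X : DerivedCategory M}
    (φ : X ⟶ (singleFunctor M 0).obj ((homologyFunctor M 0).obj X)) (h : degreeZero φ = 𝟙 _) :
    IsLiftable X := fun W u =>
  ⟨φ ≫ (singleFunctor M 0).map u, by rw [degreeZero_comp_map, h, Category.id_comp]⟩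

/-- Writing the identity as a sum of maps through the objects `Y j` covers direct sums and direct
summands at once, so liftability need only be checked on shifts of single objects. -/
lemma isLiftable_of_sum {X : DerivedCategory M} {n : ℕ} {Y : Fin n → DerivedCategory M}
    (a : ∀ j, X ⟶ Y j) (b : ∀ j, Y j ⟶ X) (hab : ∑ j, a j ≫ b j = 𝟙 X)
    (hY : ∀ j, IsLiftable (Y j)) : IsLiftable X := by
  intro W u
  choose φ hφ using fun j => hY j W ((homologyFunctor M 0).map (b j) ≫ u)
  refine ⟨∑ j, a j ≫ φ j, ?_⟩
  rw [degreeZero_sum]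
  simp only [degreeZero_comp, hφ, ← Category.assoc, ← Functor.map_comp]
  rw [← Preadditive.sum_comp, ← Functor.map_sum, hab]
  simp

lemma isLiftable_of_iso {X Y : DerivedCategory M} (e : X ≅ Y) (h : IsLiftable Y) :
    IsLiftable X :=
  isLiftable_of_sum (n := 1) (fun _ => e.hom) (fun _ => e.inv) (by simp) fun _ => h

lemma isLiftable_of_isZero {X : DerivedCategory M} (h : IsZero ((homologyFunctor M 0).obj X)) :
    IsLiftable X := fun _ _ => ⟨0, h.eq_of_src _ _⟩

lemma isLiftable_single (B : M) : IsLiftable ((singleFunctor M 0).obj B) := fun W u =>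
  ⟨(singleFunctor M 0).map ((singleFunctorCompHomologyFunctorIso M 0).inv.app B ≫ u), by
    rw [degreeZero_map, Iso.hom_inv_id_app_assoc]⟩

instance (B : M) (i : ℤ) : (((singleFunctor M 0).obj B)⟦i⟧).IsLE (-i) :=
  TStructure.t.isLE_shift _ 0 i (-i)

instance (B : M) (i : ℤ) : (((singleFunctor M 0).obj B)⟦i⟧).IsGE (-i) :=
  TStructure.t.isGE_shift _ 0 i (-i)

lemma isZero_homology_shift_single (B : M) {i j : ℤ} (h : i + j ≠ 0) :
    IsZero ((homologyFunctor M j).obj (((singleFunctor M 0).obj B)⟦i⟧)) := by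
  rcases lt_or_gt_of_ne h with h | h
  · exact isZero_of_isGE _ (-i) j (by lia)
  · exact isZero_of_isLE _ (-i) j (by lia)

lemma isLiftable_shift_single (B : M) (i : ℤ) :
    IsLiftable (((singleFunctor M 0).obj B)⟦i⟧) := by
  by_cases hi : i = 0
  · subst hi
    exact isLiftable_of_iso ((shiftFunctorZero _ ℤ).app _) (isLiftable_single B)
  · exact isLiftable_of_isZero (isZero_homology_shift_single B (by simpa using hi))

lemma eq_zero_of_degreeZero_single {B W : M}
    (φ : (singleFunctor M 0).obj B ⟶ (singleFunctor M 0).obj W) (h : degreeZero φ = 0) :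
    φ = 0 := by
  obtain ⟨f, rfl⟩ := (singleFunctor M 0).map_surjective φ
  rw [degreeZero_map, ← cancel_epi ((singleFunctorCompHomologyFunctorIso M 0).inv.app B),
    Iso.inv_hom_id_app_assoc, comp_zero] at h
  rw [h, Functor.map_zero]

/-- For i = 0 this is full faithfulness of the embedding in degree zero; for i > 0 the source lives
in negative degrees and admits no nonzero map to degree zero. -/
lemma eq_zero_of_degreeZero_shift_single {B W : M} {i : ℤ}
    (φ : ((singleFunctor M 0).obj B)⟦i⟧ ⟶ (singleFunctor M 0).obj W) (h : degreeZero φ = 0)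
    (hi : 0 ≤ i) : φ = 0 := by
  rcases hi.eq_or_lt with rfl | hi
  · rw [← cancel_epi ((shiftFunctorZero _ ℤ).inv.app _), comp_zero]
    exact eq_zero_of_degreeZero_single _ (by rw [degreeZero_comp, h, comp_zero])
  · exact TStructure.t.zero φ (-i) 0

/-- Such maps are elements of Ext in the positive degree `-i` with values in an injective object. -/
lemma eq_zero_of_injective {B J : M} [Injective J] {i : ℤ} (hi : i < 0)
    (φ : ((singleFunctor M 0).obj B)⟦i⟧ ⟶ (singleFunctor M 0).obj J) : φ = 0 := by
  obtain ⟨n, rfl⟩ : ∃ n : ℕ, i = -n := ⟨i.natAbs, by lia⟩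
  apply (shiftFunctor (DerivedCategory M) (n : ℤ)).map_injective
  rw [Functor.map_zero, ← cancel_epi
    ((shiftFunctorCompIsoId (DerivedCategory M) (-(n : ℤ)) n (by simp)).inv.app _), comp_zero]
  refine eq_zero_of_ext (n := n) ?_ _
  have := HasExt.standard M
  obtain ⟨m, rfl⟩ := Nat.exists_eq_succ_of_ne_zero (n := n) (by lia)
  exact subsingleton_of_forall_eq 0 Abelian.Ext.eq_zero_of_injective

/-- Morphisms to an injective object placed in degree zero are determined by their component in
degree zero. -/
def IsInjectivelyFaithful (X : DerivedCategory M) : Prop :=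
  ∀ (J : M) [Injective J] (φ : X ⟶ (singleFunctor M 0).obj J), degreeZero φ = 0 → φ = 0

lemma isInjectivelyFaithful_shift_single (B : M) (i : ℤ) :
    IsInjectivelyFaithful (((singleFunctor M 0).obj B)⟦i⟧) := fun J _ φ h => by
  rcases le_or_gt 0 i with hi | hi
  · exact eq_zero_of_degreeZero_shift_single φ h hi
  · exact eq_zero_of_injective hi φ

end DegreeZero

/-! ### The Yoneda category -/

section Yoneda

open DerivedCategory

variable {M : Type u} [Category.{v} M] [Abelian M] [HasDerivedCategory.{w} M]

lemma yonedaProp_of_retract {X Y : DerivedCategory M} (r : Retract X Y) (h : yonedaProp M Y) :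
    yonedaProp M X := by
  obtain ⟨n, B, i, ⟨r'⟩⟩ := h
  exact ⟨n, B, i, ⟨r.trans r'⟩⟩

instance : (yonedaProp M).IsClosedUnderIsomorphisms where
  of_iso e h := yonedaProp_of_retract (Retract.ofIso e.symm) h

lemma exists_sum_eq_id {X : DerivedCategory M} (h : yonedaProp M X) :
    ∃ (n : ℕ) (B : Fin n → M) (i : Fin n → ℤ) (a : ∀ j, X ⟶ ((singleFunctor M 0).obj (B j))⟦i j⟧)
      (b : ∀ j, ((singleFunctor M 0).obj (B j))⟦i j⟧ ⟶ X), ∑ j, a j ≫ b j = 𝟙 X := by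
  obtain ⟨n, B, i, ⟨r⟩⟩ := h
  refine ⟨n, B, i, fun j => r.i ≫ biproduct.π _ j, fun j =>
    biproduct.ι (fun j => ((singleFunctor M 0).obj (B j))⟦i j⟧) j ≫ r.r, ?_⟩
  have h : r.i ≫ (∑ j, biproduct.π (fun j => ((singleFunctor M 0).obj (B j))⟦i j⟧) j ≫
      biproduct.ι (fun j => ((singleFunctor M 0).obj (B j))⟦i j⟧) j) ≫ r.r = 𝟙 X := by
    rw [biproduct.total, Category.id_comp, r.retract]
  rw [Preadditive.sum_comp, Preadditive.comp_sum] at h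
  simpa only [Category.assoc] using h

lemma yonedaProp_shift_single (B : M) (i : ℤ) :
    yonedaProp M (((singleFunctor M 0).obj B)⟦i⟧) :=
  ⟨1, fun _ => B, fun _ => i, ⟨⟨biproduct.ι (fun _ : Fin 1 => ((singleFunctor M 0).obj B)⟦i⟧) 0,
    biproduct.π _ 0, by simp⟩⟩⟩

lemma yonedaProp_single (B : M) : yonedaProp M ((singleFunctor M 0).obj B) :=
  (yonedaProp M).prop_of_iso ((shiftFunctorZero _ ℤ).app _) (yonedaProp_shift_single B 0)

instance : (yonedaProp M).IsStableUnderShift ℤ where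
  isStableUnderShiftBy k :=
    { le_shift X := by
        rintro ⟨n, B, i, ⟨r⟩⟩
        refine ⟨n, B, fun j => i j + k, ⟨(r.map (shiftFunctor _ k)).trans (Retract.ofIso ?_)⟩⟩
        exact (shiftFunctor _ k).mapBiproduct _ ≪≫ biproduct.mapIso fun j =>
          ((shiftFunctorAdd (DerivedCategory M) (i j) k).app _).symm }

lemma exists_bounds {X : DerivedCategory M} (h : yonedaProp M X) :
    ∃ a b : ℤ, X.IsGE a ∧ X.IsLE b := by
  obtain ⟨n, B, i, a, b, hab⟩ := exists_sum_eq_id h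
  have key (k : ℤ) (hk : ∀ j, i j + k ≠ 0) : IsZero ((homologyFunctor M k).obj X) := by
    rw [IsZero.iff_id_eq_zero, ← CategoryTheory.Functor.map_id, ← hab, Functor.map_sum]
    refine Finset.sum_eq_zero fun j _ => ?_
    rw [Functor.map_comp, (isZero_homology_shift_single (B j) (hk j)).eq_of_tgt
      ((homologyFunctor M k).map (a j)) 0, zero_comp]
  have hi (j : Fin n) : |i j| ≤ ∑ j, |i j| :=
    Finset.single_le_sum (f := fun j => |i j|) (fun _ _ => abs_nonneg _) (Finset.mem_univ j)
  refine ⟨-∑ j, |i j|, ∑ j, |i j|, (isGE_iff _ _).2 fun k hk => key k fun j hj => ?_,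
    (isLE_iff _ _).2 fun k hk => key k fun j hj => ?_⟩
  all_goals
    have := hi j
    have := abs_le.1 this
    lia

lemma isLiftable_of_yonedaProp {X : DerivedCategory M} (h : yonedaProp M X) : IsLiftable X := by
  obtain ⟨n, B, i, a, b, hab⟩ := exists_sum_eq_id h
  exact isLiftable_of_sum a b hab fun j => isLiftable_shift_single _ _

lemma isInjectivelyFaithful_of_yonedaProp {X : DerivedCategory M} (h : yonedaProp M X) :
    IsInjectivelyFaithful X := by
  intro J _ φ hφ
  obtain ⟨n, B, i, a, b, hab⟩ := exists_sum_eq_id h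
  rw [← Category.id_comp φ, ← hab, Preadditive.sum_comp]
  refine Finset.sum_eq_zero fun j _ => ?_
  rw [Category.assoc, isInjectivelyFaithful_shift_single _ _ J (b j ≫ φ)
    (by rw [degreeZero_comp, hφ, comp_zero]), comp_zero]

/-- Morphisms from an object of the Yoneda category which is concentrated in nonpositive degrees to
an object in degree zero are determined by their component in degree zero. -/
lemma eq_zero_of_degreeZero {X : DerivedCategory M} (h : yonedaProp M X) [X.IsLE 0] {W : M}
    (φ : X ⟶ (singleFunctor M 0).obj W) (hφ : degreeZero φ = 0) : φ = 0 := by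
  obtain ⟨n, B, i, a, b, hab⟩ := exists_sum_eq_id h
  rw [← Category.id_comp φ, ← hab, Preadditive.sum_comp]
  refine Finset.sum_eq_zero fun j _ => ?_
  rcases le_or_gt 0 (i j) with hi | hi
  · rw [Category.assoc, eq_zero_of_degreeZero_shift_single (b j ≫ φ)
      (by rw [degreeZero_comp, hφ, comp_zero]) hi, comp_zero]
  · rw [TStructure.t.zero (a j) 0 (-i j), zero_comp, zero_comp]

lemma exists_isIso_homology {X Z : DerivedCategory M} {n : ℤ} (φ : X⟦n⟧ ⟶ Z)
    [IsIso ((homologyFunctor M 0).map φ)] :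
    ∃ v : X ⟶ Z⟦-n⟧, IsIso ((homologyFunctor M n).map v) := by
  obtain ⟨v, e, rfl⟩ := exists_shift_comp_eq φ
  have : IsIso ((homologyFunctor M 0).map (v⟦n⟧') ≫ (homologyFunctor M 0).map e.hom) := by
    rwa [← Functor.map_comp]
  have : IsIso ((homologyFunctor M 0).map (v⟦n⟧')) :=
    IsIso.of_isIso_comp_right _ ((homologyFunctor M 0).map e.hom)
  exact ⟨v, (NatIso.isIso_map_iff ((homologyFunctor M 0).shiftIso n 0 n (by simp)) v).1 this⟩

/-- A bounded complex such that in each degree the identity of the homology lifts belongs to the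
Yoneda category. -/
lemma yonedaProp_of_isLiftable {X : DerivedCategory M} {a b : ℤ} [X.IsGE a] [X.IsLE b]
    (h : ∀ n : ℤ, IsLiftable (X⟦n⟧)) : yonedaProp M X := by
  have key (n : ℤ) : ∃ (W : M) (v : X ⟶ ((singleFunctor M 0).obj W)⟦-n⟧),
      IsIso ((homologyFunctor M n).map v) := by
    obtain ⟨φ, hφ⟩ := h n _ (𝟙 _)
    have hφ' : IsIso ((homologyFunctor M 0).map φ) := by
      rw [degreeZero] at hφ
      rw [← (Iso.eq_comp_inv ((singleFunctorCompHomologyFunctorIso M 0).app _)).2 hφ |>.symm]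
      infer_instance
    exact ⟨_, exists_isIso_homology φ⟩
  choose W v hv using key
  -- The degrees from `a` to `b`. If b < a the single index `a` remains, which is harmless.
  let k (j : Fin ((b - a).toNat + 1)) : ℤ := a + j
  let Y (j : Fin ((b - a).toNat + 1)) : DerivedCategory M :=
    ((singleFunctor M 0).obj (W (k j)))⟦-(k j)⟧
  let f : X ⟶ ⨁ Y := biproduct.lift fun j => v (k j)
  have hY (n : ℤ) (j : Fin ((b - a).toNat + 1)) (hj : n ≠ k j) :
      IsZero ((homologyFunctor M n).obj (Y j)) := isZero_homology_shift_single _ (by lia)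
  -- In degree `n` all summands but the one placed there have zero homology, and the component to
  -- that one was chosen to be invertible on homology. So `f` is a quasi-isomorphism.
  have : IsIso f := by
    rw [isIso_iff]
    intro n
    by_cases hn : ∃ j, n = k j
    · obtain ⟨j, rfl⟩ := hn
      have hπ : IsIso ((homologyFunctor M (k j)).map (biproduct.π Y j)) := by
        refine ⟨(homologyFunctor M (k j)).map (biproduct.ι Y j), ?_, ?_⟩
        · rw [← CategoryTheory.Functor.map_id, ← biproduct.total, Functor.map_sum,
            Finset.sum_eq_single j, Functor.map_comp]
          · intro l _ hl
            rw [Functor.map_comp, (hY (k j) l (fun h => hl (by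
              ext
              simp only [k] at h
              lia))).eq_of_tgt ((homologyFunctor M (k j)).map (biproduct.π Y l)) 0, zero_comp]
          · simp
        · rw [← Functor.map_comp]
          simp
      have hf : (homologyFunctor M (k j)).map f ≫ (homologyFunctor M (k j)).map (biproduct.π Y j)
          = (homologyFunctor M (k j)).map (v (k j)) := by
        rw [← Functor.map_comp]
        simp [f]
      have := hv (k j)
      rw [← hf] at this
      exact IsIso.of_isIso_comp_right _ ((homologyFunctor M (k j)).map (biproduct.π Y j))
    · push Not at hn
      have h₁ : IsZero ((homologyFunctor M n).obj X) := by
        by_cases h : n < a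
        · exact isZero_of_isGE X a n h
        · refine isZero_of_isLE X b n ?_
          by_contra hb
          exact hn ⟨(n - a).toNat, by lia⟩ (by simp only [k]; lia)
      have h₂ : IsZero ((homologyFunctor M n).obj (⨁ Y)) := by
        rw [IsZero.iff_id_eq_zero, ← CategoryTheory.Functor.map_id, ← biproduct.total,
          Functor.map_sum]
        refine Finset.sum_eq_zero fun j _ => ?_
        rw [Functor.map_comp, (hY n j (hn j)).eq_of_tgt
          ((homologyFunctor M n).map (biproduct.π Y j)) 0, zero_comp]
      exact ⟨0, h₁.eq_of_src _ _, h₂.eq_of_src _ _⟩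
  exact ⟨_, fun j => W (k j), fun j => -(k j), ⟨Retract.ofIso (asIso f)⟩⟩

end Yoneda

lemma map_add_eq_id {C D : Type*} [Category* C] [Preadditive C] [Category* D] [Preadditive D]
    {X Y Z : C} {a : X ⟶ Y} {b : Y ⟶ X} {c : X ⟶ Z} {d : Z ⟶ X} (h : a ≫ b + c ≫ d = 𝟙 X)
    (F : C ⥤ D) [F.Additive] : F.map a ≫ F.map b + F.map c ≫ F.map d = 𝟙 (F.obj X) := by
  rw [← F.map_comp, ← F.map_comp, ← F.map_add, h, F.map_id]

section Yoneda

open DerivedCategory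

variable {M : Type u} [Category.{v} M] [Abelian M] [HasDerivedCategory.{w} M]

lemma isLiftable_of_add {X Y Z : DerivedCategory M} {a : X ⟶ Y} {b : Y ⟶ X} {c : X ⟶ Z}
    {d : Z ⟶ X} (h : a ≫ b + c ≫ d = 𝟙 X) (hY : IsLiftable Y) (hZ : IsLiftable Z) :
    IsLiftable X := by
  intro W u
  obtain ⟨φ, hφ⟩ := hY W ((homologyFunctor M 0).map b ≫ u)
  obtain ⟨ψ, hψ⟩ := hZ W ((homologyFunctor M 0).map d ≫ u)
  refine ⟨a ≫ φ + c ≫ ψ, ?_⟩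
  rw [degreeZero_add, degreeZero_comp, degreeZero_comp, hφ, hψ, ← Category.assoc,
    ← Category.assoc, ← Functor.map_comp, ← Functor.map_comp, ← Preadditive.add_comp,
    ← Functor.map_add, h, CategoryTheory.Functor.map_id, Category.id_comp]

omit [HasDerivedCategory.{w} M] in
lemma isZero_of_add {X Y Z : M} {a : X ⟶ Y} {b : Y ⟶ X} {c : X ⟶ Z}
    {d : Z ⟶ X} (h : a ≫ b + c ≫ d = 𝟙 X) (hY : IsZero Y) (hZ : IsZero Z) : IsZero X := by
  rw [IsZero.iff_id_eq_zero, ← h, hY.eq_of_tgt a 0, hZ.eq_of_tgt c 0, zero_comp, zero_comp,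
    add_zero]

lemma yonedaProp_of_add {X Y Z : DerivedCategory M} {a : X ⟶ Y} {b : Y ⟶ X} {c : X ⟶ Z}
    {d : Z ⟶ X} (h : a ≫ b + c ≫ d = 𝟙 X) (hY : yonedaProp M Y) (hZ : yonedaProp M Z) :
    yonedaProp M X := by
  obtain ⟨m, m', _, _⟩ := exists_bounds hY
  obtain ⟨n, n', _, _⟩ := exists_bounds hZ
  have : X.IsGE (min m n) := (isGE_iff _ _).2 fun k hk =>
    isZero_of_add (map_add_eq_id h (homologyFunctor M k)) (isZero_of_isGE Y m k (by lia))
      (isZero_of_isGE Z n k (by lia))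
  have : X.IsLE (max m' n') := (isLE_iff _ _).2 fun k hk =>
    isZero_of_add (map_add_eq_id h (homologyFunctor M k)) (isZero_of_isLE Y m' k (by lia))
      (isZero_of_isLE Z n' k (by lia))
  exact yonedaProp_of_isLiftable (a := min m n) (b := max m' n') fun k =>
    isLiftable_of_add (map_add_eq_id h (shiftFunctor _ k))
      (isLiftable_of_yonedaProp ((yonedaProp M).le_shift k _ hY))
      (isLiftable_of_yonedaProp ((yonedaProp M).le_shift k _ hZ))

instance : HasBinaryBiproducts (YonedaCat M) where
  has_binary_biproduct X Y := by
    have h : yonedaProp M (X.obj ⊞ Y.obj) :=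
      yonedaProp_of_add biprod.total X.property Y.property
    exact HasBinaryBiproduct.mk
      { bicone :=
          { pt := ⟨X.obj ⊞ Y.obj, h⟩
            fst := ObjectProperty.homMk biprod.fst
            snd := ObjectProperty.homMk biprod.snd
            inl := ObjectProperty.homMk biprod.inl
            inr := ObjectProperty.homMk biprod.inr
            inl_fst := by ext; exact biprod.inl_fst
            inl_snd := by ext; exact biprod.inl_snd
            inr_fst := by ext; exact biprod.inr_fst
            inr_snd := by ext; exact biprod.inr_snd }
        isBilimit := isBinaryBilimitOfTotal _ (by ext1; exact biprod.total) }

/-! #### Truncations -/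

/-- The truncations of objects of the Yoneda category are direct summands. -/
lemma exists_retraction {X A B : DerivedCategory M} (hX : yonedaProp M X) {n m : ℤ} (h : n < m)
    [A.IsLE n] [B.IsGE m] {f : A ⟶ X} {g : X ⟶ B} {δ : B ⟶ A⟦(1 : ℤ)⟧}
    (H : Triangle.mk f g δ ∈ distTriang _) : ∃ r : X ⟶ A, f ≫ r = 𝟙 A := by
  obtain ⟨k, C, i, a, b, hab⟩ := exists_sum_eq_id hX
  -- If C[i] lies in degrees ≤ n, its map to X dies in B and lifts to A; otherwise A admits no
  -- nonzero map to C[i]. Either way the part of the identity seen by A factors through `f`.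
  have hb (j : Fin k) : ∃ β : ((singleFunctor M 0).obj (C j))⟦i j⟧ ⟶ A,
      f ≫ a j ≫ β ≫ f = f ≫ a j ≫ b j := by
    rcases le_or_gt (-i j) n with hj | hj
    · obtain ⟨β, hβ⟩ := exists_lift_mor₁ H (b j) (TStructure.t.zero_of_isLE_of_isGE _ (-i j) m
        (by lia) inferInstance inferInstance)
      exact ⟨β, by rw [hβ]⟩
    · refine ⟨0, ?_⟩
      rw [← Category.assoc f, ← Category.assoc f, TStructure.t.zero (f ≫ a j) n (-i j)]
      simp
  choose β hβ using hb
  refine ⟨∑ j, a j ≫ β j, ?_⟩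
  have h₁ : (f ≫ (∑ j, a j ≫ β j) - 𝟙 A) ≫ f = 0 := by
    rw [Preadditive.sub_comp, Category.assoc, Preadditive.sum_comp, Preadditive.comp_sum]
    simp only [Category.assoc, hβ]
    rw [← Preadditive.comp_sum, hab]
    simp
  -- The defect of the retraction is killed by `f`, so it factors through B[-1]. This lies in
  -- degrees ≥ m + 1, while A lies in degrees ≤ n < m, so the defect is zero.
  obtain ⟨c, hc⟩ := exists_lift_mor₁ (inv_rot_of_distTriang _ H)
    (f ≫ (∑ j, a j ≫ β j) - 𝟙 A) h₁
  have : (B⟦(-1 : ℤ)⟧).IsGE (m + 1) := TStructure.t.isGE_shift B m (-1) (m + 1)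
  have hc₀ : c = 0 := TStructure.t.zero_of_isLE_of_isGE (Y := B⟦(-1 : ℤ)⟧) c n (m + 1)
    (by lia) inferInstance inferInstance
  rw [hc₀, zero_comp] at hc
  exact sub_eq_zero.1 hc

/-- Objects of the Yoneda category split as direct sums of their truncations. -/
lemma exists_splitting {X : DerivedCategory M} (hX : yonedaProp M X) (n : ℤ) :
    ∃ (A B : DerivedCategory M) (_ : A.IsLE n) (_ : B.IsGE (n + 1)) (_ : yonedaProp M A)
      (_ : yonedaProp M B) (f : A ⟶ X) (r : X ⟶ A) (g : X ⟶ B) (s : B ⟶ X),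
      f ≫ r = 𝟙 A ∧ s ≫ g = 𝟙 B ∧ f ≫ g = 0 ∧ s ≫ r = 0 ∧ r ≫ f + g ≫ s = 𝟙 X := by
  obtain ⟨A, B, hA, hB, f, g, δ, H⟩ := TStructure.t.exists_triangle X n (n + 1) rfl
  have : A.IsLE n := ⟨hA⟩
  have : B.IsGE (n + 1) := ⟨hB⟩
  obtain ⟨r, hr⟩ := exists_retraction hX (lt_add_one n) H
  obtain ⟨s, hs⟩ := exists_desc_mor₂ H (𝟙 X - r ≫ f) (by
    rw [Preadditive.comp_sub, reassoc_of% hr, Category.comp_id, sub_self])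
  have hδ : δ = 0 := by
    have := comp_mor₃_mor₁ H
    rw [← Category.comp_id δ, ← CategoryTheory.Functor.map_id, ← hr, Functor.map_comp,
      reassoc_of% this, zero_comp]
  have : Epi g := by
    obtain ⟨t, ht⟩ := exists_lift_mor₂ H (𝟙 B) (by rw [hδ, comp_zero])
    exact (⟨⟨t, ht.symm⟩⟩ : IsSplitEpi g).epi
  have hfg : f ≫ g = 0 := comp_mor₁_mor₂ H
  have hsg : s ≫ g = 𝟙 B := by
    rw [← cancel_epi g, ← Category.assoc, ← hs, Preadditive.sub_comp, Category.assoc, hfg]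
    simp
  have hsr : s ≫ r = 0 := by
    rw [← cancel_epi g, ← Category.assoc, ← hs, Preadditive.sub_comp, Category.assoc, hr]
    simp
  exact ⟨A, B, inferInstance, inferInstance, yonedaProp_of_retract ⟨f, r, hr⟩ hX,
    yonedaProp_of_retract ⟨s, g, hsg⟩ hX, f, r, g, s, hr, hsg, hfg, hsr, by rw [← hs]; abel⟩

/-! #### Cocones of morphisms of the Yoneda category -/

section Cocone

variable {A B Z : DerivedCategory M} {c : Z ⟶ B} {f : B ⟶ A} {δ : A ⟶ Z⟦(1 : ℤ)⟧}
  (H : Triangle.mk c f δ ∈ distTriang _)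

include H

/-- The bound on A moves by one because the homology of A in degree k - 1 contributes to that of the
cocone in degree k. -/
lemma isGE_of_distinguished {m m' n : ℤ} [A.IsGE m] [B.IsGE m'] (h : n ≤ m + 1) (h' : n ≤ m') :
    Z.IsGE n := by
  refine (isGE_iff _ _).2 fun k hk => ?_
  refine (HomologySequence.exact₁ _ H (k - 1) k (by lia)).isZero_of_both_zeros ?_ ?_
  · exact (isZero_of_isGE A m (k - 1) (by lia)).eq_of_src _ _
  · exact (isZero_of_isGE B m' k (by lia)).eq_of_tgt _ _

lemma isLE_of_distinguished {m m' n : ℤ} [A.IsLE m] [B.IsLE m'] (h : m + 1 ≤ n) (h' : m' ≤ n) :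
    Z.IsLE n := by
  refine (isLE_iff _ _).2 fun k hk => ?_
  refine (HomologySequence.exact₁ _ H (k - 1) k (by lia)).isZero_of_both_zeros ?_ ?_
  · exact (isZero_of_isLE A m (k - 1) (by lia)).eq_of_src _ _
  · exact (isZero_of_isLE B m' k (by lia)).eq_of_tgt _ _

/-- A four-lemma argument along B[-1] → A[-1] → Z → B. On objects of the Yoneda category, maps to an
injective J are the same as maps from H⁰ to J. The restriction of `u` to A[-1] therefore lifts and
extends to Z; the remaining error comes from H⁰(B) by injectivity of J, and is corrected there. -/
lemma exists_degreeZero_eq (hA : yonedaProp M A) (hB : yonedaProp M B) {J : M} [Injective J]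
    (u : (homologyFunctor M 0).obj Z ⟶ J) :
    ∃ v : Z ⟶ (singleFunctor M 0).obj J, degreeZero v = u := by
  let T := Triangle.mk c f δ
  have H' : T.invRotate ∈ distTriang _ := inv_rot_of_distTriang _ H
  have H'' : T.invRotate.invRotate ∈ distTriang _ := inv_rot_of_distTriang _ H'
  let d : A⟦(-1 : ℤ)⟧ ⟶ Z := T.invRotate.mor₁
  let d' : B⟦(-1 : ℤ)⟧ ⟶ A⟦(-1 : ℤ)⟧ := T.invRotate.invRotate.mor₁
  have hd : d' ≫ d = 0 := comp_distTriang_mor_zero₁₂ _ H''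
  obtain ⟨ψ, hψ⟩ := isLiftable_of_yonedaProp ((yonedaProp M).le_shift (-1) _ hA) J
    ((homologyFunctor M 0).map d ≫ u)
  obtain ⟨v, hv⟩ : ∃ v : Z ⟶ (singleFunctor M 0).obj J, ψ = d ≫ v :=
    Triangle.yoneda_exact₂ _ H'' ψ (by
      refine isInjectivelyFaithful_of_yonedaProp ((yonedaProp M).le_shift (-1) _ hB) J (d' ≫ ψ) ?_
      rw [degreeZero_comp, hψ, ← Category.assoc, ← Functor.map_comp, hd]
      simp)
  have hex : (ShortComplex.mk ((homologyFunctor M 0).map d) ((homologyFunctor M 0).map c)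
      (by rw [← Functor.map_comp, show d ≫ c = 0 from comp_distTriang_mor_zero₁₂ _ H',
        Functor.map_zero])).Exact := HomologySequence.exact₂ _ H' 0
  have hw : (homologyFunctor M 0).map d ≫ (degreeZero v - u) = 0 := by
    rw [Preadditive.comp_sub, ← degreeZero_comp, ← hv, hψ, sub_self]
  obtain ⟨w, hw⟩ : ∃ w : (homologyFunctor M 0).obj B ⟶ J,
      (homologyFunctor M 0).map c ≫ w = degreeZero v - u :=
    ⟨hex.descToInjective _ hw, hex.comp_descToInjective _ hw⟩
  obtain ⟨χ, hχ⟩ := isLiftable_of_yonedaProp hB J w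
  refine ⟨v - c ≫ χ, ?_⟩
  rw [degreeZero_sub, degreeZero_comp, hχ, hw]
  abel

/-- Embed H⁰(Z) in an injective object and lift the embedding to a map `v` from Z. The composite of
`v` with the projection to the cokernel kills every map from the Yoneda category, because such maps
to an injective are determined on H⁰. By hypothesis the composite vanishes, so `v` factors through
H⁰(Z), and the factor has identity component in degree zero. -/
lemma isLiftable_of_ghost [EnoughInjectives M] (hA : yonedaProp M A) (hB : yonedaProp M B)
    (hZ : ∀ (W : M) (φ : Z ⟶ (singleFunctor M 0).obj W),
      (∀ (V : DerivedCategory M) (_ : yonedaProp M V) (a : V ⟶ Z), a ≫ φ = 0) → φ = 0) :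
    IsLiftable Z := by
  let u := Injective.ι ((homologyFunctor M 0).obj Z)
  obtain ⟨v, hv⟩ := exists_degreeZero_eq H hA hB u
  have hS : (ShortComplex.mk u (cokernel.π u) (cokernel.condition u)).ShortExact :=
    { exact := ShortComplex.exact_cokernel u }
  obtain ⟨v₀, hv₀⟩ : ∃ v₀ : Z ⟶ (singleFunctor M 0).obj _, v = v₀ ≫ (singleFunctor M 0).map u :=
    Triangle.coyoneda_exact₂ _ hS.singleTriangle_distinguished v (by
      refine hZ _ _ fun V hV a => ?_
      obtain ⟨ζ, hζ⟩ := isLiftable_of_yonedaProp hV _ ((homologyFunctor M 0).map a)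
      have h : a ≫ v = ζ ≫ (singleFunctor M 0).map u := by
        rw [← sub_eq_zero]
        apply isInjectivelyFaithful_of_yonedaProp hV
        rw [degreeZero_sub, degreeZero_comp, degreeZero_comp_map, hv, hζ, sub_self]
      change a ≫ v ≫ (singleFunctor M 0).map (cokernel.π u) = 0
      rw [← Category.assoc, h, Category.assoc, ← Functor.map_comp, cokernel.condition,
        Functor.map_zero, comp_zero])
  refine isLiftable_of_id v₀ ?_
  rw [← cancel_mono u, ← degreeZero_comp_map, ← hv₀, hv, Category.id_comp]

/-- The hypothesis is stable under shifts, so liftability holds in every degree, and the bounded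
complex Z splits into its homology. -/
lemma yonedaProp_of_ghost [EnoughInjectives M] (hA : yonedaProp M A) (hB : yonedaProp M B)
    (hZ : ∀ (W : DerivedCategory M) (_ : yonedaProp M W) (φ : Z ⟶ W),
      (∀ (V : DerivedCategory M) (_ : yonedaProp M V) (a : V ⟶ Z), a ≫ φ = 0) → φ = 0) :
    yonedaProp M Z := by
  obtain ⟨m, m', _, _⟩ := exists_bounds hA
  obtain ⟨n, n', _, _⟩ := exists_bounds hB
  have : Z.IsGE (min (m + 1) n) := isGE_of_distinguished H (m := m) (m' := n) (by lia) (by lia)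
  have : Z.IsLE (max (m' + 1) n') := isLE_of_distinguished H (m := m') (m' := n') (by lia) (by lia)
  refine yonedaProp_of_isLiftable (a := min (m + 1) n) (b := max (m' + 1) n') fun k =>
    isLiftable_of_ghost (shift_distinguished H k) ((yonedaProp M).le_shift k _ hA)
      ((yonedaProp M).le_shift k _ hB) fun W φ hφ => ?_
  obtain ⟨v, e, rfl⟩ := exists_shift_comp_eq φ
  have : v = 0 := hZ _ ((yonedaProp M).le_shift (-k) _ (yonedaProp_single W)) v fun V hV a => by
    apply (shiftFunctor _ k).map_injective
    have h := hφ _ ((yonedaProp M).le_shift k _ hV) (a⟦k⟧')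
    rw [Functor.map_comp, Functor.map_zero, ← cancel_mono e.hom, Category.assoc, h, zero_comp]
  rw [this, Functor.map_zero, zero_comp]

end Cocone

/-- Finitely presented modules without extensions by representable modules are presented by
triangles. -/
lemma exists_trianglePresentation [EnoughInjectives M] {A B : YonedaCat M} {f : B.obj ⟶ A.obj}
    {X : Mod (YonedaCat M)} {p : representable A ⟶ X} [Epi p] (w : rmap f ≫ p = 0)
    (hp : (ShortComplex.mk _ _ w).Exact)
    (hX : ∀ W : YonedaCat M, haveI := HasExt.standard (Mod (YonedaCat M))
      Subsingleton (Abelian.Ext X (representable W) 1)) :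
    ∃ (Z : DerivedCategory M) (c : Z ⟶ B.obj) (δ : A.obj ⟶ Z⟦(1 : ℤ)⟧)
      (T : TrianglePresentation X), Triangle.mk c f δ ∈ distTriang _ ∧
      T.K = A ∧ T.E.obj = Z⟦(1 : ℤ)⟧ ∧ T.N.obj = B.obj⟦(1 : ℤ)⟧ := by
  obtain ⟨Z, c, δ, H⟩ := distinguished_cocone_triangle₁ f
  have hZ : yonedaProp M Z := yonedaProp_of_ghost H A.property B.property fun W hW φ hφ =>
    eq_zero_of_ghost H (W := ⟨W, hW⟩) w hp (hX _) φ fun V a => hφ _ V.property a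
  obtain ⟨T, h⟩ := exists_trianglePresentation_of_cocone hZ H w hp
  exact ⟨Z, c, δ, T, H, h⟩

lemma nonempty_trianglePresentation [EnoughInjectives M] (X : Mod (YonedaCat M))
    (hX : cohenMacaulay _ X) : Nonempty (TrianglePresentation X) := by
  obtain ⟨⟨A, B, f, p, w, hp, _⟩, hX⟩ := hX
  obtain ⟨f, rfl⟩ := exists_rmap f
  obtain ⟨_, _, _, T, _⟩ := exists_trianglePresentation w hp fun W => hX W 1 one_pos
  exact ⟨T⟩

variable (M) in
/-- The Cohen-Macaulay modules over the Yoneda category form a Frobenius category. -/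
lemma isFrobenius_yoneda [EnoughInjectives M] : IsFrobenius (cohenMacaulay (YonedaCat M)) :=
  isFrobenius_cohenMacaulay _ nonempty_trianglePresentation

end Yoneda

/-! ### Splitting off representable summands -/

section Presentation

variable {D : Type u} [Category.{v} D] [Preadditive D] {P : ObjectProperty D}

lemma rmap_add {A B : P.FullSubcategory} (f g : A.obj ⟶ B.obj) :
    (rmap (f + g) : representable A ⟶ representable B) = rmap f + rmap g :=
  representableMap_add (ObjectProperty.homMk f) (ObjectProperty.homMk g)

lemma rmap_sub {A B : P.FullSubcategory} (f g : A.obj ⟶ B.obj) :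
    (rmap (f - g) : representable A ⟶ representable B) = rmap f - rmap g :=
  representableMap_sub (ObjectProperty.homMk f) (ObjectProperty.homMk g)

lemma exists_hom_of_epi {X Y : Mod P.FullSubcategory} {K : P.FullSubcategory}
    (p : representable K ⟶ X) [Epi p] (φ : representable K ⟶ Y)
    (h : ∀ (Z : P.FullSubcategory) (a : Z.obj ⟶ K.obj), rmap a ≫ p = 0 → rmap a ≫ φ = 0) :
    ∃ ψ : X ⟶ Y, p ≫ ψ = φ := by
  have h : kernel.ι p ≫ φ = 0 := mod_hom_ext fun Z x => by
    obtain ⟨a, ha⟩ := exists_rmap (x ≫ kernel.ι p)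
    rw [← Category.assoc, ← ha, h Z a (by rw [ha]; simp), comp_zero]
  have hp : (ShortComplex.mk _ _ (kernel.condition p)).Exact := ShortComplex.exact_kernel p
  exact ⟨hp.desc _ h, hp.g_desc _ h⟩

variable [HasZeroObject D] [HasShift D ℤ] [∀ n : ℤ, (shiftFunctor D n).Additive]
  [Pretriangulated D]

namespace TrianglePresentation

/-- A quotient of a representable module is determined by its kernel, so a quotient with the same
kernel as `f` is the image of `f`. -/
lemma exists_ofKernel {K E N : P.FullSubcategory} {f : K.obj ⟶ E.obj} {g : E.obj ⟶ N.obj}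
    {h : N.obj ⟶ K.obj⟦(1 : ℤ)⟧} (H : Triangle.mk f g h ∈ distTriang D)
    {X : Mod P.FullSubcategory} (p : representable K ⟶ X) [Epi p]
    (hp : ∀ (Z : P.FullSubcategory) (a : Z.obj ⟶ K.obj), rmap a ≫ p = 0 ↔ a ≫ f = 0) :
    ∃ T : TrianglePresentation X, T.K = K ∧ T.E = E ∧ T.N = N := by
  obtain ⟨i, hi⟩ := exists_hom_of_epi p (rmap f : _ ⟶ representable E) fun Z a ha => by
    rw [← rmap_comp, (hp Z a).1 ha, rmap_zero]
  exact ⟨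
    { K := K
      E := E
      N := N
      f := f
      g := g
      h := h
      distinguished := H
      p := p
      i := i
      epi := inferInstance
      mono := mono_of_representable _ fun Z x hx => by
        obtain ⟨y, rfl⟩ := exists_representable_lift p x
        obtain ⟨a, rfl⟩ := exists_rmap y
        rw [Category.assoc, hi, ← rmap_comp, rmap_eq_zero_iff] at hx
        exact (hp Z a).2 hx
      fac := hi }, rfl, rfl, rfl⟩

lemma exists_hom {X Y : Mod P.FullSubcategory} (T : TrianglePresentation X)
    (φ : representable T.K ⟶ Y)
    (h : ∀ (Z : P.FullSubcategory) (a : Z.obj ⟶ T.K.obj), a ≫ T.f = 0 → rmap a ≫ φ = 0) :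
    ∃ ψ : X ⟶ Y, T.p ≫ ψ = φ :=
  exists_hom_of_epi T.p φ fun Z a ha => h Z a ((T.rmap_p_eq_zero_iff a).1 ha)

/-- A direct summand of the first two terms of a triangle can be split off from the module
presented by it. -/
lemma exists_split_off [IsTriangulated D] {X : Mod P.FullSubcategory} (T : TrianglePresentation X)
    {A : P.FullSubcategory} {K' : D} (hK' : P K') {σ : A.obj ⟶ T.K.obj} {π : T.K.obj ⟶ K'}
    {s : K' ⟶ T.K.obj} (hs : s ≫ π = 𝟙 K')
    {δ : K' ⟶ A.obj⟦(1 : ℤ)⟧} (H : Triangle.mk σ π δ ∈ distTriang D)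
    {θ : T.E.obj ⟶ A.obj} (hθ : σ ≫ T.f ≫ θ = 𝟙 A.obj)
    (hP : ∀ {Y Z : D}, Retract Y Z → P Z → P Y) :
    ∃ (Y : Mod P.FullSubcategory) (T' : TrianglePresentation Y) (a : X ⟶ Y) (b : Y ⟶ X)
      (c : X ⟶ representable A) (d : representable A ⟶ X), T'.K.obj = K' ∧
      Nonempty (Retract T'.E.obj T.E.obj) ∧ T'.N = T.N ∧ b ≫ a = 𝟙 Y ∧
      a ≫ b + c ≫ d = 𝟙 X := by
  -- The retraction `θ` makes A a summand of `T.E` with complement E'.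
  obtain ⟨E', γ, ε, HE⟩ := distinguished_cocone_triangle (σ ≫ T.f)
  have hθ' : (σ ≫ T.f) ≫ θ = 𝟙 A.obj := by rw [Category.assoc, hθ]
  obtain ⟨t, ht⟩ := exists_desc_mor₂ HE (𝟙 T.E.obj - θ ≫ σ ≫ T.f) (by
    rw [Preadditive.comp_sub, ← Category.assoc (σ ≫ T.f), hθ', Category.id_comp, Category.comp_id,
      sub_self])
  have hε : ε = 0 := by
    have := comp_mor₃_mor₁ HE
    rw [← Category.comp_id ε, ← CategoryTheory.Functor.map_id, ← hθ',
      Functor.map_comp, reassoc_of% this, zero_comp]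
  have : Epi γ := by
    obtain ⟨t, ht⟩ := exists_lift_mor₂ HE (𝟙 E') (by rw [hε, comp_zero])
    exact (⟨⟨t, ht.symm⟩⟩ : IsSplitEpi γ).epi
  have htγ : t ≫ γ = 𝟙 E' := by
    rw [← cancel_epi γ, ← Category.assoc, ← ht, Preadditive.sub_comp, Category.assoc,
      comp_mor₁_mor₂ HE]
    simp
  let r : Retract E' T.E.obj := ⟨t, γ, htγ⟩
  -- The octahedral axiom removes A from both K and E and yields a triangle K' → E' → N with the
  -- same third term.
  let O := Triangulated.someOctahedron rfl H T.distinguished HE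
  let f' : K' ⟶ E' := O.m₁
  have hf' : π ≫ f' = T.f ≫ γ := O.comm₁
  have HO : Triangle.mk f' O.m₃ (T.h ≫ π⟦(1 : ℤ)⟧') ∈ distTriang D := O.mem
  let d : representable A ⟶ X := rmap σ ≫ T.p
  let c : X ⟶ representable A := T.i ≫ rmap θ
  have hdc : d ≫ c = 𝟙 _ := by
    simp only [d, c, Category.assoc]
    rw [← Category.assoc T.p, T.fac, ← rmap_comp, ← rmap_comp, hθ]
    exact representableMap_id A
  let a : X ⟶ cokernel d := cokernel.π d
  have had : d ≫ a = 0 := cokernel.condition d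
  have hex : (ShortComplex.mk d a had).Exact := ShortComplex.exact_cokernel d
  obtain ⟨b, hb⟩ : ∃ b : cokernel d ⟶ X, a ≫ b = 𝟙 X - c ≫ d :=
    ⟨cokernel.desc d (𝟙 X - c ≫ d) (by rw [Preadditive.comp_sub, reassoc_of% hdc]; simp),
      cokernel.π_desc _ _ _⟩
  have hba : b ≫ a = 𝟙 _ := by
    rw [← cancel_epi a, ← Category.assoc, hb, Preadditive.sub_comp, Category.assoc, had]
    simp
  let K'' : P.FullSubcategory := ⟨K', hK'⟩
  let E'' : P.FullSubcategory := ⟨E', hP r T.E.property⟩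
  let p : representable K'' ⟶ cokernel d := rmap s ≫ T.p ≫ a
  have hp : Epi p := epi_of_representable_lift _ fun Z x => by
    obtain ⟨x, rfl⟩ := exists_representable_lift a x
    obtain ⟨k, rfl⟩ := T.exists_lift x
    refine ⟨rmap (B := K'') (k ≫ π), ?_⟩
    obtain ⟨l, hl⟩ := exists_lift_mor₁ H (k - k ≫ π ≫ s) (by
      rw [Preadditive.sub_comp, Category.assoc, Category.assoc, hs]; simp)
    have hz : rmap (l ≫ σ) ≫ T.p ≫ a = 0 := by
      rw [rmap_comp (B := A), Category.assoc, ← Category.assoc (rmap σ), had, comp_zero]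
    rw [← hl, rmap_sub, Preadditive.sub_comp, sub_eq_zero] at hz
    refine Eq.trans ?_ (hz.symm.trans (Category.assoc _ _ _).symm)
    exact (Category.assoc _ _ _).symm.trans (congrArg (· ≫ T.p ≫ a)
      ((rmap_comp (B := K'') (E := T.K) (k ≫ π) s).symm.trans
        (congrArg rmap (Category.assoc _ _ _))))
  obtain ⟨T', hK, hE, hN⟩ := exists_ofKernel (K := K'') (E := E'') (N := T.N) HO p fun Z k => by
    have hkp : rmap k ≫ p = (rmap (k ≫ s) ≫ T.p) ≫ a := by
      rw [rmap_comp (B := K''), Category.assoc, Category.assoc]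
    rw [hkp]
    constructor
    · intro h
      obtain ⟨l, hl⟩ := exact_representable_lift hex _ h
      obtain ⟨l, rfl⟩ := exists_rmap l
      have : (k ≫ s - l ≫ σ) ≫ T.f = 0 := by
        rw [← T.rmap_p_eq_zero_iff, rmap_sub, Preadditive.sub_comp, rmap_comp (B := A),
          Category.assoc (rmap l)]
        exact sub_eq_zero.2 hl.symm
      rw [Preadditive.sub_comp, sub_eq_zero] at this
      rw [← Category.comp_id k, ← hs, Category.assoc, Category.assoc, hf', ← Category.assoc,
        ← Category.assoc, this, Category.assoc, Category.assoc, ← Category.assoc σ,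
        comp_mor₁_mor₂ HE, comp_zero]
    · intro h
      have : ((k ≫ s) ≫ T.f) ≫ γ = 0 := by
        rw [Category.assoc, ← hf', Category.assoc, reassoc_of% hs, h]
      obtain ⟨l, hl⟩ := exists_lift_mor₁ HE _ this
      have : rmap (k ≫ s) ≫ T.p = rmap l ≫ d := by
        rw [← sub_eq_zero, ← Category.assoc, ← rmap_comp, ← Preadditive.sub_comp, ← rmap_sub,
          T.rmap_p_eq_zero_iff, Preadditive.sub_comp, hl, Category.assoc, sub_self]
      rw [this, Category.assoc, had, comp_zero]
  exact ⟨_, T', a, b, c, d, by rw [hK], by rw [hE]; exact ⟨r⟩, hN, hba, by rw [hb]; abel⟩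

end TrianglePresentation

end Presentation

/-- The five lemma for short exact pieces. -/
lemma isIso_of_five {A : Type*} [Category* A] [Abelian A] {X₀ X₁ X₂ X₃ X₄ Y₀ Y₁ Y₂ Y₃ Y₄ : A}
    {a₀ : X₀ ⟶ X₁} {a₁ : X₁ ⟶ X₂} {a₂ : X₂ ⟶ X₃} {a₃ : X₃ ⟶ X₄} {b₀ : Y₀ ⟶ Y₁} {b₁ : Y₁ ⟶ Y₂}
    {b₂ : Y₂ ⟶ Y₃} {b₃ : Y₃ ⟶ Y₄} (w₁ : a₀ ≫ a₁ = 0) (w₂ : a₁ ≫ a₂ = 0) (w₃ : a₂ ≫ a₃ = 0)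
    (w₁' : b₀ ≫ b₁ = 0) (w₂' : b₁ ≫ b₂ = 0) (w₃' : b₂ ≫ b₃ = 0)
    (h₁ : (ShortComplex.mk _ _ w₁).Exact) (h₂ : (ShortComplex.mk _ _ w₂).Exact)
    (h₃ : (ShortComplex.mk _ _ w₃).Exact) (h₁' : (ShortComplex.mk _ _ w₁').Exact)
    (h₂' : (ShortComplex.mk _ _ w₂').Exact) (h₃' : (ShortComplex.mk _ _ w₃').Exact)
    {φ₀ : X₀ ⟶ Y₀} {φ₁ : X₁ ⟶ Y₁} {φ₂ : X₂ ⟶ Y₂} {φ₃ : X₃ ⟶ Y₃} {φ₄ : X₄ ⟶ Y₄}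
    (c₀ : a₀ ≫ φ₁ = φ₀ ≫ b₀) (c₁ : a₁ ≫ φ₂ = φ₁ ≫ b₁) (c₂ : a₂ ≫ φ₃ = φ₂ ≫ b₂)
    (c₃ : a₃ ≫ φ₄ = φ₃ ≫ b₃) (i₀ : IsIso φ₀) (i₁ : IsIso φ₁)
    (i₃ : IsIso φ₃) (i₄ : IsIso φ₄) : IsIso φ₂ := by
  let R := ComposableArrows.mk₄ a₀ a₁ a₂ a₃
  let R' := ComposableArrows.mk₄ b₀ b₁ b₂ b₃
  have hR : R.Exact := ComposableArrows.exact_of_δ₀ h₁.exact_toComposableArrows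
    (ComposableArrows.exact_of_δ₀ h₂.exact_toComposableArrows h₃.exact_toComposableArrows)
  have hR' : R'.Exact := ComposableArrows.exact_of_δ₀ h₁'.exact_toComposableArrows
    (ComposableArrows.exact_of_δ₀ h₂'.exact_toComposableArrows h₃'.exact_toComposableArrows)
  let φ : R ⟶ R' := ComposableArrows.homMk₄ φ₀ φ₁ φ₂ φ₃ φ₄ c₀ c₁ c₂ c₃
  exact Abelian.isIso_of_epi_of_isIso_of_isIso_of_mono hR hR' φ
    (inferInstanceAs (Epi φ₀)) (inferInstanceAs (IsIso φ₁)) (inferInstanceAs (IsIso φ₃))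
    (inferInstanceAs (Mono φ₄))

section Yoneda

open DerivedCategory

variable {M : Type u} [Category.{v} M] [Abelian M] [HasDerivedCategory.{w} M]

/-! #### The modules `U₀(-, A)` -/

/-- The canonical projection from a representable module. -/
def degreeZeroProj (A : M) :
    representable (⟨(singleFunctor M 0).obj A, yonedaProp_single A⟩ : YonedaCat M) ⟶
      degreeZeroModule A :=
  (homRepresentableEquiv _ _).symm
    ((singleFunctor M 0).map ((singleFunctorCompHomologyFunctorIso M 0).hom.app A))

lemma homRepresentableEquiv_rmap_degreeZeroProj (A : M) {Z : YonedaCat M}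
    (a : Z.obj ⟶ (singleFunctor M 0).obj A) :
    homRepresentableEquiv Z (degreeZeroModule A) (rmap a ≫ degreeZeroProj A) =
      (singleFunctor M 0).map (degreeZero a) := by
  refine Eq.trans ?_ ((singleFunctor M 0).map_comp _ _).symm
  change (singleFunctor M 0).map ((homologyFunctor M 0).map (𝟙 _ ≫ a)) ≫ _ = _
  rw [Category.id_comp]

/-- Morphisms from a representable module to `U₀(-, A)`. -/
lemma exists_degreeZero_of_hom (A : M) {Z : YonedaCat M} (x : representable Z ⟶ degreeZeroModule A) :
    ∃ u : (homologyFunctor M 0).obj Z.obj ⟶ A,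
      homRepresentableEquiv Z (degreeZeroModule A) x = (singleFunctor M 0).map u := by
  obtain ⟨u, hu⟩ := (singleFunctor M 0).map_surjective
    (Y := A) (homRepresentableEquiv Z (degreeZeroModule A) x)
  exact ⟨u, hu.symm⟩

lemma rmap_degreeZeroProj_eq_zero_iff {A : M} {Z : YonedaCat M}
    (a : Z.obj ⟶ (singleFunctor M 0).obj A) :
    rmap a ≫ degreeZeroProj A = 0 ↔ degreeZero a = 0 := by
  rw [← (homRepresentableEquiv Z (degreeZeroModule A)).apply_eq_iff_eq,
    homRepresentableEquiv_rmap_degreeZeroProj]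
  constructor
  · intro h
    exact (singleFunctor M 0).map_injective (Eq.trans h ((singleFunctor M 0).map_zero _ _).symm)
  · intro h
    rw [h]
    exact Functor.map_zero _ _ _

instance (A : M) : Epi (degreeZeroProj A) := epi_of_representable_lift _ fun Z x => by
  obtain ⟨u, hu⟩ := exists_degreeZero_of_hom A x
  obtain ⟨φ, hφ⟩ := isLiftable_of_yonedaProp Z.property A u
  refine ⟨rmap (B := ⟨(singleFunctor M 0).obj A, yonedaProp_single A⟩) φ, ?_⟩
  apply (homRepresentableEquiv Z (degreeZeroModule A)).injective
  rw [hu, ← hφ]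
  exact homRepresentableEquiv_rmap_degreeZeroProj A φ

/-- A morphism from a representable module to `U₀(-, A)` vanishes if there is no homology in degree
zero. -/
lemma eq_zero_of_isZero_homology {A : M} {Z : YonedaCat M}
    (hZ : IsZero ((homologyFunctor M 0).obj Z.obj)) (x : representable Z ⟶ degreeZeroModule A) :
    x = 0 := by
  obtain ⟨u, hu⟩ := exists_degreeZero_of_hom A x
  apply (homRepresentableEquiv Z (degreeZeroModule A)).injective
  rw [hu, hZ.eq_of_src u 0]
  exact Functor.map_zero _ _ _

/-- The presentation of `U₀(-, A)` given by an embedding of `A` into an injective object. -/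
lemma exists_presentation_degreeZeroModule [EnoughInjectives M] (A : M) :
    ∃ T : TrianglePresentation (degreeZeroModule A), ∃ J B : M,
      T.K.obj = (singleFunctor M 0).obj A ∧ T.E.obj = (singleFunctor M 0).obj J ∧
      T.N.obj = (singleFunctor M 0).obj B := by
  let ι := Injective.ι A
  have hS : (ShortComplex.mk ι (cokernel.π ι) (cokernel.condition ι)).ShortExact :=
    { exact := ShortComplex.exact_cokernel ι }
  obtain ⟨T, hK, hE, hN⟩ := TrianglePresentation.exists_ofKernel
    (K := ⟨(singleFunctor M 0).obj A, yonedaProp_single A⟩)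
    (E := ⟨(singleFunctor M 0).obj (Injective.under A), yonedaProp_single _⟩)
    (N := ⟨(singleFunctor M 0).obj (cokernel ι), yonedaProp_single _⟩)
    (f := (singleFunctor M 0).map ι) (g := (singleFunctor M 0).map (cokernel.π ι))
    (h := hS.singleδ) hS.singleTriangle_distinguished (degreeZeroProj A) fun Z a => by
      rw [rmap_degreeZeroProj_eq_zero_iff]
      -- The kernel of the projection to U₀(-, A) consists of the maps with zero component in degree
      -- zero. After embedding A in an injective object, these are exactly the maps that become
      -- zero.
      constructor
      · intro h
        refine isInjectivelyFaithful_of_yonedaProp Z.property (Injective.under A) _ ?_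
        exact (degreeZero_comp_map a ι).trans (by rw [h, zero_comp])
      · intro h
        rw [← cancel_mono ι, zero_comp]
        exact (degreeZero_comp_map a ι).symm.trans ((congrArg degreeZero h).trans degreeZero_zero)
  exact ⟨T, Injective.under A, cokernel ι, by rw [hK], by rw [hE], by rw [hN]⟩

lemma cohenMacaulay_degreeZeroModule [EnoughInjectives M] (A : M) :
    cohenMacaulay (YonedaCat M) (degreeZeroModule A) := by
  obtain ⟨T, _⟩ := exists_presentation_degreeZeroModule A
  exact T.cohenMacaulay

/-! #### Truncations of triangles -/

lemma homologyFunctor_map_square {A B A' B' : DerivedCategory M} (n : ℤ) {a : A ⟶ B}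
    {b : B ⟶ B'} {c : A ⟶ A'} {d : A' ⟶ B'} (h : a ≫ b = c ≫ d) :
    (homologyFunctor M n).map a ≫ (homologyFunctor M n).map b =
      (homologyFunctor M n).map c ≫ (homologyFunctor M n).map d := by
  rw [← Functor.map_comp, h, Functor.map_comp]

/-- The cone of the truncation of a morphism of the Yoneda category with cone in the Yoneda
category belongs to the Yoneda category. -/
lemma yonedaProp_cone_of_truncation {K E N K' E' N' : DerivedCategory M} {f : K ⟶ E} {g : E ⟶ N}
    {h : N ⟶ K⟦(1 : ℤ)⟧} {f' : K' ⟶ E'} {g' : E' ⟶ N'} {h' : N' ⟶ K'⟦(1 : ℤ)⟧}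
    (H : Triangle.mk f g h ∈ distTriang _) (H' : Triangle.mk f' g' h' ∈ distTriang _)
    (hN : yonedaProp M N) (hK' : yonedaProp M K') (hE' : yonedaProp M E') [K'.IsLE 0] [E'.IsLE 0]
    [N'.IsLE 0]
    {κ : K' ⟶ K} {ε : E' ⟶ E} (comm : f' ≫ ε = κ ≫ f)
    (hκ : ∀ n ≤ 0, IsIso ((homologyFunctor M n).map κ))
    (hε : ∀ n ≤ 0, IsIso ((homologyFunctor M n).map ε)) : yonedaProp M N' := by
  obtain ⟨a, _, _, _⟩ := exists_bounds hK'
  obtain ⟨b, _, _, _⟩ := exists_bounds hE'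
  have : N'.IsGE (min (a - 1) b) := (isGE_iff _ _).2 fun k hk => by
    refine (HomologySequence.exact₃ _ H' k (k + 1) rfl).isZero_of_both_zeros ?_ ?_
    · exact (isZero_of_isGE E' b k (by lia)).eq_of_src _ _
    · exact (isZero_of_isGE K' a (k + 1) (by lia)).eq_of_tgt _ _
  obtain ⟨ν, hν, hν'⟩ : ∃ ν : N' ⟶ N, g' ≫ ν = ε ≫ g ∧ h' ≫ κ⟦(1 : ℤ)⟧' = ν ≫ h :=
    complete_distinguished_triangle_morphism _ _ H' H κ ε comm
  refine yonedaProp_of_isLiftable (a := min (a - 1) b) (b := 0) fun n => ?_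
  -- For n < 0 the five lemma identifies the homology of N' with that of N, because degree n + 1 is
  -- still in the truncated range. Degree zero needs a separate argument, and positive degrees carry
  -- no homology.
  rcases lt_trichotomy n 0 with hn | rfl | hn
  · have h₁ : IsIso ((homologyFunctor M n).map ν) := by
      let φ : Triangle.mk f' g' h' ⟶ Triangle.mk f g h :=
        { hom₁ := κ, hom₂ := ε, hom₃ := ν, comm₁ := comm, comm₂ := hν, comm₃ := hν' }
      have h₁ := hκ n (by lia)
      have h₂ := hε n (by lia)
      have h₃ := hκ (n + 1) (by lia)
      have h₄ := hε (n + 1) (by lia)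
      exact isIso_of_five _ _ _ _ _ _ (HomologySequence.exact₂ _ H' n)
        (HomologySequence.exact₃ _ H' n (n + 1) rfl) (HomologySequence.exact₁ _ H' n (n + 1) rfl)
        (HomologySequence.exact₂ _ H n)
        (HomologySequence.exact₃ _ H n (n + 1) rfl) (HomologySequence.exact₁ _ H n (n + 1) rfl)
        (φ₀ := (homologyFunctor M n).map κ) (φ₁ := (homologyFunctor M n).map ε)
        (φ₃ := (homologyFunctor M (n + 1)).map κ) (φ₄ := (homologyFunctor M (n + 1)).map ε)
        (homologyFunctor_map_square n comm) (homologyFunctor_map_square n hν)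
        ((homologyFunctor M 0).homologySequenceδ_naturality _ _ φ n (n + 1) rfl).symm
        (homologyFunctor_map_square (n + 1) comm) h₁ h₂ h₃ h₄
    have h₂ : IsIso ((homologyFunctor M 0).map (ν⟦n⟧')) :=
      (NatIso.isIso_map_iff ((homologyFunctor M 0).shiftIso n 0 n (by simp)) ν).2 h₁
    intro W u
    obtain ⟨φ, hφ⟩ := isLiftable_of_yonedaProp ((yonedaProp M).le_shift n _ hN) W
      (inv ((homologyFunctor M 0).map (ν⟦n⟧')) ≫ u)
    exact ⟨ν⟦n⟧' ≫ φ, by rw [degreeZero_comp, hφ, IsIso.hom_inv_id_assoc]⟩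
  · refine isLiftable_of_iso ((shiftFunctorZero _ ℤ).app _) ?_
    -- Since K' is in degrees ≤ 0, H⁰(E') → H⁰(N') is surjective, and a map from K' to degree zero
    -- is determined by its component there. So a lift of this surjection to E' vanishes on K' and
    -- descends to N'.
    obtain ⟨ψ, hψ⟩ := isLiftable_of_yonedaProp hE' _ ((homologyFunctor M 0).map g')
    have : f' ≫ ψ = 0 := eq_zero_of_degreeZero hK' _ (by
      rw [degreeZero_comp, hψ, ← Functor.map_comp, comp_mor₁_mor₂ H', Functor.map_zero])
    obtain ⟨φ, rfl⟩ := exists_desc_mor₂ H' ψ this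
    have : Epi ((homologyFunctor M 0).map g') :=
      (HomologySequence.epi_homologyMap_mor₂_iff _ H' 0 1 rfl).2
        ((isZero_of_isLE K' 0 1 (by lia)).eq_of_tgt _ _)
    refine isLiftable_of_id φ ?_
    rw [← cancel_epi ((homologyFunctor M 0).map g'), ← degreeZero_comp, hψ]
    exact (Category.comp_id _).symm
  · exact isLiftable_of_isZero (by 
      have : (N'⟦n⟧).IsLE (-n) := TStructure.t.isLE_shift N' 0 n (-n)
      exact isZero_of_isLE _ (-n) 0 (by lia))

end Yoneda

section Ext

open Abelian

variable {A : Type u} [Category.{v} A] [Abelian A]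

lemma subsingleton_ext_one_right {S : ShortComplex A} (hS : S.ShortExact) {Y : A}
    (h₂ : haveI := HasExt.standard A; Subsingleton (Ext S.X₂ Y 1))
    (h : ∀ u : S.X₁ ⟶ Y, ∃ v : S.X₂ ⟶ Y, S.f ≫ v = u) :
    haveI := HasExt.standard A; Subsingleton (Ext S.X₃ Y 1) := by
  have := HasExt.standard A
  refine subsingleton_of_forall_eq 0 fun x => ?_
  obtain ⟨u, rfl⟩ := Ext.contravariant_sequence_exact₃ hS Y x (Subsingleton.elim _ _)
    (add_zero 1)
  obtain ⟨u, rfl⟩ := Ext.homEquiv₀.symm.surjective u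
  obtain ⟨v, rfl⟩ := h u
  change hS.extClass.comp (Ext.mk₀ (S.f ≫ v)) _ = 0
  rw [← Ext.mk₀_comp_mk₀, hS.extClass_comp_assoc]

end Ext

/-! ### Truncation of presented modules -/

section Yoneda

open DerivedCategory

variable {M : Type u} [Category.{v} M] [Abelian M] [HasDerivedCategory.{w} M]

lemma isIso_homology_of_splitting {X A B : DerivedCategory M} {f : A ⟶ X} {r : X ⟶ A}
    {g : X ⟶ B} {s : B ⟶ X} (hfr : f ≫ r = 𝟙 A) (h : r ≫ f + g ≫ s = 𝟙 X) {n k : ℤ}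
    [B.IsGE (n + 1)] (hk : k ≤ n) : IsIso ((homologyFunctor M k).map f) := by
  refine ⟨(homologyFunctor M k).map r, ?_, ?_⟩
  · rw [← Functor.map_comp, hfr, CategoryTheory.Functor.map_id]
  · have := map_add_eq_id h (homologyFunctor M k)
    rwa [(isZero_of_isGE B (n + 1) k (by lia)).eq_of_tgt ((homologyFunctor M k).map g) 0, zero_comp,
      add_zero] at this

lemma isGE_of_retract {X Y : DerivedCategory M} (r : Retract X Y) {n : ℤ} [Y.IsGE n] :
    X.IsGE n := (isGE_iff _ _).2 fun k hk => by
  rw [IsZero.iff_id_eq_zero, ← CategoryTheory.Functor.map_id, ← r.retract, Functor.map_comp,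
    (isZero_of_isGE Y n k hk).eq_of_tgt ((homologyFunctor M k).map r.i) 0, zero_comp]

lemma isLE_of_retract {X Y : DerivedCategory M} (r : Retract X Y) {n : ℤ} [Y.IsLE n] :
    X.IsLE n := (isLE_iff _ _).2 fun k hk => by
  rw [IsZero.iff_id_eq_zero, ← CategoryTheory.Functor.map_id, ← r.retract, Functor.map_comp,
    (isZero_of_isLE Y n k hk).eq_of_tgt ((homologyFunctor M k).map r.i) 0, zero_comp]

variable [EnoughInjectives M]

/-- Modules presented by triangles have a submodule presented by a triangle in nonpositive degrees
such that the quotient is presented by a triangle in nonnegative degrees whose first term is in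
positive degrees. -/
lemma TrianglePresentation.exists_truncation {X : Mod (YonedaCat M)} (T : TrianglePresentation X) :
    ∃ (X' X'' : Mod (YonedaCat M)) (j : X' ⟶ X) (π : X ⟶ X'') (w : j ≫ π = 0)
      (_ : (ShortComplex.mk j π w).ShortExact) (T' : TrianglePresentation X')
      (T'' : TrianglePresentation X''),
      (T'.K.obj.IsLE 0 ∧ T'.E.obj.IsLE 0 ∧ T'.N.obj.IsLE 0) ∧
      (T''.K.obj.IsGE 1 ∧ T''.E.obj.IsGE 0 ∧ T''.N.obj.IsGE 0) ∧
      (T.K.obj.IsGE 0 → T.E.obj.IsGE 0 → T.N.obj.IsGE 0 →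
        T'.K.obj.IsGE 0 ∧ T'.E.obj.IsGE 0 ∧ T'.N.obj.IsGE 0) := by
  obtain ⟨K', K'', _, _, hK', hK'', fk, rk, gk, sk, hfrk, hsgk, hfgk, hsrk, hk⟩ :=
    exists_splitting T.K.property 0
  obtain ⟨E', E'', _, _, hE', hE'', fe, re, ge, se, hfre, hsge, hfge, hsre, he⟩ :=
    exists_splitting T.E.property 0
  obtain ⟨B', B, _, _, hB', hB, fn, rn, gn, sn, hfrn, hsgn, hfgn, hsrn, hn⟩ :=
    exists_splitting T.N'.property 0
  -- The truncated map to degrees ≤ 0; it is compatible with `T.f` because no nonzero map goes from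
  -- K' to the part of E in degrees ≥ 1.
  let f' : K' ⟶ E' := fk ≫ T.f ≫ re
  have hf' : f' ≫ fe = fk ≫ T.f := by
    have h₀ : fk ≫ T.f ≫ ge = 0 := TStructure.t.zero _ 0 (0 + 1)
    have := congrArg (fun φ => fk ≫ T.f ≫ φ) he
    simp only [Preadditive.comp_add, reassoc_of% h₀, zero_comp, add_zero, Category.comp_id] at this
    simpa [f'] using this
  obtain ⟨N', g', h', H'⟩ := distinguished_cocone_triangle f'
  have : N'.IsLE 0 := (isLE_iff _ _).2 fun k hk => by
    refine (HomologySequence.exact₃ _ H' k (k + 1) rfl).isZero_of_both_zeros ?_ ?_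
    · exact (isZero_of_isLE E' 0 k (by lia)).eq_of_src _ _
    · exact (isZero_of_isLE K' 0 (k + 1) (by lia)).eq_of_tgt _ _
  have hN' : yonedaProp M N' := yonedaProp_cone_of_truncation T.distinguished H' T.N.property hK' hE'
    hf' (fun n hn => isIso_homology_of_splitting hfrk hk hn)
    (fun n hn => isIso_homology_of_splitting hfre he hn)
  let K₁ : YonedaCat M := ⟨K', hK'⟩
  let E₁ : YonedaCat M := ⟨E', hE'⟩
  let K₂ : YonedaCat M := ⟨K'', hK''⟩
  let B₂ : YonedaCat M := ⟨B, hB⟩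
  let T' := TrianglePresentation.ofTriangle (K := K₁) (E := E₁) (N := ⟨N', hN'⟩) f' g' h' H'
  obtain ⟨j, hj⟩ := T'.exists_hom (rmap (A := K₁) fk ≫ T.p) fun Z a ha => by
    rw [← Category.assoc, ← rmap_comp (B := K₁), T.rmap_p_eq_zero_iff, Category.assoc, ← hf',
      ← Category.assoc, show a ≫ f' = 0 from ha, zero_comp]
  have hji : j ≫ T.i = T'.i ≫ rmap (A := E₁) fe := by
    rw [← cancel_epi T'.p, ← Category.assoc, hj, Category.assoc, T.fac, ← Category.assoc, T'.fac]
    exact (rmap_comp (A := K₁) fk T.f).symm.trans ((congrArg rmap hf'.symm).trans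
      (rmap_comp (A := K₁) (B := E₁) f' fe))
  have hfe : rmap (A := E₁) (B := T.E) fe ≫ rmap (B := E₁) re = 𝟙 _ :=
    (rmap_comp (A := E₁) (E := E₁) fe re).symm.trans
      ((congrArg rmap hfre).trans (representableMap_id E₁))
  have : Mono (rmap (A := E₁) (B := T.E) fe) := mono_of_mono_fac hfe
  have : Mono (j ≫ T.i) := hji ▸ mono_comp _ _
  have : Mono j := mono_of_mono j T.i
  have hS : (ShortComplex.mk j (cokernel.π j) (cokernel.condition j)).ShortExact :=
    { exact := ShortComplex.exact_cokernel j }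
  let p : representable K₂ ⟶ cokernel j := rmap (A := K₂) sk ≫ T.p ≫ cokernel.π j
  have hfk : rmap (A := K₁) fk ≫ T.p ≫ cokernel.π j = 0 := by
    rw [← Category.assoc, ← hj, Category.assoc, cokernel.condition, comp_zero]
  have hgp : rmap (B := K₂) gk ≫ p = T.p ≫ cokernel.π j := by
    have := congrArg (fun φ => rmap φ ≫ T.p ≫ cokernel.π j) hk
    rw [rmap_add, Preadditive.add_comp, rmap_comp (B := K₁), Category.assoc, hfk, comp_zero,
      zero_add, rmap_comp (B := K₂), Category.assoc] at this
    exact this.trans ((congrArg (· ≫ _) (representableMap_id T.K)).trans (Category.id_comp _))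
  have : Epi (rmap (B := K₂) gk ≫ p) := hgp ▸ epi_comp _ _
  have : Epi p := epi_of_epi (rmap (B := K₂) gk) p
  -- The quotient is presented by the parts in degrees ≥ 1 of N[-1] → K.
  let φ : B ⟶ K'' := sn ≫ T.d ≫ gk
  have hφ : gn ≫ φ = T.d ≫ gk := by
    have h₀ : fn ≫ T.d ≫ gk = 0 := TStructure.t.zero_of_isLE_of_isGE _ 0 (0 + 1) (by lia)
      inferInstance inferInstance
    have := congrArg (fun ψ => ψ ≫ T.d ≫ gk) hn
    dsimp only at this
    rw [Preadditive.add_comp, Category.assoc, h₀, comp_zero, zero_add, Category.assoc] at this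
    exact this.trans (Category.id_comp _)
  have hw : rmap (A := B₂) (B := K₂) φ ≫ p = 0 := by
    have h₁ : rmap (A := T.N') T.d ≫ T.p = 0 :=
      (T.rmap_p_eq_zero_iff (Z := T.N') _).2 (comp_mor₁_mor₂ T.d_distinguished)
    rw [show (rmap (A := B₂) (B := K₂) φ) = (rmap (A := B₂) (B := T.N') sn ≫ rmap T.d) ≫
      rmap (B := K₂) gk from (congrArg rmap (Category.assoc _ _ _).symm).trans
        ((rmap_comp (A := B₂) (B := T.K) (E := K₂) (sn ≫ T.d) gk).trans
          (congrArg (· ≫ _) (rmap_comp (A := B₂) (B := T.N') sn T.d))), Category.assoc, hgp,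
      Category.assoc]
    refine (congrArg (rmap (A := B₂) (B := T.N') sn ≫ ·) ((Category.assoc _ _ _).symm.trans
      ((congrArg (· ≫ _) h₁).trans zero_comp))).trans comp_zero
  have hp : (ShortComplex.mk _ _ hw).Exact := exact_of_representable _ fun Z x hx => by
    obtain ⟨a, rfl⟩ := exists_rmap (B := K₂) x
    have hx' : (rmap (B := T.K) (a ≫ sk) ≫ T.p) ≫ cokernel.π j = 0 := by
      rw [rmap_comp (B := K₂), Category.assoc, Category.assoc]
      exact hx
    obtain ⟨y, hy⟩ := exact_representable_lift hS.exact _ hx'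
    obtain ⟨b, rfl⟩ := T'.exists_lift y
    have hab : rmap (B := T.K) (a ≫ sk - b ≫ fk) ≫ T.p = 0 := by
      rw [rmap_sub, Preadditive.sub_comp, sub_eq_zero, ← hy]
      exact (Category.assoc _ _ _).trans ((congrArg (rmap b ≫ ·) hj).trans
        ((Category.assoc _ _ _).symm.trans (congrArg (· ≫ T.p)
          (rmap_comp (B := K₁) b fk).symm)))
    obtain ⟨c, hc⟩ := exists_lift_mor₁ T.d_distinguished _ ((T.rmap_p_eq_zero_iff _).1 hab)
    refine ⟨rmap (B := B₂) (c ≫ gn), ?_⟩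
    refine (rmap_comp (B := B₂) (E := K₂) (c ≫ gn) φ).symm.trans (congrArg rmap ?_)
    rw [Category.assoc, hφ, ← Category.assoc, ← hc, Preadditive.sub_comp, Category.assoc, hsgk,
      Category.assoc, hfgk, comp_zero, sub_zero]
    exact Category.comp_id _
  -- Ext¹ from the quotient to representables vanishes because every map from X' to a representable
  -- extends to X: it extends to the representable of E', which is a summand of that of E.
  obtain ⟨Z, c, δ, T'', H'', hK, hE, hN⟩ := exists_trianglePresentation hw hp fun W =>
    subsingleton_ext_one_right hS (T.subsingleton_ext_one W) fun u => by
      obtain ⟨v, hv⟩ := exists_extension_of_subsingleton_ext T'.shortExact_rotate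
        (T'.rotate.subsingleton_ext_one W) u
      refine ⟨T.i ≫ rmap (B := E₁) re ≫ v, ?_⟩
      refine (Category.assoc _ _ _).symm.trans ?_
      refine (congrArg (· ≫ _) hji).trans ?_
      refine ((Category.assoc _ _ _).trans (congrArg (T'.i ≫ ·) ((Category.assoc _ _ _).symm.trans
        ((congrArg (· ≫ v) hfe).trans (Category.id_comp v))))).trans hv
  have : K₂.obj.IsGE 1 := ‹K''.IsGE (0 + 1)›
  have : B₂.obj.IsGE 1 := ‹B.IsGE (0 + 1)›
  -- The cocone of B → K'' stays in degrees ≥ 1. The presentation is K'' → Z[1] → B[1], which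
  -- explains the bounds 1, 0, 0.
  have : Z.IsGE 1 := isGE_of_distinguished H'' (m := 1) (m' := 1) (by lia) (by lia)
  refine ⟨_, _, j, cokernel.π j, _, hS, T', T'', ⟨‹_›, ‹_›, ‹_›⟩, ⟨?_, ?_, ?_⟩, ?_⟩
  · rw [hK]
    infer_instance
  · rw [hE]
    exact TStructure.t.isGE_shift Z 1 1 0
  · rw [hN]
    exact TStructure.t.isGE_shift B₂.obj 1 1 0
  · intro _ _ _
    have : K'.IsGE 0 := isGE_of_retract ⟨fk, rk, hfrk⟩
    have : E'.IsGE 0 := isGE_of_retract ⟨fe, re, hfre⟩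
    refine ⟨‹_›, ‹_›, (isGE_iff _ _).2 fun k hk => ?_⟩
    -- If N has no negative homology, `T.f` is injective on homology in degrees ≤ 0. The truncated
    -- map inherits this, so N' has no negative homology either.
    have h₁ : Mono ((homologyFunctor M (k + 1)).map T.f) :=
      (HomologySequence.mono_homologyMap_mor₁_iff _ T.distinguished k (k + 1) rfl).2
        ((isZero_of_isGE T.N.obj 0 k hk).eq_of_src _ _)
    have h₂ : Mono ((homologyFunctor M (k + 1)).map fk) := by
      have : (homologyFunctor M (k + 1)).map fk ≫ (homologyFunctor M (k + 1)).map rk = 𝟙 _ := by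
        rw [← Functor.map_comp, hfrk, CategoryTheory.Functor.map_id]
      exact mono_of_mono_fac this
    have h₃ : Mono ((homologyFunctor M (k + 1)).map f') := by
      have : Mono ((homologyFunctor M (k + 1)).map fk ≫ (homologyFunctor M (k + 1)).map T.f) :=
        mono_comp' h₂ h₁
      exact mono_of_mono_fac (homologyFunctor_map_square (k + 1) hf')
    refine (HomologySequence.exact₃ _ H' k (k + 1) rfl).isZero_of_both_zeros ?_ ?_
    · exact (isZero_of_isGE E' 0 k hk).eq_of_src _ _
    · exact (HomologySequence.mono_homologyMap_mor₁_iff _ H' k (k + 1) rfl).1 h₃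

end Yoneda

/-! ### Shifts and triangles in the stable category -/

section Shift

variable {C : Type*} [Category* C] [Preadditive C] [HasShift C ℤ]
  [∀ n : ℤ, (shiftFunctor C n).Additive]

lemma forall_shift_eq_zero_iff {X Y : C} {i j a : ℤ} (h : j + a = i) :
    (∀ f : X⟦a⟧ ⟶ Y⟦i⟧, f = 0) ↔ ∀ f : X ⟶ Y⟦j⟧, f = 0 := by
  let e : Y⟦i⟧ ≅ Y⟦j⟧⟦a⟧ := (shiftFunctorAdd' C j a i h).app Y
  constructor
  · intro H f
    apply (shiftFunctor C a).map_injective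
    rw [Functor.map_zero, ← cancel_mono e.inv, zero_comp]
    exact H _
  · intro H f
    obtain ⟨g, hg⟩ := (shiftFunctor C a).map_surjective (f ≫ e.hom)
    rw [← cancel_mono e.hom, zero_comp, ← hg, H g, Functor.map_zero]

lemma isZero_of_isZero_shift {X : C} {a : ℤ} (h : IsZero (X⟦a⟧)) : IsZero X := by
  rw [IsZero.iff_id_eq_zero] at h ⊢
  apply (shiftFunctor C a).map_injective
  rw [CategoryTheory.Functor.map_id, h, Functor.map_zero]

end Shift

/-- A direct sum decomposition gives a distinguished triangle. -/
lemma distinguished_of_splitting {D : Type*} [Category* D] [Preadditive D] [HasZeroObject D]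
    [HasShift D ℤ] [∀ n : ℤ, (shiftFunctor D n).Additive] [Pretriangulated D] {A X B : D}
    {f : A ⟶ X} {r : X ⟶ A} {g : X ⟶ B} {s : B ⟶ X} (hfr : f ≫ r = 𝟙 A) (hsg : s ≫ g = 𝟙 B)
    (hfg : f ≫ g = 0) (hsr : s ≫ r = 0) (h : r ≫ f + g ≫ s = 𝟙 X) :
    Triangle.mk f g (0 : B ⟶ A⟦(1 : ℤ)⟧) ∈ distTriang D :=
  distinguished_of_iso (binaryBiproductTriangle_distinguished A B) _ _ _ (Iso.refl _)
    { hom := biprod.lift r g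
      inv := biprod.desc f s
      hom_inv_id := by rw [biprod.lift_desc, h]
      inv_hom_id := by ext <;> simp [hfr, hsg, hfg, hsr] } (Iso.refl _)
    (by ext <;> simp [hfr, hfg]) (by simp) (by simp)

section Happel

variable {A : Type u} [Category.{v} A] [Abelian A] {Q : ObjectProperty A} [Q.ContainsZero]
  [HasShift (Stable Q) ℤ] [∀ n : ℤ, (shiftFunctor (Stable Q) n).Additive]
  [Pretriangulated (Stable Q)] (hH : IsHappelTriangulation Q)

include hH in
lemma nonempty_suspension_iso {S : ShortComplex Q.FullSubcategory} (hS : IsProjConflation S) :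
    Nonempty (((toStable Q).obj S.X₁)⟦(1 : ℤ)⟧ ≅ (toStable Q).obj S.X₃) := by
  obtain ⟨σ, _⟩ := hH.exists_iso
  exact ⟨(σ S hS).symm⟩

include hH in
lemma exists_distinguished (hQ : IsFrobenius Q) {S : ShortComplex Q.FullSubcategory}
    (hS : IsConflation S) :
    ∃ h, Triangle.mk ((toStable Q).map S.f) ((toStable Q).map S.g) h ∈ distTriang (Stable Q) := by
  obtain ⟨σ, _, hσ⟩ := hH.exists_iso
  obtain ⟨S', hS', h⟩ := hH.exists_suspension S.X₁
  obtain ⟨φ, hφ⟩ := exists_hom_of_conflation hQ hS hS' (eqToHom h.symm)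
  have : IsIso φ.τ₁ := hφ ▸ inferInstance
  exact ⟨_, (hσ _).2 ⟨_, S', hS, hS', φ, this, ⟨Iso.refl _⟩⟩⟩

/-- A decomposition of an object with a projective summand gives an isomorphism in the stable
category. -/
lemma nonempty_iso_of_add {Q : ObjectProperty A} {X Y : Q.FullSubcategory} {P : A} [Projective P]
    {a : X.obj ⟶ Y.obj} {b : Y.obj ⟶ X.obj} {c : X.obj ⟶ P} {d : P ⟶ X.obj}
    (hba : b ≫ a = 𝟙 _) (h : a ≫ b + c ≫ d = 𝟙 _) :
    Nonempty ((toStable Q).obj X ≅ (toStable Q).obj Y) :=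
  ⟨{ hom := (toStable Q).map (ObjectProperty.homMk a)
     inv := (toStable Q).map (ObjectProperty.homMk b)
     hom_inv_id := by
      rw [← Functor.map_comp, ← CategoryTheory.Functor.map_id, toStable_map_eq_iff]
      refine ⟨P, inferInstance, -c, d, ?_⟩
      change _ = a ≫ b - 𝟙 X.obj
      rw [← h, Preadditive.neg_comp]
      abel
     inv_hom_id := by
      rw [← Functor.map_comp, ← CategoryTheory.Functor.map_id]
      exact congrArg _ (ObjectProperty.hom_ext _ hba) }⟩

end Happel

/-! ### Stable objects presented in prescribed degrees -/

section Yoneda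

open DerivedCategory

variable {M : Type u} [Category.{v} M] [Abelian M] [HasDerivedCategory.{w} M]

/-- The object of the stable category presented by a triangle. -/
abbrev TrianglePresentation.stable {Y : Mod (YonedaCat M)} (T : TrianglePresentation Y) :
    StableCM (YonedaCat M) := (toStable _).obj ⟨Y, T.cohenMacaulay⟩

variable (M) in
/-- The objects of the derived category in degrees `≤ n`. -/
abbrev degreesLE (n : ℤ) : ObjectProperty (DerivedCategory M) := fun K => K.IsLE n

variable (M) in
/-- The objects of the derived category in degrees `≥ n`. -/
abbrev degreesGE (n : ℤ) : ObjectProperty (DerivedCategory M) := fun K => K.IsGE n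

/-- The objects of the stable category presented by triangles whose terms satisfy given
properties. -/
def HasPresentation (P₁ P₂ P₃ : ObjectProperty (DerivedCategory M)) :
    ObjectProperty (StableCM (YonedaCat M)) := fun X =>
  ∃ (Y : Mod (YonedaCat M)) (T : TrianglePresentation Y), P₁ T.K.obj ∧ P₂ T.E.obj ∧ P₃ T.N.obj ∧
    Nonempty (X ≅ T.stable)

lemma TrianglePresentation.hasPresentation {Y : Mod (YonedaCat M)} (T : TrianglePresentation Y)
    {P₁ P₂ P₃ : ObjectProperty (DerivedCategory M)} (h₁ : P₁ T.K.obj) (h₂ : P₂ T.E.obj)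
    (h₃ : P₃ T.N.obj) : HasPresentation P₁ P₂ P₃ T.stable := ⟨Y, T, h₁, h₂, h₃, ⟨Iso.refl _⟩⟩

section

variable {P₁ P₂ P₃ P₁' P₂' P₃' : ObjectProperty (DerivedCategory M)}
  {X X' : StableCM (YonedaCat M)}

lemma HasPresentation.of_iso (h : HasPresentation P₁ P₂ P₃ X) (e : X ≅ X') :
    HasPresentation P₁ P₂ P₃ X' := by
  obtain ⟨Y, T, h₁, h₂, h₃, ⟨e'⟩⟩ := h
  exact ⟨Y, T, h₁, h₂, h₃, ⟨e.symm ≪≫ e'⟩⟩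

lemma HasPresentation.mono (h : HasPresentation P₁ P₂ P₃ X) (h₁ : P₁ ≤ P₁') (h₂ : P₂ ≤ P₂')
    (h₃ : P₃ ≤ P₃') : HasPresentation P₁' P₂' P₃' X := by
  obtain ⟨Y, T, h₁', h₂', h₃', e⟩ := h
  exact ⟨Y, T, h₁ _ h₁', h₂ _ h₂', h₃ _ h₃', e⟩

end

lemma degreesGE_antitone {m n : ℤ} (h : m ≤ n) : degreesGE M n ≤ degreesGE M m :=
  fun K (_ : K.IsGE n) => TStructure.t.isGE_of_ge K m n h

lemma degreesLE_monotone {m n : ℤ} (h : m ≤ n) : degreesLE M m ≤ degreesLE M n :=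
  fun K (_ : K.IsLE m) => TStructure.t.isLE_of_le K m n h

lemma degreesGE_shift {m n a : ℤ} (h : a + n = m) (K : DerivedCategory M) (_ : degreesGE M m K) :
    degreesGE M n (K⟦a⟧) := TStructure.t.isGE_shift K m a n h

lemma degreesLE_shift {m n a : ℤ} (h : a + n = m) (K : DerivedCategory M) (_ : degreesLE M m K) :
    degreesLE M n (K⟦a⟧) := TStructure.t.isLE_shift K m a n h

/-- Maps from objects presented in nonpositive degrees to objects presented in positive degrees
vanish. -/
lemma eq_zero_of_hasPresentation {X X' : StableCM (YonedaCat M)}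
    (h : HasPresentation (degreesLE M 0) ⊤ ⊤ X) (h' : HasPresentation (degreesGE M 1) ⊤ ⊤ X')
    (f : X ⟶ X') : f = 0 := by
  obtain ⟨Y, T, h₁, _, _, ⟨e⟩⟩ := h
  obtain ⟨Y', T', h₁', _, _, ⟨e'⟩⟩ := h'
  obtain ⟨φ, hφ⟩ := toStable_map_surjective (e.inv ≫ f ≫ e'.hom)
  -- The stable map is represented by a module map covered by a morphism between the first terms,
  -- which vanishes for degree reasons.
  obtain ⟨a, ha⟩ := T'.exists_lift (T.p ≫ φ.hom)
  have ha₀ : a = 0 := TStructure.t.zero_of_isLE_of_isGE a 0 1 one_pos h₁ h₁'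
  have hφ₀ : φ = 0 := by
    ext1
    rw [← cancel_epi T.p, ← ha, ha₀, rmap_zero, zero_comp]
    exact comp_zero.symm
  rw [hφ₀, Functor.map_zero] at hφ
  rw [← cancel_epi e.inv, ← cancel_mono e'.hom, Category.assoc, ← hφ]
  simp

variable [EnoughInjectives M]

/-- The object of the stable category given by `U₀(-, A)`. -/
abbrev stableDegreeZero (A : M) : StableCM (YonedaCat M) :=
  (toStable _).obj ⟨degreeZeroModule A, cohenMacaulay_degreeZeroModule A⟩

lemma hasPresentation_stableDegreeZero (A : M) :
    HasPresentation (degreesGE M 0) (degreesGE M 0) (degreesGE M 0) (stableDegreeZero A) := by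
  obtain ⟨T, J, B, hK, hE, hN⟩ := exists_presentation_degreeZeroModule A
  refine T.hasPresentation ?_ ?_ ?_
  · rw [hK]
    exact inferInstanceAs (((singleFunctor M 0).obj A).IsGE 0)
  · rw [hE]
    exact inferInstanceAs (((singleFunctor M 0).obj J).IsGE 0)
  · rw [hN]
    exact inferInstanceAs (((singleFunctor M 0).obj B).IsGE 0)

/-- Maps from the representable of K to U₀(-, A) are maps H⁰(K) → A, and H⁰(K) = 0 here. -/
lemma eq_zero_of_hasPresentation_degreesGE {X : StableCM (YonedaCat M)}
    (h : HasPresentation (degreesGE M 1) ⊤ ⊤ X) {A : M} (f : X ⟶ stableDegreeZero A) : f = 0 := by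
  obtain ⟨Y, T, h₁, _, _, ⟨e⟩⟩ := h
  obtain ⟨φ, hφ⟩ := toStable_map_surjective (e.inv ≫ f)
  have hφ₀ : φ = 0 := by
    ext1
    rw [← cancel_epi T.p]
    refine (eq_zero_of_isZero_homology ?_ (T.p ≫ φ.hom)).trans comp_zero.symm
    have : T.K.obj.IsGE 1 := h₁
    exact isZero_of_isGE _ 1 0 one_pos
  rw [hφ₀, Functor.map_zero] at hφ
  rw [← cancel_epi e.inv, ← hφ, comp_zero]

/-- A module presented by a triangle in nonnegative degrees without nonzero maps to modules
`U₀(-, A)` in the stable category is presented by a triangle whose first term is in positive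
degrees. -/
lemma TrianglePresentation.exists_isGE_one {Y : Mod (YonedaCat M)} (T : TrianglePresentation Y)
    [T.K.obj.IsGE 0] [T.N.obj.IsGE 0]
    (h : ∀ f : T.stable ⟶ stableDegreeZero ((homologyFunctor M 0).obj T.K.obj), f = 0) :
    ∃ (Y' : Mod (YonedaCat M)) (T' : TrianglePresentation Y'), T'.K.obj.IsGE 1 ∧
      Nonempty (Retract T'.K.obj T.K.obj) ∧ Nonempty (Retract T'.E.obj T.E.obj) ∧ T'.N = T.N ∧
      Nonempty (T.stable ≅ T'.stable) := by
  let W := (homologyFunctor M 0).obj T.K.obj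
  obtain ⟨ψ, hψ⟩ := isLiftable_of_yonedaProp T.K.property W (𝟙 _)
  have hmono : Mono ((homologyFunctor M 0).map T.f) :=
    (HomologySequence.mono_homologyMap_mor₁_iff _ T.distinguished (-1) 0 (by lia)).2
      ((isZero_of_isGE T.N.obj 0 (-1) (by lia)).eq_of_src _ _)
  let sW : YonedaCat M := ⟨(singleFunctor M 0).obj W, yonedaProp_single W⟩
  -- Because N has no negative homology, `T.f` is injective on H⁰, so the identity of H⁰(K) induces
  -- a well-defined map from Y to U₀(-, H⁰(K)).
  obtain ⟨q, hq⟩ := T.exists_hom (rmap (B := sW) ψ ≫ degreeZeroProj W) fun Z a ha => by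
    have h₁ : degreeZero (a ≫ ψ) = 0 := by
      rw [degreeZero_comp, hψ, ← cancel_mono ((homologyFunctor M 0).map T.f), Category.comp_id,
        ← Functor.map_comp, ha, Functor.map_zero, zero_comp]
    rw [← Category.assoc, ← rmap_comp (E := sW)]
    exact (rmap_degreeZeroProj_eq_zero_iff (a ≫ ψ)).2 h₁
  obtain ⟨P, hP, a, b, hab⟩ := (toStable_map_eq_iff (X := ⟨Y, T.cohenMacaulay⟩)
    (Y := ⟨degreeZeroModule W, cohenMacaulay_degreeZeroModule W⟩) (ObjectProperty.homMk q) 0).1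
    ((h _).trans (Functor.map_zero _ _ _).symm)
  -- By hypothesis `q` factors through a projective module, hence through the representable of
  -- H⁰(K). Extending along Y → U(-, E) gives `θ`, which splits `T.f` on H⁰.
  obtain ⟨v, hv⟩ := exists_extension_of_subsingleton_ext T.shortExact_rotate
    (T.rotate.subsingleton_ext_one sW) (a ≫ Projective.factorThru b (degreeZeroProj W))
  obtain ⟨θ, rfl⟩ := exists_rmap (B := sW) v
  have hq' : T.i ≫ rmap (B := sW) θ ≫ degreeZeroProj W = q := by
    refine (Category.assoc _ _ _).symm.trans ((congrArg (· ≫ _) hv).trans ?_)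
    rw [Category.assoc, Projective.factorThru_comp, hab]
    exact sub_zero q
  have hθ : (homologyFunctor M 0).map T.f ≫ degreeZero θ = 𝟙 _ := by
    rw [← degreeZero_comp, ← hψ, ← sub_eq_zero, ← degreeZero_sub]
    refine (rmap_degreeZeroProj_eq_zero_iff (T.f ≫ θ - ψ)).1 ?_
    rw [rmap_sub (B := sW), Preadditive.sub_comp, sub_eq_zero, hq.symm, ← hq',
      rmap_comp (B := T.E) (E := sW), ← T.fac, Category.assoc, Category.assoc]
  obtain ⟨K', K'', _, _, hK', hK'', σ, ρ, π, s, hσρ, hsπ, hσπ, hsρ, hK⟩ :=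
    exists_splitting T.K.property 0
  have : K'.IsGE 0 := isGE_of_retract ⟨σ, ρ, hσρ⟩
  have hσ : IsIso ((homologyFunctor M 0).map σ) := isIso_homology_of_splitting hσρ hK le_rfl
  let ε : K' ⟶ (singleFunctor M 0).obj W := σ ≫ T.f ≫ θ
  have hε : degreeZero ε = (homologyFunctor M 0).map σ := by
    rw [degreeZero_comp, degreeZero_comp, hθ]
    exact Category.comp_id _
  -- K' is the degree-zero part of K, so `ε` is a map between complexes in degree zero that is
  -- invertible on H⁰. Its inverse exhibits K' as a summand of E as well.
  have : IsIso ε := by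
    rw [isIso_iff]
    intro n
    rcases lt_trichotomy n 0 with hn | rfl | hn
    · exact ⟨0, (isZero_of_isGE K' 0 n hn).eq_of_src _ _,
        (isZero_of_isGE ((singleFunctor M 0).obj W) 0 n hn).eq_of_src _ _⟩
    · have : IsIso ((homologyFunctor M 0).map ε ≫
        (singleFunctorCompHomologyFunctorIso M 0).hom.app W) := by
        change IsIso (degreeZero ε)
        rwa [hε]
      exact IsIso.of_isIso_comp_right _ ((singleFunctorCompHomologyFunctorIso M 0).hom.app W)
    · exact ⟨0, (isZero_of_isLE K' 0 n hn).eq_of_src _ _,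
        (isZero_of_isLE ((singleFunctor M 0).obj W) 0 n hn).eq_of_src _ _⟩
  obtain ⟨Y', T', a, b, c, d, h₁, h₂, h₃, h₄, h₅⟩ := T.exists_split_off (A := ⟨K', hK'⟩) hK'' hsπ
    (distinguished_of_splitting hσρ hsπ hσπ hsρ hK) (θ := θ ≫ inv ε)
    (by
      refine Eq.trans ?_ (IsIso.hom_inv_id ε)
      simp only [ε, Category.assoc])
    fun r hZ => yonedaProp_of_retract r hZ
  refine ⟨Y', T', ?_, ⟨h₁ ▸ ⟨s, π, hsπ⟩⟩, h₂, h₃, nonempty_iso_of_add (X := ⟨Y, T.cohenMacaulay⟩)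
    (Y := ⟨Y', T'.cohenMacaulay⟩) h₄ h₅⟩
  rw [h₁]
  exact ‹K''.IsGE (0 + 1)›

end Yoneda

/-! ### Rotation of presentations, orthogonality and the t-structure -/

section Yoneda

open DerivedCategory

variable {M : Type u} [Category.{v} M] [Abelian M] [HasDerivedCategory.{w} M]

section Shift

variable [HasShift (StableCM (YonedaCat M)) ℤ]
  [∀ n : ℤ, (shiftFunctor (StableCM (YonedaCat M)) n).Additive]
  [Pretriangulated (StableCM (YonedaCat M))]
  (hH : IsHappelTriangulation (cohenMacaulay (YonedaCat M)))
  {P₁ P₂ P₃ P : ObjectProperty (DerivedCategory M)} {X : StableCM (YonedaCat M)}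

include hH

lemma nonempty_shift_iso {Y : Mod (YonedaCat M)}
    (T : TrianglePresentation Y) : Nonempty (T.stable⟦(1 : ℤ)⟧ ≅ T.rotate.stable) :=
  nonempty_suspension_iso hH (S :=
    { X₁ := ⟨Y, T.cohenMacaulay⟩
      X₂ := ⟨representable T.E, cohenMacaulay_representable _⟩
      X₃ := ⟨_, T.rotate.cohenMacaulay⟩
      f := ObjectProperty.homMk T.i
      g := ObjectProperty.homMk (cokernel.π T.i)
      zero := ObjectProperty.hom_ext _ (cokernel.condition T.i) })
    { isConflation := T.shortExact_rotate
      projective := inferInstanceAs (Projective (representable T.E)) }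

lemma nonempty_invShift_iso {Y : Mod (YonedaCat M)}
    (T : TrianglePresentation Y) : Nonempty (T.stable⟦(-1 : ℤ)⟧ ≅ T.invRotate.stable) := by
  obtain ⟨e⟩ := nonempty_suspension_iso hH (S :=
    { X₁ := ⟨_, T.invRotate.cohenMacaulay⟩
      X₂ := ⟨representable T.K, cohenMacaulay_representable _⟩
      X₃ := ⟨Y, T.cohenMacaulay⟩
      f := ObjectProperty.homMk (kernel.ι T.p)
      g := ObjectProperty.homMk T.p
      zero := ObjectProperty.hom_ext _ (kernel.condition T.p) })
    { isConflation := T.shortExact_invRotate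
      projective := inferInstanceAs (Projective (representable T.K)) }
  exact ⟨(shiftFunctor _ (-1 : ℤ)).mapIso e.symm ≪≫
    (shiftFunctorCompIsoId _ (1 : ℤ) (-1) (by simp)).app _⟩

lemma HasPresentation.shift (h : HasPresentation P₁ P₂ P₃ X) (hP : ∀ K, P₁ K → P (K⟦(1 : ℤ)⟧)) :
    HasPresentation P₂ P₃ P (X⟦(1 : ℤ)⟧) := by
  obtain ⟨Y, T, h₁, h₂, h₃, ⟨e⟩⟩ := h
  obtain ⟨e'⟩ := nonempty_shift_iso hH T
  exact ⟨_, T.rotate, h₂, h₃, hP _ h₁, ⟨(shiftFunctor _ (1 : ℤ)).mapIso e ≪≫ e'⟩⟩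

lemma HasPresentation.invShift (h : HasPresentation P₁ P₂ P₃ X)
    (hP : ∀ K, P₃ K → P (K⟦(-1 : ℤ)⟧)) : HasPresentation P P₁ P₂ (X⟦(-1 : ℤ)⟧) := by
  obtain ⟨Y, T, h₁, h₂, h₃, ⟨e⟩⟩ := h
  obtain ⟨e'⟩ := nonempty_invShift_iso hH T
  exact ⟨_, T.invRotate, hP _ h₃, h₁, h₂, ⟨(shiftFunctor _ (-1 : ℤ)).mapIso e ≪≫ e'⟩⟩

/-- The desuspension has terms N[-1], K, E, whose lower bounds 1, 1, 0 are at least as good as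
before. -/
lemma HasPresentation.degreesGE_invShift
    (h : HasPresentation (degreesGE M 1) (degreesGE M 0) (degreesGE M 0) X) (n : ℕ) :
    HasPresentation (degreesGE M 1) (degreesGE M 0) (degreesGE M 0) (X⟦-(n : ℤ)⟧) := by
  induction n with
  | zero => exact h.of_iso ((shiftFunctorZero' _ _ (by simp)).symm.app X)
  | succ n ih =>
    refine ((ih.invShift hH (degreesGE_shift (n := 1) (by lia))).mono le_rfl
      (degreesGE_antitone zero_le_one) le_rfl).of_iso ?_
    exact (shiftFunctorAdd' _ (-(n : ℤ)) (-1) (-((n + 1 : ℕ) : ℤ)) (by push_cast; ring)).symm.app X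

lemma HasPresentation.degreesGE_invShift_succ
    (h : HasPresentation (degreesGE M 0) (degreesGE M 0) (degreesGE M 0) X) (n : ℕ) :
    HasPresentation (degreesGE M 1) (degreesGE M 0) (degreesGE M 0) (X⟦-(n : ℤ) - 1⟧) :=
  ((h.invShift hH (degreesGE_shift (n := 1) (by lia))).degreesGE_invShift hH n).of_iso
    ((shiftFunctorAdd' _ (-1) (-(n : ℤ)) (-(n : ℤ) - 1) (by ring)).symm.app X)

/-- Three rotations return to the same triangle with every term shifted, so shifting a stable object
by 3 moves all degrees by one. -/
lemma HasPresentation.invShift_three {P' : ObjectProperty (DerivedCategory M)}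
    (h : HasPresentation P P P X) (hP : ∀ K, P K → P' (K⟦(-1 : ℤ)⟧)) :
    HasPresentation P' P' P' (X⟦(-3 : ℤ)⟧) :=
  (((h.invShift hH hP).invShift hH hP).invShift hH hP).of_iso ((shiftFunctor _ (-1 : ℤ)).mapIso
    ((shiftFunctorAdd' _ (-1) (-1) (-2) (by simp)).symm.app X) ≪≫
      (shiftFunctorAdd' _ (-2) (-1) (-3) (by simp)).symm.app X)

lemma HasPresentation.shift_three {P' : ObjectProperty (DerivedCategory M)}
    (h : HasPresentation P P P X) (hP : ∀ K, P K → P' (K⟦(1 : ℤ)⟧)) :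
    HasPresentation P' P' P' (X⟦(3 : ℤ)⟧) :=
  (((h.shift hH hP).shift hH hP).shift hH hP).of_iso ((shiftFunctor _ (1 : ℤ)).mapIso
    ((shiftFunctorAdd' _ 1 1 2 (by simp)).symm.app X) ≪≫
      (shiftFunctorAdd' _ 2 1 3 (by simp)).symm.app X)

lemma HasPresentation.exists_invShift (n b : ℕ)
    (h : HasPresentation (degreesGE M (-n) ⊓ degreesLE M b) (degreesGE M (-n) ⊓ degreesLE M b)
      (degreesGE M (-n) ⊓ degreesLE M b) X) :
    ∃ (m : ℤ) (b : ℕ), HasPresentation (degreesGE M 0 ⊓ degreesLE M b)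
      (degreesGE M 0 ⊓ degreesLE M b) (degreesGE M 0 ⊓ degreesLE M b) (X⟦m⟧) := by
  induction n generalizing X b with
  | zero => exact ⟨0, b, h.of_iso ((shiftFunctorZero _ _).symm.app X)⟩
  | succ n ih =>
    obtain ⟨m, b, hm⟩ := ih (b + 1) (h.invShift_three hH fun K hK =>
      ⟨degreesGE_shift (n := -(n : ℤ)) (by lia) K hK.1, degreesLE_shift (by lia) K hK.2⟩)
    exact ⟨_, b, hm.of_iso ((shiftFunctorAdd _ (-3) m).symm.app X)⟩

lemma HasPresentation.exists_shift (n : ℕ)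
    (h : HasPresentation (degreesLE M n) (degreesLE M n) (degreesLE M n) X) :
    ∃ m : ℤ, HasPresentation (degreesLE M 0) (degreesLE M 0) (degreesLE M 0) (X⟦m⟧) := by
  induction n generalizing X with
  | zero => exact ⟨0, h.of_iso ((shiftFunctorZero _ _).symm.app X)⟩
  | succ n ih =>
    obtain ⟨m, hm⟩ := ih (h.shift_three hH (degreesLE_shift (by lia)))
    exact ⟨_, hm.of_iso ((shiftFunctorAdd _ 3 m).symm.app X)⟩

end Shift

lemma exists_degrees {K : DerivedCategory M} (hK : yonedaProp M K) :
    ∃ n : ℕ, K.IsGE (-n) ∧ K.IsLE n := by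
  obtain ⟨a, b, h, h'⟩ := exists_bounds hK
  exact ⟨a.natAbs + b.natAbs, TStructure.t.isGE_of_ge K _ a (by lia),
    TStructure.t.isLE_of_le K b _ (by lia)⟩

variable [EnoughInjectives M]

lemma exists_hasPresentation (X : StableCM (YonedaCat M)) : ∃ n : ℕ,
    HasPresentation (degreesGE M (-n) ⊓ degreesLE M n) (degreesGE M (-n) ⊓ degreesLE M n)
      (degreesGE M (-n) ⊓ degreesLE M n) X := by
  obtain ⟨Y, rfl⟩ := toStable_obj_surjective X
  obtain ⟨T⟩ := nonempty_trianglePresentation Y.obj Y.property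
  obtain ⟨a, ha, ha'⟩ := exists_degrees T.K.property
  obtain ⟨b, hb, hb'⟩ := exists_degrees T.E.property
  obtain ⟨c, hc, hc'⟩ := exists_degrees T.N.property
  exact ⟨a + b + c, T.hasPresentation
    ⟨degreesGE_antitone (by lia) _ ha, degreesLE_monotone (by lia) _ ha'⟩
    ⟨degreesGE_antitone (by lia) _ hb, degreesLE_monotone (by lia) _ hb'⟩
    ⟨degreesGE_antitone (by lia) _ hc, degreesLE_monotone (by lia) _ hc'⟩⟩

omit [EnoughInjectives M] in
lemma isZero_of_degrees {K : DerivedCategory M} {m n : ℤ} (h : degreesGE M m K)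
    (h' : degreesLE M n K) (hmn : n < m) : IsZero K :=
  have : K.IsGE m := h
  have : K.IsLE n := h'
  TStructure.t.isZero K n m hmn

omit [EnoughInjectives M] in
lemma TrianglePresentation.isZero_stable {Y : Mod (YonedaCat M)} (T : TrianglePresentation Y)
    (h : IsZero T.K.obj) : IsZero T.stable := by
  refine (toStable _).map_isZero ?_
  rw [IsZero.iff_id_eq_zero]
  ext1
  have h₀ : 𝟙 (representable T.K) = 0 :=
    (representableMap_id T.K).symm.trans ((congrArg rmap (h.eq_of_src _ _)).trans rmap_zero)
  rw [← cancel_epi T.p, ← Category.id_comp T.p, h₀, zero_comp, zero_comp, zero_comp]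

variable [HasShift (StableCM (YonedaCat M)) ℤ]
  [∀ n : ℤ, (shiftFunctor (StableCM (YonedaCat M)) n).Additive]

/-- The objects of the stable category without nonzero maps to the `i`-th suspensions of the modules
`U₀(-, A)`. -/
def orthogonalDegree (i : ℤ) : ObjectProperty (StableCM (YonedaCat M)) := fun X =>
  ∀ (A : M) (f : X ⟶ (stableDegreeZero A)⟦i⟧), f = 0

instance (i : ℤ) : (orthogonalDegree (M := M) i).IsClosedUnderIsomorphisms where
  of_iso e h A f := by
    rw [← cancel_epi e.hom, h A (e.hom ≫ f), comp_zero]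

lemma orthogonalDegree_shift_iff {X : StableCM (YonedaCat M)} {i j a : ℤ} (h : j + a = i) :
    orthogonalDegree i (X⟦a⟧) ↔ orthogonalDegree j X :=
  forall_congr' fun _ => forall_shift_eq_zero_iff h

omit [∀ n : ℤ, (shiftFunctor (StableCM (YonedaCat M)) n).Additive] in
lemma orthogonalDegree_zero_iff {X : StableCM (YonedaCat M)} :
    orthogonalDegree 0 X ↔ ∀ (A : M) (f : X ⟶ stableDegreeZero A), f = 0 := by
  refine forall_congr' fun A => ⟨fun h f => ?_, fun h f => ?_⟩
  · rw [← cancel_mono ((shiftFunctorZero _ ℤ).inv.app _), h (f ≫ _)]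
    exact zero_comp.symm
  · rw [← cancel_mono ((shiftFunctorZero _ ℤ).hom.app _), h (f ≫ _)]
    exact zero_comp.symm

variable [Pretriangulated (StableCM (YonedaCat M))]

lemma orthogonalDegree_of_distinguished {X Y Z : StableCM (YonedaCat M)} {f : X ⟶ Y} {g : Y ⟶ Z}
    {h : Z ⟶ X⟦(1 : ℤ)⟧} (H : Triangle.mk f g h ∈ distTriang _) {i : ℤ}
    (hX : orthogonalDegree i X) (hZ : orthogonalDegree i Z) : orthogonalDegree i Y := fun A φ => by
  obtain ⟨ψ, rfl⟩ := exists_desc_mor₂ H φ (hX A _)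
  rw [hZ A ψ, comp_zero]

variable (hH : IsHappelTriangulation (cohenMacaulay (YonedaCat M)))

include hH

/-- U₀(-, A) is presented in degrees ≥ 0, so its negative shifts are presented with first term in
degrees ≥ 1, and maps from degrees ≤ 0 vanish. -/
lemma orthogonalDegree_of_neg {X : StableCM (YonedaCat M)}
    (h : HasPresentation (degreesLE M 0) ⊤ ⊤ X) {i : ℤ} (hi : i < 0) : orthogonalDegree i X :=
  fun A f => by
    obtain ⟨n, rfl⟩ : ∃ n : ℕ, i = -(n : ℤ) - 1 := ⟨(-i - 1).toNat, by lia⟩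
    exact eq_zero_of_hasPresentation h
      (((hasPresentation_stableDegreeZero A).degreesGE_invShift_succ hH n).mono le_rfl le_top le_top)
      f

/-- Move the shift to the source: X[-i] has a presentation with the same bounds, so its first term
has no H⁰ and U₀(-, A) receives nothing from it. -/
lemma orthogonalDegree_of_nonneg {X : StableCM (YonedaCat M)}
    (h : HasPresentation (degreesGE M 1) (degreesGE M 0) (degreesGE M 0) X) {i : ℤ} (hi : 0 ≤ i) :
    orthogonalDegree i X := by
  obtain ⟨n, rfl⟩ := Int.eq_ofNat_of_zero_le hi
  rw [← orthogonalDegree_shift_iff (add_neg_cancel (n : ℤ)), orthogonalDegree_zero_iff]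
  intro A f
  exact eq_zero_of_hasPresentation_degreesGE ((h.degreesGE_invShift hH n).mono le_rfl le_top le_top)
    f

/-- Induction on the total width p + q + r, where the three terms live in degrees 0 to p - 1, q - 1
and r - 1. Orthogonality in degree zero lets the degree-zero part of K be split off. Then X[1] is
presented by E, N, K[1], and K[1] fits into one degree fewer. If K = 0, then X = 0. -/
lemma isZero_of_bounded_presentation (n : ℕ) {X : StableCM (YonedaCat M)} {p q r : ℕ}
    (hn : p + q + r = n)
    (hX : HasPresentation (degreesGE M 0 ⊓ degreesLE M (p - 1)) (degreesGE M 0 ⊓ degreesLE M (q - 1))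
      (degreesGE M 0 ⊓ degreesLE M (r - 1)) X)
    (h : ∀ i ≤ 0, orthogonalDegree i X) : IsZero X := by
  induction n generalizing p q r X with
  | zero =>
    obtain rfl : p = 0 := by lia
    obtain ⟨Y, T, ⟨h₁, h₂⟩, _, _, ⟨e⟩⟩ := hX
    exact (T.isZero_stable (isZero_of_degrees h₁ h₂ (by lia))).of_iso e
  | succ n ih =>
    obtain ⟨Y, T, ⟨h₁, h₂⟩, ⟨h₃, h₄⟩, ⟨h₅, h₆⟩, ⟨e⟩⟩ := hX
    rcases p with _ | p
    · exact (T.isZero_stable (isZero_of_degrees h₁ h₂ (by lia))).of_iso e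
    · have : T.K.obj.IsGE 0 := h₁
      have : T.N.obj.IsGE 0 := h₅
      obtain ⟨Y', T', h₁', ⟨rK⟩, ⟨rE⟩, hN, ⟨e'⟩⟩ := T.exists_isGE_one
        (orthogonalDegree_zero_iff.1 ((orthogonalDegree 0).prop_of_iso e (h 0 le_rfl)) _)
      refine isZero_of_isZero_shift (a := 1) (ih (p := q) (q := r) (r := p) (by lia) (X := X⟦(1 : ℤ)⟧)
        ?_ fun i hi => ?_)
      · have : T.E.obj.IsGE 0 := h₃
        have : T.E.obj.IsLE (q - 1) := h₄
        have : T.K.obj.IsLE ((p + 1 : ℕ) - 1) := h₂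
        have : T'.K.obj.IsLE ((p + 1 : ℕ) - 1) := isLE_of_retract rK
        refine HasPresentation.shift hH (P₁ := degreesGE M 1 ⊓ degreesLE M ((p + 1 : ℕ) - 1))
          ⟨_, T', ⟨h₁', this⟩, ⟨isGE_of_retract rE, isLE_of_retract rE⟩, ?_, ⟨e ≪≫ e'⟩⟩ ?_
        · rw [hN]
          exact ⟨h₅, h₆⟩
        · exact fun K hK => ⟨degreesGE_shift (by lia) K hK.1, degreesLE_shift (by lia) K hK.2⟩
      · exact (orthogonalDegree_shift_iff (sub_add_cancel i 1)).2 (h (i - 1) (by lia))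

lemma isZero_of_orthogonalDegree {X : StableCM (YonedaCat M)}
    (h : ∀ i, orthogonalDegree i X) : IsZero X := by
  obtain ⟨n, hn⟩ := exists_hasPresentation X
  -- Shifting moves all terms into nonnegative degrees; orthogonality in every degree is unaffected.
  obtain ⟨m, b, hb⟩ := hn.exists_invShift hH
  have hP : degreesGE M 0 ⊓ degreesLE M b ≤ degreesGE M 0 ⊓ degreesLE M ((b + 1 : ℕ) - 1) :=
    inf_le_inf le_rfl (degreesLE_monotone (by lia))
  exact isZero_of_isZero_shift (isZero_of_bounded_presentation hH _ rfl (hb.mono hP hP hP)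
    fun i _ => (orthogonalDegree_shift_iff (sub_add_cancel i m)).2 (h _))

lemma exists_truncation_triangle {Y : Mod (YonedaCat M)} (T : TrianglePresentation Y) :
    ∃ (X' X'' : StableCM (YonedaCat M)) (f : X' ⟶ T.stable) (g : T.stable ⟶ X'')
      (h : X'' ⟶ X'⟦(1 : ℤ)⟧) (_ : Triangle.mk f g h ∈ distTriang _),
      HasPresentation (degreesLE M 0) (degreesLE M 0) (degreesLE M 0) X' ∧
      HasPresentation (degreesGE M 1) (degreesGE M 0) (degreesGE M 0) X'' ∧
      (degreesGE M 0 T.K.obj → degreesGE M 0 T.E.obj → degreesGE M 0 T.N.obj →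
        HasPresentation (degreesGE M 0 ⊓ degreesLE M 0) (degreesGE M 0 ⊓ degreesLE M 0)
          (degreesGE M 0 ⊓ degreesLE M 0) X') := by
  obtain ⟨X', X'', j, π, w, hS, T', T'', ⟨h₁, h₂, h₃⟩, ⟨h₁', h₂', h₃'⟩, h⟩ := T.exists_truncation
  obtain ⟨δ, H⟩ := exists_distinguished hH (isFrobenius_yoneda M) (S :=
    { X₁ := ⟨X', T'.cohenMacaulay⟩
      X₂ := ⟨Y, T.cohenMacaulay⟩
      X₃ := ⟨X'', T''.cohenMacaulay⟩
      f := ObjectProperty.homMk j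
      g := ObjectProperty.homMk π
      zero := ObjectProperty.hom_ext _ w }) hS
  exact ⟨_, _, _, _, δ, H, T'.hasPresentation h₁ h₂ h₃, T''.hasPresentation h₁' h₂' h₃',
    fun a b c => T'.hasPresentation ⟨(h a b c).1, h₁⟩ ⟨(h a b c).2.1, h₂⟩ ⟨(h a b c).2.2, h₃⟩⟩

/-- In the truncation triangle X'' is orthogonal in all degrees: in degrees ≥ 0 by its own
presentation, in negative degrees because X and X'[1] are. So X'' = 0 and X is its own truncation.
-/
lemma hasPresentation_of_orthogonalDegree_neg {Y : Mod (YonedaCat M)} (T : TrianglePresentation Y)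
    (hT : ∀ i < 0, orthogonalDegree i T.stable) :
    HasPresentation (degreesLE M 0) (degreesLE M 0) (degreesLE M 0) T.stable ∧
      (degreesGE M 0 T.K.obj → degreesGE M 0 T.E.obj → degreesGE M 0 T.N.obj →
        HasPresentation (degreesGE M 0 ⊓ degreesLE M 0) (degreesGE M 0 ⊓ degreesLE M 0)
          (degreesGE M 0 ⊓ degreesLE M 0) T.stable) := by
  obtain ⟨X', X'', f, g, h, H, h₁, h₂, h₃⟩ := exists_truncation_triangle hH T
  have hX'' : IsZero X'' := isZero_of_orthogonalDegree hH fun i => by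
    rcases le_or_gt 0 i with hi | hi
    · exact orthogonalDegree_of_nonneg hH h₂ hi
    · exact orthogonalDegree_of_distinguished (rot_of_distTriang _ H) (hT i hi)
        ((orthogonalDegree_shift_iff (sub_add_cancel i 1)).2
          (orthogonalDegree_of_neg hH (h₁.mono le_rfl le_top le_top) (by lia)))
  have : IsIso f := (Triangle.isZero₃_iff_isIso₁ _ H).1 hX''
  exact ⟨h₁.of_iso (asIso f), fun a b c => (h₃ a b c).of_iso (asIso f)⟩

/-- Dually, X' is orthogonal in negative degrees by its presentation, and in degrees ≥ 0 because X
and X''[-1] are; so X' = 0. -/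
lemma hasPresentation_of_orthogonalDegree_nonneg {X : StableCM (YonedaCat M)}
    (hX : ∀ i, 0 ≤ i → orthogonalDegree i X) :
    HasPresentation (degreesGE M 1) (degreesGE M 0) (degreesGE M 0) X := by
  obtain ⟨n, Y, T, -, -, -, ⟨e⟩⟩ := exists_hasPresentation X
  obtain ⟨X', X'', f, g, h, H, h₁, h₂, h₃⟩ := exists_truncation_triangle hH T
  have hX' : IsZero X' := isZero_of_orthogonalDegree hH fun i => by
    rcases le_or_gt 0 i with hi | hi
    · exact orthogonalDegree_of_distinguished (inv_rot_of_distTriang _ H)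
        ((orthogonalDegree_shift_iff (j := i + 1) (by lia)).2
          (orthogonalDegree_of_nonneg hH h₂ (by lia)))
        ((orthogonalDegree i).prop_of_iso e (hX i hi))
    · exact orthogonalDegree_of_neg hH (h₁.mono le_rfl le_top le_top) hi
  have : IsIso g := (Triangle.isZero₁_iff_isIso₂ _ H).1 hX'
  exact h₂.of_iso (e ≪≫ asIso g).symm

/-- The t-structure on the stable category. -/
abbrev tStructure : Triangulated.TStructure (StableCM (YonedaCat M)) where
  -- The bound is `-n` because X lies in the n-th aisle exactly when X[n] lies in the zeroth.
  le n X := ∀ (A : M) (i : ℤ), i < -n → ∀ f : X ⟶ (stableDegreeZero A)⟦i⟧, f = 0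
  ge n X := ∀ (A : M) (i : ℤ), -n < i → ∀ f : X ⟶ (stableDegreeZero A)⟦i⟧, f = 0
  le_isClosedUnderIsomorphisms n :=
    { of_iso e h A i hi := (orthogonalDegree i).prop_of_iso e (fun A => h A i hi) A }
  ge_isClosedUnderIsomorphisms n :=
    { of_iso e h A i hi := (orthogonalDegree i).prop_of_iso e (fun A => h A i hi) A }
  le_shift n a n' h X hX A i hi :=
    (forall_shift_eq_zero_iff (sub_add_cancel i a)).2 (hX A (i - a) (by lia))
  ge_shift n a n' h X hX A i hi :=
    (forall_shift_eq_zero_iff (sub_add_cancel i a)).2 (hX A (i - a) (by lia))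
  zero' X Y f hX hY := by
    obtain ⟨n, Y, T, -, -, -, ⟨e⟩⟩ := exists_hasPresentation X
    have hX' := (hasPresentation_of_orthogonalDegree_neg hH T fun i hi =>
      (orthogonalDegree i).prop_of_iso e fun A => hX A i (by lia)).1
    have hY' := hasPresentation_of_orthogonalDegree_nonneg hH fun i hi A => hY A i (by lia)
    rw [← cancel_epi e.inv, comp_zero]
    exact eq_zero_of_hasPresentation (hX'.mono le_rfl le_top le_top) (hY'.mono le_rfl le_top le_top)
      _
  le_zero_le X hX A i hi := hX A i (by lia)
  ge_one_le X hX A i hi := hX A i (by lia)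
  exists_triangle_zero_one X := by
    obtain ⟨n, Y, T, -, -, -, ⟨e⟩⟩ := exists_hasPresentation X
    obtain ⟨X', X'', f, g, h, H, h₁, h₂, h₃⟩ := exists_truncation_triangle hH T
    refine ⟨X', X'', fun A i hi => ?_, fun A i hi => ?_, f ≫ e.inv, e.hom ≫ g, h,
      distinguished_of_iso H _ _ _ (Iso.refl _) e (Iso.refl _) (by simp) (by simp) (by simp)⟩
    · exact orthogonalDegree_of_neg hH (h₁.mono le_rfl le_top le_top) (by lia) A
    · exact orthogonalDegree_of_nonneg hH h₂ (by lia) A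

lemma tStructure_bounded (X : StableCM (YonedaCat M)) : (tStructure hH).bounded X := by
  obtain ⟨n, hX⟩ := exists_hasPresentation X
  constructor
  · obtain ⟨m, b, h⟩ := hX.exists_invShift hH
    have h' := (h.mono inf_le_left inf_le_left inf_le_left).degreesGE_invShift_succ hH 0
    -- X[m] is presented in degrees ≥ 0, so X[m - 1] is orthogonal in degrees ≥ 0; this makes X
    -- orthogonal in all degrees i > -m.
    refine ⟨m, ⟨fun A i hi => ?_⟩⟩
    have := orthogonalDegree_of_nonneg hH h' (i := i + m - 1) (by lia) A
    rw [forall_shift_eq_zero_iff (j := i + m) (by simp; ring),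
      forall_shift_eq_zero_iff (j := i) (by lia)] at this
    exact this
  · obtain ⟨m, h⟩ := (hX.mono inf_le_right inf_le_right inf_le_right).exists_shift hH
    refine ⟨m, ⟨fun A i hi => ?_⟩⟩
    have := orthogonalDegree_of_neg hH (h.mono le_rfl le_top le_top) (i := i + m) (by lia) A
    rw [forall_shift_eq_zero_iff (j := i) (by lia)] at this
    exact this

/-- The condition on positive shifts gives X[-1] a presentation with bounds 1, 0, 0. Suspending puts
all terms of a presentation of X in degrees ≥ 0, and truncating that presentation leaves only degree
zero. -/
lemma hasPresentation_of_heart {X : StableCM (YonedaCat M)} (hX : (tStructure hH).heart X) :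
    HasPresentation (degreesGE M 0 ⊓ degreesLE M 0) (degreesGE M 0 ⊓ degreesLE M 0)
      (degreesGE M 0 ⊓ degreesLE M 0) X := by
  have h := (hasPresentation_of_orthogonalDegree_nonneg hH (X := X⟦(-1 : ℤ)⟧) fun i hi =>
    (orthogonalDegree_shift_iff (add_neg_cancel_right i 1)).2 fun A =>
      hX.2 A (i + 1) (by lia)).shift hH (degreesGE_shift (n := 0) (by lia))
  obtain ⟨Y, T, h₁, h₂, h₃, ⟨e⟩⟩ := h
  let e' : X ≅ T.stable := (shiftFunctorCompIsoId _ (-1 : ℤ) 1 (by simp)).symm.app X ≪≫ e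
  exact ((hasPresentation_of_orthogonalDegree_neg hH T fun i hi =>
    (orthogonalDegree i).prop_of_iso e' fun A => hX.1 A i (by lia)).2 h₁ h₂ h₃).of_iso e'.symm

lemma heart_of_hasPresentation {X : StableCM (YonedaCat M)}
    (hX : HasPresentation (degreesGE M 0 ⊓ degreesLE M 0) (degreesGE M 0 ⊓ degreesLE M 0)
      (degreesGE M 0 ⊓ degreesLE M 0) X) : (tStructure hH).heart X := by
  constructor
  · exact fun A i hi =>
      orthogonalDegree_of_neg hH (hX.mono inf_le_right le_top le_top) (by lia) A
  · intro A i hi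
    have h := (hX.mono inf_le_left inf_le_left inf_le_left).degreesGE_invShift_succ hH 0
    have := orthogonalDegree_of_nonneg hH h (i := i - 1) (by lia) A
    rw [forall_shift_eq_zero_iff (j := i) (by simp; ring)] at this
    exact this

end Yoneda

/-! ### Epimorphisms of `M` as common presentations of both sides of the equivalence -/

section Heart

open DerivedCategory

variable {M : Type u} [Category.{v} M] [Abelian M] [HasDerivedCategory.{w} M]
  {S : Type u} [Category.{v} S] [Preadditive S]

/-- An object of the Yoneda category in degree zero. -/
abbrev yonedaSingle (A : M) : YonedaCat M := ⟨(singleFunctor M 0).obj A, yonedaProp_single A⟩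

/-- The map of representable modules given by a morphism in degree zero. -/
abbrev singleMap {A B : M} (f : A ⟶ B) :
    representable (yonedaSingle A) ⟶ representable (yonedaSingle B) :=
  rmap (A := yonedaSingle A) (B := yonedaSingle B) ((singleFunctor M 0).map f)

lemma singleMap_comp {A B C : M} (f : A ⟶ B) (g : B ⟶ C) :
    singleMap (f ≫ g) = singleMap f ≫ singleMap g :=
  (congrArg rmap ((singleFunctor M 0).map_comp f g)).trans
    (rmap_comp (A := yonedaSingle A) (B := yonedaSingle B) (E := yonedaSingle C) _ _)

lemma singleMap_sub {A B : M} (f g : A ⟶ B) : singleMap (f - g) = singleMap f - singleMap g :=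
  (congrArg rmap (singleFunctor M 0).map_sub).trans
    (rmap_sub (A := yonedaSingle A) (B := yonedaSingle B) _ _)

lemma exists_singleMap {A B : M}
    (f : representable (yonedaSingle A) ⟶ representable (yonedaSingle B)) :
    ∃ g : A ⟶ B, singleMap g = f := by
  obtain ⟨g, rfl⟩ := exists_rmap f
  obtain ⟨g, rfl⟩ := (singleFunctor M 0).map_surjective (X := A) (Y := B) g
  exact ⟨g, rfl⟩

/-- A pair consisting of a module over the Yoneda category and a module over `S` which are
presented by the same epimorphism of `M`. -/
structure Bridge (π : M ⥤ S) where
  /-- the source of the epimorphism -/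
  E : M
  /-- the target of the epimorphism -/
  N : M
  /-- the epimorphism -/
  g : E ⟶ N
  epi_g : Epi g
  /-- the module over the Yoneda category -/
  Y : Mod (YonedaCat M)
  /-- the projection from a representable module -/
  p : representable (yonedaSingle N) ⟶ Y
  epi_p : Epi p
  p_eq_zero_iff : ∀ (Z : YonedaCat M) (a : Z.obj ⟶ (singleFunctor M 0).obj N),
    rmap (B := yonedaSingle N) a ≫ p = 0 ↔ ∃ b, b ≫ (singleFunctor M 0).map g = a
  /-- the module over `S` -/
  F : Mod S
  /-- the projection from a representable module -/
  q : representable (π.obj N) ⟶ F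
  epi_q : Epi q
  q_eq_zero_iff : ∀ (B : M) (a : B ⟶ N), representableMap (π.map a) ≫ q = 0 ↔ ∃ b, b ≫ g = a

namespace Bridge

variable {π : M ⥤ S}

attribute [instance] epi_g epi_p epi_q

section

variable (X : Bridge π)

lemma singleMap_p_eq_zero_iff {B : M} (a : B ⟶ X.N) :
    singleMap a ≫ X.p = 0 ↔ ∃ b, b ≫ X.g = a := by
  rw [X.p_eq_zero_iff]
  constructor
  · rintro ⟨b, hb⟩
    obtain ⟨b, rfl⟩ := (singleFunctor M 0).map_surjective b
    exact ⟨b, (singleFunctor M 0).map_injective (((singleFunctor M 0).map_comp _ _).trans hb)⟩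
  · rintro ⟨b, rfl⟩
    exact ⟨_, ((singleFunctor M 0).map_comp _ _).symm⟩

lemma singleMap_g_p : singleMap X.g ≫ X.p = 0 :=
  (X.singleMap_p_eq_zero_iff X.g).2 ⟨𝟙 _, Category.id_comp _⟩

lemma map_g_q : representableMap (π.map X.g) ≫ X.q = 0 :=
  (X.q_eq_zero_iff _ X.g).2 ⟨𝟙 _, Category.id_comp _⟩

lemma exists_lift_p {B : M} (x : representable (yonedaSingle B) ⟶ X.Y) :
    ∃ a : B ⟶ X.N, singleMap a ≫ X.p = x := by
  obtain ⟨y, rfl⟩ := exists_representable_lift X.p x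
  obtain ⟨a, rfl⟩ := exists_singleMap y
  exact ⟨a, rfl⟩

lemma exists_lift_q [π.Full] {B : M} (x : representable (π.obj B) ⟶ X.F) :
    ∃ a : B ⟶ X.N, representableMap (π.map a) ≫ X.q = x := by
  obtain ⟨y, rfl⟩ := exists_representable_lift X.q x
  obtain ⟨a, rfl⟩ := exists_representableMap y
  obtain ⟨a, rfl⟩ := π.map_surjective a
  exact ⟨a, rfl⟩

end

variable {X X' : Bridge π} (hS : Function.Surjective π.obj)

/-- Morphisms of the two modules of a bridge correspond if they come from the same morphism. -/
def Corresponds (φ : X.Y ⟶ X'.Y) (ψ : X.F ⟶ X'.F) : Prop :=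
  ∃ a : X.N ⟶ X'.N, X.p ≫ φ = singleMap a ≫ X'.p ∧
    X.q ≫ ψ = representableMap (π.map a) ≫ X'.q

lemma corresponds_id (X : Bridge π) : Corresponds (𝟙 X.Y) (𝟙 X.F) := by
  refine ⟨𝟙 _, ?_, ?_⟩
  · rw [Category.comp_id]
    exact ((congrArg (· ≫ X.p) ((congrArg rmap ((singleFunctor M 0).map_id _)).trans
      (representableMap_id (yonedaSingle X.N)))).trans (Category.id_comp _)).symm
  · rw [Category.comp_id, π.map_id, representableMap_id, Category.id_comp]

lemma Corresponds.comp {X'' : Bridge π} {φ : X.Y ⟶ X'.Y} {ψ : X.F ⟶ X'.F} {φ' : X'.Y ⟶ X''.Y}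
    {ψ' : X'.F ⟶ X''.F} (h : Corresponds φ ψ) (h' : Corresponds φ' ψ') :
    Corresponds (φ ≫ φ') (ψ ≫ ψ') := by
  obtain ⟨a, ha, hb⟩ := h
  obtain ⟨a', ha', hb'⟩ := h'
  refine ⟨a ≫ a', ?_, ?_⟩
  · rw [← Category.assoc, ha, Category.assoc, ha', ← Category.assoc, singleMap_comp]
  · rw [← Category.assoc, hb, Category.assoc, hb', ← Category.assoc, π.map_comp,
      representableMap_comp]

/-- Both equalities say that the difference of the two maps N → N' factors through the epimorphism
of X'. -/
lemma corresponds_eq_iff [π.Additive] {φ φ' : X.Y ⟶ X'.Y} {ψ ψ' : X.F ⟶ X'.F}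
    (h : Corresponds φ ψ) (h' : Corresponds φ' ψ') : φ = φ' ↔ ψ = ψ' := by
  obtain ⟨a, ha, hb⟩ := h
  obtain ⟨a', ha', hb'⟩ := h'
  rw [← cancel_epi X.p, ha, ha', ← cancel_epi X.q, hb, hb', ← sub_eq_zero,
    ← Preadditive.sub_comp, ← singleMap_sub, singleMap_p_eq_zero_iff,
    ← sub_eq_zero (a := representableMap (π.map a) ≫ X'.q), ← Preadditive.sub_comp,
    ← representableMap_sub, ← π.map_sub, q_eq_zero_iff]

include hS in
-- A map N → N' descends to the modules on either side exactly when its composite with `X.g` factors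
-- through `X'.g`, so descent on one side gives descent on the other.
lemma exists_corresponds_left (φ : X.Y ⟶ X'.Y) [π.Full] : ∃ ψ : X.F ⟶ X'.F, Corresponds φ ψ := by
  obtain ⟨a, ha⟩ := X'.exists_lift_p (X.p ≫ φ)
  have hga : representableMap (π.map (X.g ≫ a)) ≫ X'.q = 0 := by
    rw [q_eq_zero_iff, ← singleMap_p_eq_zero_iff, singleMap_comp, Category.assoc, ha,
      ← Category.assoc, singleMap_g_p, zero_comp]
  have h : kernel.ι X.q ≫ representableMap (π.map a) ≫ X'.q = 0 := mod_hom_ext fun Z x => by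
    obtain ⟨Z, rfl⟩ := hS Z
    obtain ⟨c, hc⟩ := exists_representableMap (x ≫ kernel.ι X.q)
    obtain ⟨c, rfl⟩ := π.map_surjective c
    obtain ⟨b, rfl⟩ := (X.q_eq_zero_iff _ c).1 (by rw [hc]; simp)
    rw [comp_zero, ← Category.assoc, ← hc, π.map_comp, representableMap_comp, Category.assoc,
      ← Category.assoc (representableMap (π.map X.g)), ← representableMap_comp, ← π.map_comp, hga,
      comp_zero]
  have hq : (ShortComplex.mk _ _ (kernel.condition X.q)).Exact := ShortComplex.exact_kernel X.q
  exact ⟨hq.desc _ h, a, ha.symm, hq.g_desc _ h⟩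

lemma exists_corresponds_right (ψ : X.F ⟶ X'.F) [π.Full] : ∃ φ : X.Y ⟶ X'.Y, Corresponds φ ψ := by
  obtain ⟨a, ha⟩ := X'.exists_lift_q (X.q ≫ ψ)
  have hga : singleMap (X.g ≫ a) ≫ X'.p = 0 := by
    rw [singleMap_p_eq_zero_iff, ← q_eq_zero_iff, π.map_comp, representableMap_comp,
      Category.assoc, ha, ← Category.assoc, map_g_q, zero_comp]
  obtain ⟨φ, hφ⟩ := exists_hom_of_epi X.p (singleMap a ≫ X'.p) fun Z c hc => by
    obtain ⟨b, rfl⟩ := (X.p_eq_zero_iff Z c).1 hc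
    have hga' : singleMap X.g ≫ singleMap a ≫ X'.p = 0 :=
      (Category.assoc _ _ _).symm.trans ((congrArg (· ≫ X'.p) (singleMap_comp X.g a).symm).trans hga)
    exact (congrArg (· ≫ _) (rmap_comp (B := yonedaSingle X.E) (E := yonedaSingle X.N) b
      ((singleFunctor M 0).map X.g))).trans ((Category.assoc _ _ _).trans
        ((congrArg (rmap (B := yonedaSingle X.E) b ≫ ·) hga').trans comp_zero))
  exact ⟨φ, a, hφ, ha.symm⟩

variable (X) in
-- The maps to N that factor through `X.g` are those killed by the connecting morphism from N to the
-- shifted kernel of `X.g`. So `X.Y` is the image of that morphism.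
lemma exists_trianglePresentation : ∃ T : TrianglePresentation X.Y,
    T.K.obj = (singleFunctor M 0).obj X.N ∧
    T.E.obj = ((singleFunctor M 0).obj (kernel X.g))⟦(1 : ℤ)⟧ ∧
    T.N.obj = ((singleFunctor M 0).obj X.E)⟦(1 : ℤ)⟧ := by
  have hS : (ShortComplex.mk (kernel.ι X.g) X.g (kernel.condition X.g)).ShortExact :=
    { exact := ShortComplex.exact_kernel X.g }
  have H : Triangle.mk ((singleFunctor M 0).map (kernel.ι X.g)) ((singleFunctor M 0).map X.g)
    hS.singleδ ∈ distTriang _ := hS.singleTriangle_distinguished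
  obtain ⟨T, hK, hE, hN⟩ := TrianglePresentation.exists_ofKernel (K := yonedaSingle X.N)
    (E := ⟨_, yonedaProp_shift_single (kernel X.g) 1⟩) (N := ⟨_, yonedaProp_shift_single X.E 1⟩)
    (rot_of_distTriang _ (rot_of_distTriang _ H)) X.p fun Z a => by
      refine (X.p_eq_zero_iff Z a).trans ⟨?_, fun ha => ?_⟩
      · rintro ⟨b, rfl⟩
        exact (Category.assoc _ _ _).trans ((congrArg (b ≫ ·) (comp_mor₂_mor₃ H)).trans comp_zero)
      · obtain ⟨b, hb⟩ := exists_lift_mor₂ H a ha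
        exact ⟨b, hb.symm⟩
  exact ⟨T, by rw [hK], by rw [hE], by rw [hN]⟩

lemma cohenMacaulay (X : Bridge π) : cohenMacaulay _ X.Y := by
  obtain ⟨T, _⟩ := X.exists_trianglePresentation
  exact T.cohenMacaulay

lemma finitelyPresented [π.Full] (hS : Function.Surjective π.obj) (X : Bridge π) :
    finitelyPresented S X.F := by
  refine ⟨_, _, representableMap (π.map X.g), X.q, X.map_g_q,
    exact_of_representable _ fun Z x hx => ?_, X.epi_q⟩
  obtain ⟨Z, rfl⟩ := hS Z
  obtain ⟨c, rfl⟩ := exists_representableMap x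
  obtain ⟨c, rfl⟩ := π.map_surjective c
  obtain ⟨b, rfl⟩ := (X.q_eq_zero_iff _ c).1 hx
  exact ⟨representableMap (π.map b), by rw [π.map_comp, representableMap_comp]⟩

/-- A factorization through a projective lifts to the representable of N', hence is given by a map N
→ N' that vanishes on E. As E → N is epi, this map is zero: bridge modules have the same morphisms
in the stable category. -/
lemma eq_zero_of_factors (f : X.Y ⟶ X'.Y) {P : Mod (YonedaCat M)} [Projective P] {a : X.Y ⟶ P}
    {b : P ⟶ X'.Y} (hab : a ≫ b = f) : f = 0 := by
  let c := a ≫ Projective.factorThru b X'.p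
  have hc : c ≫ X'.p = f := by rw [Category.assoc, Projective.factorThru_comp, hab]
  obtain ⟨d, hd⟩ := exists_singleMap (X.p ≫ c)
  have hgd : singleMap (X.g ≫ d) = 0 := by
    rw [singleMap_comp, hd, ← Category.assoc, singleMap_g_p, zero_comp]
  have hgd' : X.g ≫ d = 0 := (singleFunctor M 0).map_injective
    (((rmap_eq_zero_iff (A := yonedaSingle X.E) (B := yonedaSingle X'.N) _).1 hgd).trans
      ((singleFunctor M 0).map_zero _ _).symm)
  have hd₀ : d = 0 := by rwa [← cancel_epi X.g, comp_zero]
  rw [← hc, ← cancel_epi X.p, ← Category.assoc, ← hd, hd₀, comp_zero]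
  exact (congrArg (· ≫ X'.p) ((congrArg rmap ((singleFunctor M 0).map_zero _ _)).trans
    (rmap_zero (A := yonedaSingle X.N) (B := yonedaSingle X'.N)))).trans zero_comp

end Bridge

/-! #### Construction of bridges -/

/-- The module is the cokernel of U(-, E) → U(-, N), obtained by rotating twice the presentation
attached to the short exact sequence of `g`. -/
lemma exists_module_of_epi {E N : M} (g : E ⟶ N) [Epi g] :
    ∃ (Y : Mod (YonedaCat M)) (p : representable (yonedaSingle N) ⟶ Y) (_ : Epi p),
      ∀ (Z : YonedaCat M) (a : Z.obj ⟶ (singleFunctor M 0).obj N),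
        rmap (B := yonedaSingle N) a ≫ p = 0 ↔ ∃ b, b ≫ (singleFunctor M 0).map g = a := by
  have hS : (ShortComplex.mk (kernel.ι g) g (kernel.condition g)).ShortExact :=
    { exact := ShortComplex.exact_kernel g }
  have H : Triangle.mk ((singleFunctor M 0).map (kernel.ι g)) ((singleFunctor M 0).map g)
    hS.singleδ ∈ distTriang _ := hS.singleTriangle_distinguished
  let T := TrianglePresentation.ofTriangle (K := yonedaSingle (kernel g)) (E := yonedaSingle E)
    (N := yonedaSingle N) _ _ _ H
  refine ⟨_, T.rotate.rotate.p, inferInstance, fun Z a =>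
    (T.rotate.rotate.rmap_p_eq_zero_iff a).trans ⟨fun ha => ?_, ?_⟩⟩
  · obtain ⟨b, hb⟩ := exists_lift_mor₂ H a ha
    exact ⟨b, hb.symm⟩
  · rintro ⟨b, rfl⟩
    exact (Category.assoc _ _ _).trans ((congrArg (b ≫ ·) (comp_mor₂_mor₃ H)).trans comp_zero)

section

variable {π : M ⥤ S} [π.Full] [π.Additive] (hS : Function.Surjective π.obj)
  (h₀ : ∀ {X Y : M} (f : X ⟶ Y), π.map f = 0 →
    ∃ (P : M) (_ : Projective P) (a : X ⟶ P) (b : P ⟶ Y), a ≫ b = f)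

include h₀

omit [HasDerivedCategory.{w} M] in
-- A map factoring through a projective object lifts along the epimorphism `g`, so lifting along `g`
-- in the stable category is the same as lifting in `M`.
lemma representableMap_cokernel_eq_zero_iff {E N : M} (g : E ⟶ N) [Epi g] {B : M} (a : B ⟶ N) :
    representableMap (π.map a) ≫ cokernel.π (representableMap (π.map g)) = 0 ↔
      ∃ b, b ≫ g = a := by
  constructor
  · intro h
    have hg : (ShortComplex.mk _ _ (cokernel.condition (representableMap (π.map g)))).Exact :=
      ShortComplex.exact_cokernel _
    obtain ⟨y, hy⟩ := exact_representable_lift hg _ h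
    obtain ⟨y, rfl⟩ := exists_representableMap y
    obtain ⟨y, rfl⟩ := π.map_surjective y
    obtain ⟨P, _, c, d, hcd⟩ := h₀ (a - y ≫ g) (by
      rw [π.map_sub, sub_eq_zero, π.map_comp]
      apply representableMap_injective
      rw [representableMap_comp]
      exact hy.symm)
    refine ⟨y + c ≫ Projective.factorThru d g, ?_⟩
    rw [Preadditive.add_comp, Category.assoc, Projective.factorThru_comp, hcd]
    abel
  · rintro ⟨b, rfl⟩
    rw [π.map_comp, representableMap_comp, Category.assoc, cokernel.condition, comp_zero]

include hS in
lemma exists_bridge_of_finitelyPresented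
    (h₁ : ∀ N : M, ∃ (P : M) (p : P ⟶ N), Epi p ∧ IsZero (π.obj P)) (F : Mod S)
    (hF : finitelyPresented S F) : ∃ X : Bridge π, X.F = F := by
  obtain ⟨A, B, f, q, w, hq, _⟩ := hF
  obtain ⟨N, rfl⟩ := hS A
  obtain ⟨E, rfl⟩ := hS B
  obtain ⟨f, rfl⟩ := exists_representableMap f
  obtain ⟨f, rfl⟩ := π.map_surjective f
  obtain ⟨P, p, _, hP⟩ := h₁ N
  -- Adding an epimorphism from an object that `π` kills makes the presenting map epi without
  -- changing the cokernel over `S`.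
  let g : E ⊞ P ⟶ N := biprod.desc f p
  have : Epi (biprod.inr ≫ g) := by rwa [biprod.inr_desc]
  have : Epi g := epi_of_epi biprod.inr g
  obtain ⟨Y, y, _, hy⟩ := exists_module_of_epi g
  exact ⟨
    { E := E ⊞ P
      N := N
      g := g
      epi_g := inferInstance
      Y := Y
      p := y
      epi_p := inferInstance
      p_eq_zero_iff := hy
      F := F
      q := q
      epi_q := inferInstance
      q_eq_zero_iff := fun B a => by
        constructor
        · intro h
          obtain ⟨b, hb⟩ := exact_representable_lift hq _ h
          obtain ⟨b, rfl⟩ := exists_representableMap b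
          obtain ⟨b, rfl⟩ := π.map_surjective b
          obtain ⟨P', _, c, d, hcd⟩ := h₀ (a - b ≫ f) (by
            rw [π.map_sub, sub_eq_zero, π.map_comp]
            apply representableMap_injective
            rw [representableMap_comp]
            exact hb.symm)
          refine ⟨biprod.lift b (c ≫ Projective.factorThru d p), ?_⟩
          rw [biprod.lift_desc, Category.assoc, Projective.factorThru_comp, hcd]
          abel
        · rintro ⟨b, rfl⟩
          have h : π.map (b ≫ g) = π.map (b ≫ biprod.fst) ≫ π.map f := by
            rw [← π.map_comp, ← sub_eq_zero, ← π.map_sub,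
              show b ≫ g - (b ≫ biprod.fst) ≫ f = (b ≫ biprod.snd) ≫ p by
                simp [g, biprod.desc_eq], π.map_comp, hP.eq_of_src (π.map p) 0, comp_zero]
          rw [h, representableMap_comp, Category.assoc]
          exact (congrArg (_ ≫ ·) w).trans comp_zero }, rfl⟩

lemma exists_bridge_of_trianglePresentation {Y : Mod (YonedaCat M)} (T : TrianglePresentation Y)
    (hK : (degreesGE M 0 ⊓ degreesLE M 0) T.K.obj) (hE : (degreesGE M 0 ⊓ degreesLE M 0) T.E.obj)
    (hN : (degreesGE M 0 ⊓ degreesLE M 0) T.N.obj) :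
    ∃ X : Bridge π, X.Y = cokernel T.rotate.i := by
  have : T.K.obj.IsLE 0 := hK.2
  have : T.E.obj.IsLE 0 := hE.2
  have : T.E.obj.IsGE 0 := hE.1
  have : T.N.obj.IsLE 0 := hN.2
  have : T.N.obj.IsGE 0 := hN.1
  obtain ⟨E, ⟨e⟩⟩ := exists_iso_singleFunctor_obj_of_isGE_of_isLE T.E.obj 0
  obtain ⟨N, ⟨e'⟩⟩ := exists_iso_singleFunctor_obj_of_isGE_of_isLE T.N.obj 0
  obtain ⟨g, hg⟩ := (singleFunctor M 0).map_surjective (e.inv ≫ T.g ≫ e'.hom)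
  -- The next homology group, that of K in degree one, vanishes.
  have hTg : Epi ((homologyFunctor M 0).map T.g) :=
    (HomologySequence.epi_homologyMap_mor₂_iff _ T.distinguished 0 1 rfl).2
      ((isZero_of_isLE T.K.obj 0 1 (by lia)).eq_of_tgt _ _)
  have : Epi ((homologyFunctor M 0).map ((singleFunctor M 0).map g)) := by
    rw [hg, Functor.map_comp, Functor.map_comp]
    infer_instance
  have : Epi g := by
    have h := (singleFunctorCompHomologyFunctorIso M 0).hom.naturality g
    have h' : Epi ((singleFunctorCompHomologyFunctorIso M 0).hom.app E ≫ g) := by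
      refine h ▸ ?_
      exact epi_comp' this inferInstance
    exact epi_of_epi ((singleFunctorCompHomologyFunctorIso M 0).hom.app E) g
  have hge : e.inv ≫ T.g = (singleFunctor M 0).map g ≫ e'.inv := by
    rw [hg, Category.assoc, Category.assoc, e'.hom_inv_id, Category.comp_id]
  let p : representable (yonedaSingle N) ⟶ cokernel T.rotate.i :=
    rmap (A := yonedaSingle N) e'.inv ≫ T.rotate.rotate.p
  have hiso : IsIso (rmap (A := yonedaSingle N) (B := T.N) e'.inv) :=
    ⟨rmap (B := yonedaSingle N) e'.hom,
      (rmap_comp (A := yonedaSingle N) (E := yonedaSingle N) e'.inv e'.hom).symm.trans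
        ((congrArg rmap e'.inv_hom_id).trans (representableMap_id _)),
      (rmap_comp (B := yonedaSingle N) e'.hom e'.inv).symm.trans
        ((congrArg rmap e'.hom_inv_id).trans (representableMap_id _))⟩
  exact ⟨
    { E := E
      N := N
      g := g
      epi_g := inferInstance
      Y := cokernel T.rotate.i
      p := p
      epi_p := epi_comp' inferInstance T.rotate.rotate.epi
      p_eq_zero_iff := fun Z a => by
        have h : rmap (B := yonedaSingle N) a ≫ p =
            rmap (B := T.N) (a ≫ e'.inv) ≫ T.rotate.rotate.p :=
          (Category.assoc _ _ _).symm.trans (congrArg (· ≫ T.rotate.rotate.p)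
            (rmap_comp (B := yonedaSingle N) a e'.inv).symm)
        rw [h, T.rotate.rotate.rmap_p_eq_zero_iff]
        constructor
        · intro ha
          obtain ⟨b, hb⟩ := exists_lift_mor₂ T.distinguished _ ha
          refine ⟨b ≫ e.hom, ?_⟩
          rw [← cancel_mono e'.inv, Category.assoc, ← hge, Category.assoc, e.hom_inv_id_assoc, hb]
        · rintro ⟨b, rfl⟩
          have hb : (b ≫ (singleFunctor M 0).map g) ≫ e'.inv = (b ≫ e.inv) ≫ T.g := by
            rw [Category.assoc, ← hge, Category.assoc]
          exact (congrArg (· ≫ T.h) hb).trans ((Category.assoc _ _ _).trans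
            ((congrArg ((b ≫ e.inv) ≫ ·) (comp_mor₂_mor₃ T.distinguished)).trans comp_zero))
      F := cokernel (representableMap (π.map g))
      q := cokernel.π _
      epi_q := inferInstance
      q_eq_zero_iff := fun B a => representableMap_cokernel_eq_zero_iff h₀ g a }, rfl⟩

end

/-! #### The equivalence -/

/-- The category of bridges. -/
abbrev BridgeCat (π : M ⥤ S) := InducedCategory (cohenMacaulay (YonedaCat M)).FullSubcategory
  fun X : Bridge π => ⟨X.Y, X.cohenMacaulay⟩

/-- The functor from bridges to finitely presented modules. -/
def bridgeToFPMod (π : M ⥤ S) [π.Full] [π.Additive] (hS : Function.Surjective π.obj) :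
    BridgeCat π ⥤ FPMod S where
  obj X := ⟨X.F, X.finitelyPresented hS⟩
  map f := ObjectProperty.homMk (Bridge.exists_corresponds_left hS f.hom.hom).choose
  map_id X := ObjectProperty.hom_ext _ ((Bridge.corresponds_eq_iff
    (Bridge.exists_corresponds_left hS (𝟙 X.Y)).choose_spec (Bridge.corresponds_id X)).1 rfl)
  map_comp f g := ObjectProperty.hom_ext _ ((Bridge.corresponds_eq_iff
    (Bridge.exists_corresponds_left hS (f.hom.hom ≫ g.hom.hom)).choose_spec
    ((Bridge.exists_corresponds_left hS f.hom.hom).choose_spec.comp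
      (Bridge.exists_corresponds_left hS g.hom.hom).choose_spec)).1 rfl)

section

variable (π : M ⥤ S) [π.Full] [π.Additive] (hS : Function.Surjective π.obj)

instance : (bridgeToFPMod π hS).Faithful where
  map_injective {X Y} f g h := by
    ext1
    ext1
    exact (Bridge.corresponds_eq_iff (Bridge.exists_corresponds_left hS f.hom.hom).choose_spec
      (Bridge.exists_corresponds_left hS g.hom.hom).choose_spec).2 (congrArg (·.hom) h)

instance : (bridgeToFPMod π hS).Full where
  map_surjective {X Y} ψ := by
    obtain ⟨φ, hφ⟩ := Bridge.exists_corresponds_right ψ.hom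
    exact ⟨InducedCategory.homMk (ObjectProperty.homMk φ), ObjectProperty.hom_ext _
      ((Bridge.corresponds_eq_iff (Bridge.exists_corresponds_left hS φ).choose_spec hφ).1 rfl)⟩

end

end Heart

/-! ### Comparison of bridges with the heart -/

section Heart

open DerivedCategory

variable {M : Type u} [Category.{v} M] [Abelian M] [HasDerivedCategory.{w} M] [EnoughInjectives M]
  {S : Type u} [Category.{v} S] [Preadditive S]
  [HasShift (StableCM (YonedaCat M)) ℤ]
  [∀ n : ℤ, (shiftFunctor (StableCM (YonedaCat M)) n).Additive]
  [Pretriangulated (StableCM (YonedaCat M))]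
  (hH : IsHappelTriangulation (cohenMacaulay (YonedaCat M))) (π : M ⥤ S)

omit [EnoughInjectives M] in
include hH in
-- The bridge module has terms N, (ker g)[1], E[1]. Desuspending twice rotates these back to the
-- short exact sequence ker g, E, N in degree zero.
lemma hasPresentation_of_bridge (X : Bridge π) :
    HasPresentation (degreesGE M 0 ⊓ degreesLE M 0) (degreesGE M 0 ⊓ degreesLE M 0)
      (degreesGE M 0 ⊓ degreesLE M 0)
      (((toStable _).obj ⟨X.Y, X.cohenMacaulay⟩)⟦(-1 : ℤ)⟧⟦(-1 : ℤ)⟧) := by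
  obtain ⟨T, hK, hE, hN⟩ := X.exists_trianglePresentation
  have h₀ (A : M) : (degreesGE M 0 ⊓ degreesLE M 0) ((singleFunctor M 0).obj A) :=
    ⟨inferInstanceAs (((singleFunctor M 0).obj A).IsGE 0),
      inferInstanceAs (((singleFunctor M 0).obj A).IsLE 0)⟩
  have h₁ (A : M) : (degreesGE M (-1) ⊓ degreesLE M (-1)) (((singleFunctor M 0).obj A)⟦(1 : ℤ)⟧) :=
    ⟨degreesGE_shift (by lia) _ (h₀ A).1, degreesLE_shift (by lia) _ (h₀ A).2⟩
  have h₂ (K : DerivedCategory M) (hK : (degreesGE M (-1) ⊓ degreesLE M (-1)) K) :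
      (degreesGE M 0 ⊓ degreesLE M 0) (K⟦(-1 : ℤ)⟧) :=
    ⟨degreesGE_shift (by lia) _ hK.1, degreesLE_shift (by lia) _ hK.2⟩
  exact ((T.hasPresentation (hK ▸ h₀ _) (hE ▸ h₁ _) (hN ▸ h₁ _)).invShift hH h₂).invShift hH h₂

/-- The functor from bridges to the stable category, shifted into the heart. -/
abbrev bridgeToStable : BridgeCat π ⥤ StableCM (YonedaCat M) :=
  (inducedFunctor _ ⋙ toStable _) ⋙ shiftFunctor _ (-1 : ℤ) ⋙ shiftFunctor _ (-1 : ℤ)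

omit [EnoughInjectives M] [HasShift (StableCM (YonedaCat M)) ℤ]
  [∀ n : ℤ, (shiftFunctor (StableCM (YonedaCat M)) n).Additive]
  [Pretriangulated (StableCM (YonedaCat M))] in
lemma faithful_inducedFunctor_toStable :
    (inducedFunctor (fun X : Bridge π => (⟨X.Y, X.cohenMacaulay⟩ :
      (cohenMacaulay (YonedaCat M)).FullSubcategory)) ⋙ toStable _).Faithful where
  map_injective {X X'} f g h := by
    obtain ⟨P, _, a, b, hab⟩ := (toStable_map_eq_iff _ _).1 h
    ext1
    ext1
    exact sub_eq_zero.1 (Bridge.eq_zero_of_factors (X := X) (X' := X') _ hab)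

/-- The functor from bridges to the heart. -/
abbrev bridgeToHeart : BridgeCat π ⥤ (tStructure hH).heart.FullSubcategory :=
  ObjectProperty.lift _ (bridgeToStable π) fun X =>
    heart_of_hasPresentation hH (hasPresentation_of_bridge hH π X)

instance : (bridgeToHeart hH π).Faithful :=
  have := faithful_inducedFunctor_toStable π
  have : (bridgeToStable π).Faithful := Functor.Faithful.comp _ _
  inferInstance

variable [π.Full] [π.Additive] (hS : Function.Surjective π.obj)
  (h₀ : ∀ {X Y : M} (f : X ⟶ Y), π.map f = 0 →
    ∃ (P : M) (_ : Projective P) (a : X ⟶ P) (b : P ⟶ Y), a ≫ b = f)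

include h₀

/-- An object of the heart has a presentation in degree zero; its double suspension is the double
cosyzygy, which is a bridge module, and shifting back recovers the object. -/
lemma essSurj_bridgeToHeart : (bridgeToHeart hH π).EssSurj where
  mem_essImage X := by
    obtain ⟨Y, T, hK, hE, hN, ⟨e⟩⟩ := hasPresentation_of_heart hH X.property
    obtain ⟨B, hB⟩ := exists_bridge_of_trianglePresentation h₀ T hK hE hN
    obtain ⟨e₁⟩ := nonempty_shift_iso hH T
    obtain ⟨e₂⟩ := nonempty_shift_iso hH T.rotate
    have hB' : (⟨B.Y, B.cohenMacaulay⟩ : (cohenMacaulay (YonedaCat M)).FullSubcategory) =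
        ⟨_, T.rotate.rotate.cohenMacaulay⟩ := by
      congr 1
    let e₃ : X.obj⟦(1 : ℤ)⟧⟦(1 : ℤ)⟧ ≅ (toStable _).obj ⟨B.Y, B.cohenMacaulay⟩ :=
      (shiftFunctor _ (1 : ℤ)).mapIso ((shiftFunctor _ (1 : ℤ)).mapIso e ≪≫ e₁) ≪≫ e₂ ≪≫
        eqToIso (congrArg (toStable _).obj hB'.symm)
    let s (Z : StableCM (YonedaCat M)) : Z⟦(1 : ℤ)⟧⟦(-1 : ℤ)⟧ ≅ Z :=
      (shiftFunctorCompIsoId _ (1 : ℤ) (-1) (by simp)).app Z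
    let e₄ : (bridgeToStable π).obj B ≅ X.obj :=
      (shiftFunctor _ (-1 : ℤ)).mapIso ((shiftFunctor _ (-1 : ℤ)).mapIso e₃.symm ≪≫ s _) ≪≫ s _
    exact ⟨B, ⟨(tStructure hH).heart.fullyFaithfulι.preimageIso e₄⟩⟩

omit [EnoughInjectives M] [HasShift (StableCM (YonedaCat M)) ℤ]
  [∀ n : ℤ, (shiftFunctor (StableCM (YonedaCat M)) n).Additive]
  [Pretriangulated (StableCM (YonedaCat M))] in
include hS in
lemma essSurj_bridgeToFPMod
    (h₁ : ∀ N : M, ∃ (P : M) (p : P ⟶ N), Epi p ∧ IsZero (π.obj P)) :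
    (bridgeToFPMod π hS).EssSurj where
  mem_essImage F := by
    obtain ⟨B, hB⟩ := exists_bridge_of_finitelyPresented hS h₀ h₁ F.obj F.property
    obtain ⟨F, hF⟩ := F
    obtain rfl : B.F = F := hB
    exact ⟨B, ⟨Iso.refl _⟩⟩

include hS in
/-- The heart of the t-structure. -/
theorem nonempty_heart_equivalence
    (h₁ : ∀ N : M, ∃ (P : M) (p : P ⟶ N), Epi p ∧ IsZero (π.obj P)) :
    Nonempty ((tStructure hH).heart.FullSubcategory ≌ FPMod S) := by
  have := essSurj_bridgeToHeart hH π h₀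
  have := essSurj_bridgeToFPMod π hS h₀ h₁
  have h₂ : (bridgeToHeart hH π).IsEquivalence := { }
  have h₃ : (bridgeToFPMod π hS).IsEquivalence := { }
  exact ⟨(bridgeToHeart hH π).asEquivalence.symm.trans (bridgeToFPMod π hS).asEquivalence⟩

end Heart

/-! ### Finitely generated modules -/

section FGModuleCat

variable {Λ : Type u} [Ring Λ]

lemma exists_free_epi (N : FGModuleCat.{u} Λ) :
    ∃ (P : FGModuleCat.{u} Λ) (p : P ⟶ N), Projective P.obj ∧ Function.Surjective p.hom.hom := by
  obtain ⟨n, f, hf⟩ := Module.Finite.exists_fin' Λ N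
  exact ⟨FGModuleCat.of Λ (Fin n → Λ), FGModuleCat.ofHom f,
    ModuleCat.projective_of_free (Pi.basisFun Λ (Fin n)), hf⟩

variable [IsNoetherianRing Λ]

lemma surjective_of_epi {X Y : FGModuleCat.{u} Λ} (f : X ⟶ Y) [Epi f] :
    Function.Surjective f.hom.hom := by
  have : Epi ((forget₂ (FGModuleCat Λ) (ModuleCat Λ)).map f) := inferInstance
  exact (ModuleCat.epi_iff_surjective _).1 this

lemma injective_of_mono {X Y : FGModuleCat.{u} Λ} (f : X ⟶ Y) [Mono f] :
    Function.Injective f.hom.hom := by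
  have : Mono ((forget₂ (FGModuleCat Λ) (ModuleCat Λ)).map f) := inferInstance
  exact (ModuleCat.mono_iff_injective _).1 this

lemma epi_of_surjective {X Y : FGModuleCat.{u} Λ} (f : X ⟶ Y)
    (h : Function.Surjective f.hom.hom) : Epi f :=
  (forget₂ (FGModuleCat Λ) (ModuleCat Λ)).epi_of_epi_map
    ((ModuleCat.epi_iff_surjective _).2 h)

lemma mono_of_injective {X Y : FGModuleCat.{u} Λ} (f : X ⟶ Y)
    (h : Function.Injective f.hom.hom) : Mono f :=
  (forget₂ (FGModuleCat Λ) (ModuleCat Λ)).mono_of_mono_map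
    ((ModuleCat.mono_iff_injective _).2 h)

lemma projective_of_projective_obj {P : FGModuleCat.{u} Λ} [Projective P.obj] : Projective P where
  factors {E X} f e _ := by
    have : Epi e.hom := (ModuleCat.epi_iff_surjective _).2 (surjective_of_epi e)
    exact ⟨ObjectProperty.homMk (Projective.factorThru f.hom e.hom),
      ObjectProperty.hom_ext _ (Projective.factorThru_comp f.hom e.hom)⟩

lemma injective_of_injective_obj {J : FGModuleCat.{u} Λ} [Injective J.obj] : Injective J where
  factors {X E} f e _ := by
    have : Mono e.hom := (ModuleCat.mono_iff_injective _).2 (injective_of_mono e)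
    exact ⟨ObjectProperty.homMk (Injective.factorThru f.hom e.hom),
      ObjectProperty.hom_ext _ (Injective.comp_factorThru f.hom e.hom)⟩

/-- The stable relation allows arbitrary projective modules; lifting along a finitely generated free
cover of Y replaces them by a finitely generated one. -/
lemma exists_projective_of_toStable_map_eq_zero {X Y : FGModuleCat.{u} Λ} (f : X ⟶ Y)
    (hf : (toStable (ModuleCat.isFG.{u} Λ)).map f = 0) :
    ∃ (P : FGModuleCat.{u} Λ) (_ : Projective P) (a : X ⟶ P) (b : P ⟶ Y), a ≫ b = f := by
  obtain ⟨P, _, a, b, hab⟩ := (toStable_map_eq_iff f 0).1 (hf.trans (Functor.map_zero _ _ _).symm)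
  obtain ⟨P', p, _, hp⟩ := exists_free_epi Y
  have : Epi p.hom := (ModuleCat.epi_iff_surjective _).2 hp
  refine ⟨P', projective_of_projective_obj,
    ObjectProperty.homMk (a ≫ Projective.factorThru b p.hom), p, ObjectProperty.hom_ext _ ?_⟩
  change (a ≫ Projective.factorThru b p.hom) ≫ p.hom = _
  rw [Category.assoc, Projective.factorThru_comp, hab]
  exact sub_zero f.hom

lemma exists_epi_of_isZero_toStable (N : FGModuleCat.{u} Λ) :
    ∃ (P : FGModuleCat.{u} Λ) (p : P ⟶ N), Epi p ∧
      IsZero ((toStable (ModuleCat.isFG.{u} Λ)).obj P) := by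
  obtain ⟨P, p, _, hp⟩ := exists_free_epi N
  refine ⟨P, p, epi_of_surjective p hp, ?_⟩
  rw [IsZero.iff_id_eq_zero, ← CategoryTheory.Functor.map_id, ← (toStable _).map_zero,
    toStable_map_eq_iff]
  exact ⟨P.obj, inferInstance, 𝟙 _, 𝟙 _, (Category.comp_id _).trans (sub_zero (𝟙 P.obj)).symm⟩

/-- The coinduced module Hom_k(Λ, A) is finite-dimensional over k, hence finitely generated over Λ.
-/
lemma finite_coextendScalars (k : Type v) [Field k] (Λ : Type u) [Ring Λ] [Algebra k Λ]
    [FiniteDimensional k Λ] (A : ModuleCat.{u} Λ) (hA : Module.Finite Λ A) :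
    Module.Finite Λ ((ModuleCat.coextendScalars (algebraMap k Λ)).obj
      ((ModuleCat.restrictScalars (algebraMap k Λ)).obj A)) := by
  let f := algebraMap k Λ
  let V := (ModuleCat.restrictScalars f).obj A
  let J := (ModuleCat.coextendScalars f).obj V
  let W := (ModuleCat.restrictScalars f).obj (ModuleCat.of Λ Λ)
  let _ : Module k A := Module.compHom A f
  have : IsScalarTower k Λ A := ⟨fun c s a => by
    rw [Algebra.smul_def, mul_smul]
    rfl⟩
  have hV : Module.Finite k V := Module.Finite.trans (R := k) Λ A
  have hW : Module.Finite k W := by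
    refine Module.Finite.of_surjective
      ({ toFun := fun s => s
         map_add' := fun _ _ => rfl
         map_smul' := fun c s => Algebra.smul_def c s } : Λ →ₗ[k] W) fun s => ⟨s, rfl⟩
  let _ : Module k J := Module.compHom J f
  have : IsScalarTower k Λ J := ⟨fun c s a => by
    rw [Algebra.smul_def, mul_smul]
    rfl⟩
  let e := ModuleCat.CoextendScalars.equiv f V
  let e' : J →ₗ[k] (W →ₗ[k] V) :=
    { toFun := fun x => e x
      map_add' := map_add e
      map_smul' := fun c x => by
        ext s
        refine (ModuleCat.CoextendScalars.smul_apply f V x (f c) s).trans ?_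
        refine Eq.trans ?_ ((e x).map_smul c s)
        let s' : Λ := s
        -- Λ acts on Hom_k(Λ, A) through right multiplication on the argument, so linearity over k
        -- uses that the image of k is central.
        exact congrArg (fun t : Λ => e x t) (Algebra.commutes c s').symm }
  have : Module.Finite k J := Module.Finite.of_injective e' e.injective
  exact Module.Finite.of_restrictScalars_finite k Λ J

/-- Vector spaces are injective, and coinduction preserves injectives because it is right adjoint to
the exact functor of restriction. The unit A → Hom_k(Λ, A) is injective, as evaluation at 1 recovers
the element. -/
lemma enoughInjectives_fgModuleCat (k : Type v) [Field k] (Λ : Type u) [Ring Λ] [Algebra k Λ]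
    [FiniteDimensional k Λ] [IsNoetherianRing Λ] : EnoughInjectives (FGModuleCat.{u} Λ) where
  presentation A := by
    let f := algebraMap k Λ
    let V := (ModuleCat.restrictScalars f).obj A.obj
    have : Module.Injective k V := Module.injective_of_isSemisimpleRing k V
    have : Injective V := Module.injective_object_of_injective_module k V
    let J := (ModuleCat.coextendScalars f).obj V
    have : Injective J := Injective.injective_of_adjoint
      (ModuleCat.restrictCoextendScalarsAdj f) V
    let ι : A.obj ⟶ J := (ModuleCat.restrictCoextendScalarsAdj f).unit.app A.obj
    have hι : Function.Injective ι.hom := by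
      refine (injective_iff_map_eq_zero ι.hom).2 fun a ha => ?_
      have h : ModuleCat.CoextendScalars.equiv f V (ι.hom a) (1 : Λ) = (1 : Λ) • a := rfl
      rw [ha, map_zero, one_smul] at h
      exact h.symm
    have hJ : Module.Finite Λ J := finite_coextendScalars k Λ A.obj A.property
    let J' : FGModuleCat.{u} Λ := ⟨J, hJ⟩
    exact ⟨{
      J := J'
      injective := injective_of_injective_obj
      f := ObjectProperty.homMk ι
      mono := mono_of_injective _ hι }⟩

end FGModuleCat

end YonedaTStructure

end

open YonedaTStructure
theorem theorem4p9 (k : Type v) [Field k] (Λ : Type u) [Ring Λ] [Algebra k Λ]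
    [FiniteDimensional k Λ] :
    haveI : IsNoetherianRing Λ := IsNoetherianRing.of_finite k Λ
    ∀ [HasDerivedCategory.{w} (FGModuleCat.{u} Λ)],
      -- the modules `U₀(-, A)` are Cohen-Macaulay, so that they are objects of the stable category
      ∃ hU₀ : ∀ A : FGModuleCat.{u} Λ,
        cohenMacaulay (YonedaCat (FGModuleCat.{u} Λ)) (degreeZeroModule A),
      -- the triangulated structure of the stable category
      ∃ (_ : HasShift (StableCM (YonedaCat (FGModuleCat.{u} Λ))) ℤ)
        (_ : ∀ n : ℤ, (shiftFunctor (StableCM (YonedaCat (FGModuleCat.{u} Λ))) n).Additive)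
        (_ : Pretriangulated (StableCM (YonedaCat (FGModuleCat.{u} Λ)))),
        IsTriangulated (StableCM (YonedaCat (FGModuleCat.{u} Λ))) ∧
        IsHappelTriangulation (cohenMacaulay (YonedaCat (FGModuleCat.{u} Λ))) ∧
        -- the t-structure
        ∃ t : Triangulated.TStructure (StableCM (YonedaCat (FGModuleCat.{u} Λ))),
          (∀ X, t.le 0 X ↔ ∀ (A : FGModuleCat.{u} Λ) (i : ℤ), i < 0 →
            ∀ f : X ⟶ ((toStable _).obj ⟨degreeZeroModule A, hU₀ A⟩)⟦i⟧, f = 0) ∧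
          (∀ X, t.ge 0 X ↔ ∀ (A : FGModuleCat.{u} Λ) (i : ℤ), 0 < i →
            ∀ f : X ⟶ ((toStable _).obj ⟨degreeZeroModule A, hU₀ A⟩)⟦i⟧, f = 0) ∧
          (∀ X, t.bounded X) ∧
          Nonempty (t.heart.FullSubcategory ≌ FPMod (Stable (ModuleCat.isFG.{u} Λ))) := by
  have : IsNoetherianRing Λ := IsNoetherianRing.of_finite k Λ
  intro _
  have := enoughInjectives_fgModuleCat k Λ
  obtain ⟨hs, ha, hp, ht, hH⟩ := exists_isHappelTriangulation
    (isFrobenius_yoneda (FGModuleCat.{u} Λ))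
  refine ⟨cohenMacaulay_degreeZeroModule, hs, ha, hp, ht, hH, tStructure hH, fun X => ?_,
    fun X => ?_, tStructure_bounded hH, ?_⟩
  · change (∀ (A : FGModuleCat.{u} Λ) (i : ℤ), i < -0 → _) ↔ _
    rw [neg_zero]
  · change (∀ (A : FGModuleCat.{u} Λ) (i : ℤ), -0 < i → _) ↔ _
    rw [neg_zero]
  -- Here `π` is the projection to the stable category of finitely generated modules; free modules
  -- supply the epimorphisms from objects that it kills.
  · exact nonempty_heart_equivalence hH (toStable (ModuleCat.isFG.{u} Λ)) toStable_obj_surjective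
      exists_projective_of_toStable_map_eq_zero exists_epi_of_isZero_toStable
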